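/- **Theorem 1.1.** Let $M\ge 2$ be an integer and $a,b\in(0,\frac1M)$. For $k=1,\dots,M$ put $$\Omega_{\alpha_k}=[(k-1)a,ka)\times[0,1]\times[0,1],\qquad \Omega_{\beta_k}=[Ma,1]\times I_k\times[0,1],$$ where $I_k=[\frac{k-1}M,\frac kM)$ for $k<M$ and $I_M=[\frac{M-1}M,1]$. These $2M$ sets partition $[0,1]^3$. The heterochaos baker map $f=f_{a,b}\colon[0,1]^3\to[0,1]^3$ is $$f(x_u,x_c,x_s)=\begin{cases}\left(\frac{x_u-(k-1)a}{a},\ \frac{x_c}{M}+\frac{k-1}{M},\ (1-Mb)x_s\right)&\text{on }\Omega_{\alpha_k},\\[1mm]\left(\frac{x_u-Ma}{1-Ma},\ Mx_c-k+1,\ bx_s+1+b(k-M-1)\right)&\text{on }\Omega_{\beta_k}.\end{cases}$$ Let $U$ be the union of the interiors in $\mathbb R^3$ of these $2M$ sets and $\Lambda=\bigcap_{n\in\mathbb Z}f^{-n}(U)$, where $f^{-n}(U)$ denotes the image of $U$ under $f^{|n|}$ if $n<0$. For $n\ge1$, let ${\rm Per}_{\alpha,n}(f)$ (resp. ${\rm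 Per}_{\beta,n}(f)$) be the set of all $x\in\Lambda$ such that $f^n(x)=x$, $f^n$ is differentiable on a neighborhood of $x$, no eigenvalue of $Df^n(x)$ has modulus $1$, and exactly $1$ (resp. exactly $2$) of the eigenvalues, counted with multiplicity, have modulus greater than $1$. These points are called $1$-unstable (resp. $2$-unstable) periodic points of period $n$. A measure of maximal entropy (MME) of $f$ is an $f$-invariant Borel probability measure on $[0,1]^3$ whose measure-theoretic entropy is finite and equal to the supremum of the entropies of all $f$-invariant Borel probability measures on $[0,1]^3$. Then $f$ has exactly two ergodic MMEs. They have entropy $\log(M+1)$, and they can be labelled $\mu_\alpha\ne\mu_\beta$ so that $$\mu_\alpha(\Omega_{\alpha_k})=\mu_\beta(\Omega_{\beta_k})=\frac1{M+1}\quad\text{for }k=1,\dots,M.$$ The sets ${\rm Per}_{\alpha,n}(f)$ and ${\rm Per}_{\beta,n}(f)$ are finite for all $n\ge1$, and for any continuous function $\varphi\colon[0,1]^3\to\mathbb R$ we have $$\lim_{n\to\infty}\frac{\sum_{x\in{\rm Per}_{\alpha,n}(f)}\varphi(x)}{\#{\rm Per}_{\alpha,n}(f)}=\int\varphi\,{\rm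 d}\mu_{\alpha},\qquad \lim_{n\to\infty}\frac{\sum_{x\in{\rm Per}_{\beta,n}(f)}\varphi(x)}{\#{\rm Per}_{\beta,n}(f)}=\int\varphi\,{\rm d}\mu_{\beta},$$ and $$\lim_{n\to\infty}\frac{\sum_{x\in{\rm Per}_{\alpha,n}(f)\cup{\rm Per}_{\beta,n}(f)}\varphi(x)}{\#({\rm Per}_{\alpha,n}(f)\cup{\rm Per}_{\beta,n}(f))}=\frac12\int\varphi\,{\rm d}\mu_{\alpha}+\frac12\int\varphi\,{\rm d}\mu_{\beta}.$$ (For the finitely many $n$ for which a denominator vanishes, the quotient is read as $0$.) -/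

import Mathlib

open Set Filter Topology MeasureTheory

noncomputable section

namespace Heterochaos

/-! ## The heterochaos baker map

Points of `ℝ × ℝ × ℝ` are written `(x_u, x_c, x_s)`. The `M` symbols of each of the two
alphabets are indexed by `k : Fin M`, that is, from `0` to `M - 1`. -/

/-- The unit cube `[0,1]³`, with its Borel structure inherited from `ℝ³`. -/
abbrev cube : Set (ℝ × ℝ × ℝ) := Icc 0 1 ×ˢ Icc 0 1 ×ˢ Icc 0 1

/-- The domain `Ω_{α_{k+1}} = [k a, (k+1) a) × [0,1] × [0,1]`. -/
def domAlpha (M : ℕ) (a : ℝ) (k : Fin M) : Set (ℝ × ℝ × ℝ) :=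
  Ico ((k : ℝ) * a) (((k : ℝ) + 1) * a) ×ˢ Icc 0 1 ×ˢ Icc 0 1

/-- The domain `Ω_{β_{k+1}} = [M a, 1] × [k/M, (k+1)/M) × [0,1]`, where the middle interval is
closed on the right when `k + 1 = M`. -/
def domBeta (M : ℕ) (a : ℝ) (k : Fin M) : Set (ℝ × ℝ × ℝ) :=
  Icc ((M : ℝ) * a) 1 ×ˢ
    (if (k : ℕ) + 1 = M then Icc ((k : ℝ) / M) 1 else Ico ((k : ℝ) / M) (((k : ℝ) + 1) / M)) ×ˢ
    Icc 0 1

/-- The affine formula of the map on `Ω_{α_{k+1}}`. -/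
def branchAlpha (M : ℕ) (a b : ℝ) (k : Fin M) (p : ℝ × ℝ × ℝ) : ℝ × ℝ × ℝ :=
  ((p.1 - (k : ℝ) * a) / a, p.2.1 / M + (k : ℝ) / M, (1 - (M : ℝ) * b) * p.2.2)

/-- The affine formula of the map on `Ω_{β_{k+1}}`. -/
def branchBeta (M : ℕ) (a b : ℝ) (k : Fin M) (p : ℝ × ℝ × ℝ) : ℝ × ℝ × ℝ :=
  ((p.1 - (M : ℝ) * a) / (1 - (M : ℝ) * a), (M : ℝ) * p.2.1 - (k : ℝ),
    b * p.2.2 + 1 + b * ((k : ℝ) - M))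

open Classical in
/-- The formula of the heterochaos baker map, as a map of `ℝ³`. The domains form a partition of
the cube; the value outside of the cube (where the map is set to be the identity) plays no role. -/
def bakerFun (M : ℕ) (a b : ℝ) (p : ℝ × ℝ × ℝ) : ℝ × ℝ × ℝ :=
  if h : ∃ k, p ∈ domAlpha M a k then branchAlpha M a b h.choose p
  else if h : ∃ k, p ∈ domBeta M a k then branchBeta M a b h.choose p
  else p

theorem domAlpha_unique {M : ℕ} {a : ℝ} (ha : 0 < a) {k l : Fin M} {p : ℝ × ℝ × ℝ}
    (hk : p ∈ domAlpha M a k) (hl : p ∈ domAlpha M a l) : k = l := by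
  have h1 := hk.1
  have h2 := hl.1
  simp only [mem_Ico] at h1 h2
  have e1 : (k : ℝ) < (l : ℝ) + 1 := lt_of_mul_lt_mul_right (h1.1.trans_lt h2.2) ha.le
  have e2 : (l : ℝ) < (k : ℝ) + 1 := lt_of_mul_lt_mul_right (h2.1.trans_lt h1.2) ha.le
  norm_cast at e1 e2
  exact Fin.ext (by omega)

theorem domBeta_bounds {M : ℕ} {a : ℝ} {k : Fin M} {p : ℝ × ℝ × ℝ}
    (hk : p ∈ domBeta M a k) :
    (k : ℝ) ≤ M * p.2.1 ∧ M * p.2.1 ≤ (k : ℝ) + 1 ∧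
      ((k : ℕ) + 1 ≠ M → M * p.2.1 < (k : ℝ) + 1) := by
  have hM : (0 : ℝ) < M := by exact_mod_cast k.pos
  obtain ⟨-, h, -⟩ := hk
  by_cases hkM : (k : ℕ) + 1 = M
  · rw [if_pos hkM, mem_Icc, div_le_iff₀ hM] at h
    have : (M : ℝ) = (k : ℝ) + 1 := by exact_mod_cast hkM.symm
    exact ⟨by linarith [h.1], by nlinarith [h.2], fun h' => absurd hkM h'⟩
  · rw [if_neg hkM, mem_Ico, div_le_iff₀ hM, lt_div_iff₀ hM] at h
    exact ⟨by linarith [h.1], by linarith [h.2], fun _ => by linarith [h.2]⟩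

theorem domBeta_unique {M : ℕ} {a : ℝ} {k l : Fin M} {p : ℝ × ℝ × ℝ}
    (hk : p ∈ domBeta M a k) (hl : p ∈ domBeta M a l) : k = l := by
  obtain ⟨k1, -, k3⟩ := domBeta_bounds hk
  obtain ⟨l1, -, l3⟩ := domBeta_bounds hl
  have key : ∀ i j : Fin M, (i : ℝ) ≤ M * p.2.1 →
      ((j : ℕ) + 1 ≠ M → M * p.2.1 < (j : ℝ) + 1) → (i : ℕ) ≤ j := by
    intro i j hi hj
    by_cases h : (j : ℕ) + 1 = M
    · have := i.isLt
      omega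
    · have h' : (i : ℝ) < (j : ℝ) + 1 := hi.trans_lt (hj h)
      norm_cast at h'
      omega
  exact Fin.ext (le_antisymm (key k l k1 l3) (key l k l1 k3))

theorem disjoint_domAlpha_domBeta {M : ℕ} {a : ℝ} (ha : 0 < a) {k l : Fin M} {p : ℝ × ℝ × ℝ}
    (hk : p ∈ domAlpha M a k) : p ∉ domBeta M a l := by
  intro hl
  have h1 := hk.1.2
  have h2 := hl.1.1
  have h3 : ((k : ℝ) + 1) ≤ M := by exact_mod_cast k.isLt
  nlinarith

theorem bakerFun_of_mem_domAlpha {M : ℕ} {a b : ℝ} (ha : 0 < a) {k : Fin M} {p : ℝ × ℝ × ℝ}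
    (hk : p ∈ domAlpha M a k) : bakerFun M a b p = branchAlpha M a b k p := by
  have h : ∃ k, p ∈ domAlpha M a k := ⟨k, hk⟩
  rw [bakerFun, dif_pos h, domAlpha_unique ha h.choose_spec hk]

theorem bakerFun_of_mem_domBeta {M : ℕ} {a b : ℝ} (ha : 0 < a) {k : Fin M} {p : ℝ × ℝ × ℝ}
    (hk : p ∈ domBeta M a k) : bakerFun M a b p = branchBeta M a b k p := by
  have h0 : ¬ ∃ k, p ∈ domAlpha M a k := fun ⟨_, hl⟩ => disjoint_domAlpha_domBeta ha hl hk
  have h : ∃ k, p ∈ domBeta M a k := ⟨k, hk⟩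
  rw [bakerFun, dif_neg h0, dif_pos h, domBeta_unique h.choose_spec hk]

/-- The domains cover the cube. -/
theorem exists_mem_dom {M : ℕ} {a : ℝ} (hM : 2 ≤ M) (ha : 0 < a)
    {p : ℝ × ℝ × ℝ} (hp : p ∈ cube) :
    (∃ k, p ∈ domAlpha M a k) ∨ ∃ k, p ∈ domBeta M a k := by
  obtain ⟨⟨hu0, hu1⟩, ⟨hc0, hc1⟩, hs⟩ := hp
  have hM' : (0 : ℝ) < M := by exact_mod_cast (by omega : 0 < M)
  rcases lt_or_ge p.1 (M * a) with h | h
  · left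
    have h0 : 0 ≤ p.1 / a := div_nonneg hu0 ha.le
    have h1 := Nat.floor_le h0
    have h2 := Nat.lt_floor_add_one (p.1 / a)
    refine ⟨⟨⌊p.1 / a⌋₊, (Nat.floor_lt h0).2 ((div_lt_iff₀ ha).2 h)⟩, ⟨?_, ?_⟩, ⟨hc0, hc1⟩, hs⟩
    · exact (le_div_iff₀ ha).1 h1
    · exact (div_lt_iff₀ ha).1 h2
  · right
    rcases hc1.lt_or_eq with hc | hc
    · have h0 : 0 ≤ M * p.2.1 := mul_nonneg hM'.le hc0
      have h1 := Nat.floor_le h0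
      have h2 := Nat.lt_floor_add_one (M * p.2.1)
      refine ⟨⟨⌊M * p.2.1⌋₊, (Nat.floor_lt h0).2 (by nlinarith)⟩, ⟨h, hu1⟩, ?_, hs⟩
      split_ifs
      · exact ⟨(div_le_iff₀ hM').2 (by simpa [mul_comm] using h1), hc1⟩
      · exact ⟨(div_le_iff₀ hM').2 (by simpa [mul_comm] using h1),
          (lt_div_iff₀ hM').2 (by simpa [mul_comm] using h2)⟩
    · refine ⟨⟨M - 1, by omega⟩, ⟨h, hu1⟩, ?_, hs⟩
      rw [if_pos (by simp only; omega)]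
      refine ⟨?_, hc1⟩
      rw [hc, div_le_one hM']
      exact_mod_cast Nat.sub_le M 1

theorem bakerFun_mapsTo {M : ℕ} {a b : ℝ} (hM : 2 ≤ M)
    (ha : a ∈ Ioo 0 (1 / (M : ℝ))) (hb : b ∈ Ioo 0 (1 / (M : ℝ))) :
    MapsTo (bakerFun M a b) cube cube := by
  intro p hp
  have hM' : (0 : ℝ) < M := by exact_mod_cast (by omega : 0 < M)
  obtain ⟨ha0, ha1⟩ := ha
  obtain ⟨hb0, hb1⟩ := hb
  rw [lt_div_iff₀ hM'] at ha1 hb1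
  have hcov := exists_mem_dom hM ha0 hp
  obtain ⟨-, ⟨hc0, hc1⟩, hs0, hs1⟩ := hp
  rcases hcov with ⟨k, hk⟩ | ⟨k, hk⟩
  · rw [bakerFun_of_mem_domAlpha ha0 hk]
    obtain ⟨⟨hu0, hu1⟩, -, -⟩ := hk
    have hkM : (k : ℝ) + 1 ≤ M := by exact_mod_cast k.isLt
    have hk0 : (0 : ℝ) ≤ k := Nat.cast_nonneg _
    refine ⟨⟨div_nonneg (by linarith) ha0.le, (div_le_one ha0).2 (by linarith)⟩,
      ⟨?_, ?_⟩, ⟨?_, ?_⟩⟩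
    · exact add_nonneg (div_nonneg hc0 hM'.le) (div_nonneg hk0 hM'.le)
    · simp only [branchAlpha]
      rw [← add_div, div_le_one hM']
      linarith
    · exact mul_nonneg (by linarith) hs0
    · exact mul_le_one₀ (by nlinarith) hs0 hs1
  · rw [bakerFun_of_mem_domBeta ha0 hk]
    obtain ⟨h1, h2, -⟩ := domBeta_bounds hk
    obtain ⟨⟨hu0, hu1⟩, -, -⟩ := hk
    have hkM : (k : ℝ) + 1 ≤ M := by exact_mod_cast k.isLt
    have hk0 : (0 : ℝ) ≤ k := Nat.cast_nonneg _
    refine ⟨⟨div_nonneg (by linarith) (by linarith), (div_le_one (by linarith)).2 (by linarith)⟩,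
      ⟨?_, ?_⟩, ⟨?_, ?_⟩⟩
    · simp only [branchBeta, sub_nonneg]
      exact h1
    · simp only [branchBeta]
      linarith
    · simp only [branchBeta]
      nlinarith [mul_nonneg hb0.le hs0, mul_nonneg hb0.le hk0]
    · simp only [branchBeta]
      nlinarith [mul_le_mul_of_nonneg_left hs1 hb0.le, mul_le_mul_of_nonneg_left hkM hb0.le]

/-- The heterochaos baker map `f_{a,b} : [0,1]³ → [0,1]³`. -/
def bakerMap (M : ℕ) (a b : ℝ) (hM : 2 ≤ M) (ha : a ∈ Ioo 0 (1 / (M : ℝ)))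
    (hb : b ∈ Ioo 0 (1 / (M : ℝ))) : cube → cube :=
  (bakerFun_mapsTo hM ha hb).restrict (bakerFun M a b) cube cube

/-! ## The maximal invariant set and its periodic points -/

/-- The union of the interiors in `ℝ³` of the `2M` domains, as a subset of the cube. -/
def openDomain (M : ℕ) (a : ℝ) : Set cube :=
  {x | (∃ k, (x : ℝ × ℝ × ℝ) ∈ interior (domAlpha M a k)) ∨
    ∃ k, (x : ℝ × ℝ × ℝ) ∈ interior (domBeta M a k)}

/-- `⋂_{n ∈ ℤ} f^{-n}(U)`: preimages of `U` under iterates for `n ≥ 0`, and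
forward images of `U` for `n ≤ 0`. -/
def maximalInvariantSet {X : Type*} (f : X → X) (U : Set X) : Set X :=
  (⋂ n : ℕ, f^[n] ⁻¹' U) ∩ ⋂ n : ℕ, f^[n] '' U

/-- The eigenvalues of the derivative `DG(x)`, real or complex, repeated according to their
(algebraic) multiplicities. -/
def derivEigenvalues (G : ℝ × ℝ × ℝ → ℝ × ℝ × ℝ) (x : ℝ × ℝ × ℝ) : Multiset ℂ :=
  (fderiv ℝ G x : (ℝ × ℝ × ℝ) →ₗ[ℝ] (ℝ × ℝ × ℝ)).charpoly.aroots ℂ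

/-- `G` is differentiable on a neighborhood of `x` and no eigenvalue of `DG(x)` lies on the unit
circle. -/
def IsHyperbolicAt (G : ℝ × ℝ × ℝ → ℝ × ℝ × ℝ) (x : ℝ × ℝ × ℝ) : Prop :=
  (∀ᶠ y in 𝓝 x, DifferentiableAt ℝ G y) ∧ ∀ z ∈ derivEigenvalues G x, ‖z‖ ≠ 1

open Classical in
/-- The number, with multiplicity, of eigenvalues of `DG(x)` of modulus greater than one. -/
def unstableDim (G : ℝ × ℝ × ℝ → ℝ × ℝ × ℝ) (x : ℝ × ℝ × ℝ) : ℕ :=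
  (derivEigenvalues G x).countP fun z => 1 < ‖z‖

/-- The set of (hyperbolic) `d`-unstable periodic points of period `n` of `f|_Λ`. Points of `Λ` are
interior to the cube, and on the cube the iterates of `bakerFun` are those of `f`, so the derivative
of `f^n` at such a point is that of the iterate of `bakerFun`. -/
def unstablePer (M : ℕ) (a b : ℝ) (hM : 2 ≤ M) (ha : a ∈ Ioo 0 (1 / (M : ℝ)))
    (hb : b ∈ Ioo 0 (1 / (M : ℝ))) (d n : ℕ) : Set cube :=
  {x | x ∈ maximalInvariantSet (bakerMap M a b hM ha hb) (openDomain M a) ∧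
    (bakerMap M a b hM ha hb)^[n] x = x ∧
    IsHyperbolicAt (bakerFun M a b)^[n] (x : ℝ × ℝ × ℝ) ∧
    unstableDim (bakerFun M a b)^[n] (x : ℝ × ℝ × ℝ) = d}

/-! ## Measure-theoretic entropy and measures of maximal entropy -/

section Entropy

variable {X : Type*} [MeasurableSpace X]

/-- The Shannon entropy of the join `⋁_{i<n} T^{-i} ξ`, where the finite partition `ξ` is given by
its labelling function `ξ : X → Fin k`. -/
def joinEntropy (μ : Measure X) (T : X → X) {k : ℕ} (ξ : X → Fin k) (n : ℕ) : ℝ :=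
  ∑ w : Fin n → Fin k, Real.negMulLog (μ.real {x | ∀ i : Fin n, ξ (T^[i] x) = w i})

/-- The entropy `h(μ, T, ξ) = lim_n (1/n) H_μ(⋁_{i<n} T^{-i} ξ)` of a finite partition. -/
def partitionEntropy (μ : Measure X) (T : X → X) {k : ℕ} (ξ : X → Fin k) : ENNReal :=
  limsup (fun n : ℕ => ENNReal.ofReal (joinEntropy μ T ξ n / n)) atTop

/-- The Kolmogorov-Sinai entropy `h(μ, T) ∈ [0, ∞]`, the supremum over all finite measurable
partitions. -/
def measureEntropy (μ : Measure X) (T : X → X) : ENNReal :=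
  ⨆ (k : ℕ) (ξ : X → Fin k) (_ : Measurable ξ), partitionEntropy μ T ξ

/-- `μ` is an ergodic `T`-invariant probability measure that attains the supremum of the entropy
over all `T`-invariant probability measures, and this supremum is finite. -/
structure IsErgodicMME (T : X → X) (μ : Measure X) : Prop where
  isProbabilityMeasure : IsProbabilityMeasure μ
  ergodic : Ergodic T μ
  entropy_ne_top : measureEntropy μ T ≠ ⊤
  entropy_le : ∀ ν : Measure X, IsProbabilityMeasure ν → MeasurePreserving T ν ν →
    measureEntropy ν T ≤ measureEntropy μ T

end Entropy

/-- The average of `φ` over a finite set `S`, with uniform weights. -/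
def uniformAverage {X : Type*} (S : Set X) (φ : X → ℝ) : ℝ :=
  (∑ᶠ x ∈ S, φ x) / (S.ncard : ℝ)

end Heterochaos

end

/-! # The measures of maximal entropy of the heterochaos baker maps

Read the expanding coordinate `x_u` as a sequence of symbols from the alphabet `{0, …, M}`, where
`j < M` stands for `Ω_{α_{j+1}}` and `M` for the union of all `Ω_{β_k}`: then `f` acts on `x_u` as a
full shift. The central coordinate `x_c`, expanded in base `M`, is a stack of digits. A symbol
`j < M` pushes the digit `j`, the symbol `M` pops the leading digit, and which `Ω_{β_k}` contains
the point is decided by the digit that is popped. The contracting coordinate remembers the past. So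
everything is governed by the height of the stack, a walk which goes up by one on the `Ω_{α_k}` and
down by one on the `Ω_{β_k}`, and `D f^n` is diagonal with central entry `M ^ (-height)`.

*Entropy.* A word `w` of symbols reveals all but the initial digits that `w` pops, of which there are
`depth w`. Hence it has about `M ^ depth w` refinements to cylinders of a generating partition, and
since `∑ M ^ depth w ≤ (n + 1) (M + 1) ^ n` over the words of length `n`, no invariant measure has
entropy above `log (M + 1)` (`measureEntropy_le_log`). If `μ` is ergodic and pushes at least as often
as it pops, then the depth is sublinear on average (`tendsto_integral_depth_div`), so the entropy of
`μ` is that of its symbol process. If it is maximal, then the symbols are independent and uniformly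
distributed, and this determines `μ`: it is the explicit product measure `alphaMeasure`
(`eq_alphaMeasure_of_drift`). The characterization by the law of the words also yields that
`alphaMeasure` is ergodic (`ergodic_alphaMeasure`).

*Time reversal.* If `μ` pops more often than it pushes, then we pass to the inverse. The involution
`flipCube` conjugates `f_{a,b}` to the inverse of `f_{b,a}` off some faces of the cube, exchanges
pushing and popping, and preserves ergodicity and entropy. The faces are harmless unless `x_c` is an
`M`-adic rational almost surely, in which case the initial stack takes few values, and
`eq_alphaMeasure_of_adicSet` applies regardless of the drift. So the only other ergodic measure of
maximal entropy is the image `betaMeasure` of the product measure for the swapped parameters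
(`isErgodicMME_iff`).

*Periodic points.* The unstable dimension of a periodic point is `1` or `2` according to whether its
height over the period is positive or negative (`mem_unstablePer_iff`). A `1`-unstable point is
determined by its word (`eq_of_wordOf_eq`). Conversely, a word of positive height yields contractions
in `x_c` and `x_s` when started at a time of minimal height, with a fixed point. If the word pops at
all and has a large height, then this point can only fail to be interior if the contraction maps all
of `(0, 1)` close to `0` or all of it close to `1`. By a Chernoff bound and the invariance of
`alphaMeasure`, the exceptional words have a vanishing proportion, so that there are
`(M + 1) ^ n (1 + o(1))` points (`tendsto_ncard_posPer`). At most `(M + 1) ^ (n - m)` of them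
begin with a given word of length `m`, so their words equidistribute, and by
`tendsto_integral_alphaMeasure` this is enough for weak convergence to `alphaMeasure`: a typical word
determines the orbit at a later time up to a small error. Time reversal gives the `2`-unstable
points. -/

noncomputable section

set_option linter.unusedSectionVars false

namespace Heterochaos

/-! ### Symbols, coordinates and the stack -/

/-- The word of length `n` read by the labelling `ξ` along the orbit of `x`. -/
def wordOf {X ι : Type*} (T : X → X) (ξ : X → ι) (n : ℕ) (x : X) : Fin n → ι :=
  fun i => ξ (T^[i] x)

theorem wordOf_succ {X ι : Type*} (T : X → X) (ξ : X → ι) (n : ℕ) (x : X) :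
    wordOf T ξ (n + 1) x = Fin.cons (ξ x) (wordOf T ξ n (T x)) := by
  funext i
  refine Fin.cases ?_ (fun i => ?_) i
  · simp [wordOf]
  · simp [wordOf, Function.iterate_succ_apply]

theorem wordOf_eq_iff {X ι : Type*} {T : X → X} {ξ : X → ι} {n : ℕ} {x y : X} :
    wordOf T ξ n x = wordOf T ξ n y ↔ ∀ i < n, ξ (T^[i] x) = ξ (T^[i] y) := by
  simp only [wordOf, funext_iff, Fin.forall_iff]

theorem wordOf_succ_eq_iff {X ι : Type*} {T : X → X} {ξ : X → ι} {n : ℕ} {x y : X} :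
    wordOf T ξ (n + 1) x = wordOf T ξ (n + 1) y ↔
      ξ x = ξ y ∧ wordOf T ξ n (T x) = wordOf T ξ n (T y) := by
  simp only [wordOf_succ, Fin.cons_inj]

/-- The symbol read off the first coordinate: `j < M` stands for the domain `Ω_{α_{j+1}}`, and the
last symbol `M` stands for the union of the domains `Ω_{β_k}`. -/
def uSym (M : ℕ) (a u : ℝ) : Fin (M + 1) := ⟨min M ⌊u / a⌋₊, by omega⟩

/-- The leading digit of `c ∈ [0,1]` in base `M`; the point `1` has the digit `M - 1`. -/
def cDig (M : ℕ) (c : ℝ) : ℕ := min (M - 1) ⌊(M : ℝ) * c⌋₊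

/-- The symbol of a point of the cube. -/
def sym (M : ℕ) (a : ℝ) (x : cube) : Fin (M + 1) := uSym M a x.1.1

/-- The action of a symbol on the expanding coordinate. -/
def uMap (M : ℕ) (a : ℝ) (j : Fin (M + 1)) (u : ℝ) : ℝ :=
  if (j : ℕ) < M then (u - (j : ℝ) * a) / a else (u - (M : ℝ) * a) / (1 - (M : ℝ) * a)

/-- The action of a symbol on the central coordinate, regarded as a stack of digits in base `M`:
the symbol `j < M` pushes the digit `j`, the symbol `M` pops the leading digit. -/
def cMap (M : ℕ) (j : Fin (M + 1)) (c : ℝ) : ℝ :=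
  if (j : ℕ) < M then (c + (j : ℝ)) / M else (M : ℝ) * c - cDig M c

/-- The action on the contracting coordinate of a symbol and of the digit that it pops. -/
def sMap (M : ℕ) (b : ℝ) (j : Fin (M + 1)) (k : ℕ) (s : ℝ) : ℝ :=
  if (j : ℕ) < M then (1 - (M : ℝ) * b) * s else b * s + 1 + b * ((k : ℝ) - M)

/-- The contraction rate of a symbol on the contracting coordinate. -/
def sRate (M : ℕ) (b : ℝ) (j : Fin (M + 1)) : ℝ := if (j : ℕ) < M then 1 - (M : ℝ) * b else b

/-- The change of the height of the stack. -/
def stepHeight {M : ℕ} (j : Fin (M + 1)) : ℤ := if (j : ℕ) < M then 1 else -1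

/-- The number of digits of the initial stack that are popped while a word is read. -/
def depth {M : ℕ} : {n : ℕ} → (Fin n → Fin (M + 1)) → ℕ
  | 0, _ => 0
  | _ + 1, w => if (w 0 : ℕ) < M then depth (Fin.tail w) - 1 else depth (Fin.tail w) + 1

theorem depth_cons {M n : ℕ} (j : Fin (M + 1)) (w : Fin n → Fin (M + 1)) :
    depth (Fin.cons j w : Fin (n + 1) → Fin (M + 1)) =
      if (j : ℕ) < M then depth w - 1 else depth w + 1 := by
  simp [depth]

section Parameters

variable {M : ℕ} {a b : ℝ}

theorem mul_lt_one_of_mem (hM : 2 ≤ M) (ha : a ∈ Ioo 0 (1 / (M : ℝ))) : (M : ℝ) * a < 1 := by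
  have hM' : (0 : ℝ) < M := by exact_mod_cast (by omega : 0 < M)
  have := ha.2
  rw [lt_div_iff₀ hM'] at this
  linarith

theorem cast_pos_of_two_le (hM : 2 ≤ M) : (0 : ℝ) < M := by exact_mod_cast (by omega : 0 < M)

theorem two_le_cast (hM : 2 ≤ M) : (2 : ℝ) ≤ M := by exact_mod_cast hM

theorem cDig_lt (hM : 2 ≤ M) (c : ℝ) : cDig M c < M := by
  unfold cDig; omega

theorem sym_eq_of_mem_domAlpha (ha : 0 < a) {x : cube} {k : Fin M}
    (h : (x : ℝ × ℝ × ℝ) ∈ domAlpha M a k) : sym M a x = k.castSucc := by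
  obtain ⟨⟨h1, h2⟩, -⟩ := h
  have hk := k.isLt
  have : ⌊x.1.1 / a⌋₊ = k := by
    rw [Nat.floor_eq_iff (div_nonneg x.2.1.1 ha.le), le_div_iff₀ ha, div_lt_iff₀ ha]
    exact ⟨h1, h2⟩
  ext
  simp only [sym, uSym, Fin.val_castSucc, this]
  omega

theorem sym_eq_of_mem_domBeta (ha : 0 < a) {x : cube} {k : Fin M}
    (h : (x : ℝ × ℝ × ℝ) ∈ domBeta M a k) : sym M a x = Fin.last M := by
  obtain ⟨⟨h1, -⟩, -⟩ := h
  have : M ≤ ⌊x.1.1 / a⌋₊ := by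
    rw [Nat.le_floor_iff (div_nonneg x.2.1.1 ha.le), le_div_iff₀ ha]
    exact h1
  ext
  simp only [sym, uSym, Fin.val_last]
  omega

theorem cDig_eq_of_mem_domBeta {x : ℝ × ℝ × ℝ} {k : Fin M}
    (h : x ∈ domBeta M a k) : cDig M x.2.1 = k := by
  obtain ⟨h1, h2, h3⟩ := domBeta_bounds h
  have hk := k.isLt
  have h0 : (k : ℕ) ≤ ⌊(M : ℝ) * x.2.1⌋₊ := Nat.le_floor h1
  unfold cDig
  by_cases hkM : (k : ℕ) + 1 = M
  · omega
  · have h4 : ⌊(M : ℝ) * x.2.1⌋₊ < k + 1 := by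
      rw [Nat.floor_lt (le_trans (Nat.cast_nonneg _) h1)]
      exact_mod_cast h3 hkM
    omega

theorem mem_domAlpha_of_sym (hM : 2 ≤ M) (ha : 0 < a) {x : cube} {k : Fin M}
    (h : sym M a x = k.castSucc) : (x : ℝ × ℝ × ℝ) ∈ domAlpha M a k := by
  rcases exists_mem_dom hM ha x.2 with ⟨l, hl⟩ | ⟨l, hl⟩
  · have := (sym_eq_of_mem_domAlpha ha hl).symm.trans h
    rwa [← Fin.castSucc_injective _ this]
  · have := (sym_eq_of_mem_domBeta ha hl).symm.trans h
    exact absurd this (Fin.castSucc_lt_last k).ne'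

theorem mem_domBeta_of_sym (hM : 2 ≤ M) (ha : 0 < a) {x : cube}
    (h : sym M a x = Fin.last M) :
    (x : ℝ × ℝ × ℝ) ∈ domBeta M a ⟨cDig M x.1.2.1, cDig_lt hM _⟩ := by
  rcases exists_mem_dom hM ha x.2 with ⟨l, hl⟩ | ⟨l, hl⟩
  · have := (sym_eq_of_mem_domAlpha ha hl).symm.trans h
    exact absurd this (Fin.castSucc_lt_last l).ne
  · convert hl
    exact cDig_eq_of_mem_domBeta hl

variable (hM : 2 ≤ M) (ha : a ∈ Ioo 0 (1 / (M : ℝ))) (hb : b ∈ Ioo 0 (1 / (M : ℝ)))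

local notation "𝐓" => bakerMap M a b hM ha hb

/-- The baker map in terms of symbols and digits. -/
theorem bakerMap_coe (x : cube) :
    (𝐓 x : ℝ × ℝ × ℝ) = (uMap M a (sym M a x) x.1.1, cMap M (sym M a x) x.1.2.1,
      sMap M b (sym M a x) (cDig M x.1.2.1) x.1.2.2) := by
  have h0 : (𝐓 x : ℝ × ℝ × ℝ) = bakerFun M a b x := rfl
  rw [h0]
  rcases Fin.eq_castSucc_or_eq_last (sym M a x) with ⟨k, hk⟩ | hk
  · rw [bakerFun_of_mem_domAlpha ha.1 (mem_domAlpha_of_sym hM ha.1 hk), hk]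
    simp [branchAlpha, uMap, cMap, sMap, add_div]
  · rw [bakerFun_of_mem_domBeta ha.1 (mem_domBeta_of_sym hM ha.1 hk), hk]
    simp [branchBeta, uMap, cMap, sMap]

theorem bakerMap_u (x : cube) : (𝐓 x).1.1 = uMap M a (sym M a x) x.1.1 := by
  rw [bakerMap_coe]

theorem bakerMap_c (x : cube) : (𝐓 x).1.2.1 = cMap M (sym M a x) x.1.2.1 := by
  rw [bakerMap_coe]

theorem bakerMap_s (x : cube) :
    (𝐓 x).1.2.2 = sMap M b (sym M a x) (cDig M x.1.2.1) x.1.2.2 := by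
  rw [bakerMap_coe]

theorem measurable_uSym : Measurable (uSym M a) := by
  have h : Measurable fun u : ℝ => min M ⌊u / a⌋₊ :=
    measurable_const.min (Nat.measurable_floor.comp (measurable_id.div_const a))
  refine measurable_to_countable' fun j => ?_
  have : uSym M a ⁻¹' {j} = (fun u : ℝ => min M ⌊u / a⌋₊) ⁻¹' {(j : ℕ)} := by
    ext u
    simp [uSym, Fin.ext_iff]
  rw [this]
  exact h (measurableSet_singleton _)

theorem measurable_sym : Measurable (sym M a) :=
  measurable_uSym.comp (measurable_fst.comp measurable_subtype_coe)

theorem measurable_cDig : Measurable (cDig M) :=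
  measurable_const.min (Nat.measurable_floor.comp (measurable_id.const_mul _))

theorem measurable_bakerMap : Measurable 𝐓 := by
  have hu : Measurable fun x : cube => x.1.1 := measurable_fst.comp measurable_subtype_coe
  have hc : Measurable fun x : cube => x.1.2.1 :=
    (measurable_fst.comp measurable_snd).comp measurable_subtype_coe
  have hs : Measurable fun x : cube => x.1.2.2 :=
    (measurable_snd.comp measurable_snd).comp measurable_subtype_coe
  have hj : Measurable fun x : cube => ((sym M a x : ℕ) : ℝ) :=
    (measurable_from_top (f := fun j : Fin (M + 1) => ((j : ℕ) : ℝ))).comp measurable_sym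
  have hk : Measurable fun x : cube => (cDig M x.1.2.1 : ℝ) :=
    (measurable_from_top (f := fun j : ℕ => (j : ℝ))).comp (measurable_cDig.comp hc)
  have hset : MeasurableSet {x : cube | (sym M a x : ℕ) < M} :=
    measurable_sym (MeasurableSet.of_discrete (s := {j : Fin (M + 1) | (j : ℕ) < M}))
  refine Measurable.subtype_mk (h := fun x => (𝐓 x).2) (f := fun x => (𝐓 x).1) ?_
  simp_rw [bakerMap_coe, uMap, cMap, sMap]
  refine Measurable.prodMk ?_ (Measurable.prodMk ?_ ?_)
  · exact Measurable.ite hset (by fun_prop) (by fun_prop)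
  · exact Measurable.ite hset (by fun_prop) (by fun_prop)
  · exact Measurable.ite hset (by fun_prop) (by fun_prop)

/-! #### The stack -/

theorem floor_pow_mul_eq_of_le {K L : ℕ} (hLK : L ≤ K) (hM : 2 ≤ M) {c d : ℝ}
    (h : ⌊(M : ℝ) ^ K * c⌋₊ = ⌊(M : ℝ) ^ K * d⌋₊) :
    ⌊(M : ℝ) ^ L * c⌋₊ = ⌊(M : ℝ) ^ L * d⌋₊ := by
  have hM' := cast_pos_of_two_le hM
  have key : ∀ c : ℝ, ⌊(M : ℝ) ^ L * c⌋₊ = ⌊(M : ℝ) ^ K * c⌋₊ / M ^ (K - L) := by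
    intro c
    rw [← Nat.floor_div_natCast]
    congr 1
    rw [eq_div_iff (by positivity), Nat.cast_pow]
    calc (M : ℝ) ^ L * c * M ^ (K - L) = (M : ℝ) ^ (L + (K - L)) * c := by rw [pow_add]; ring
      _ = _ := by rw [Nat.add_sub_cancel' hLK]
  rw [key, key, h]

theorem cDig_eq_of_floor_eq (hM : 2 ≤ M) {K : ℕ} (hK : 1 ≤ K) {c d : ℝ}
    (h : ⌊(M : ℝ) ^ K * c⌋₊ = ⌊(M : ℝ) ^ K * d⌋₊) : cDig M c = cDig M d := by
  have := floor_pow_mul_eq_of_le hK hM h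
  rw [pow_one] at this
  rw [cDig, cDig, this]

theorem floor_cMap_push {j : Fin (M + 1)} (hj : (j : ℕ) < M) (hM : 2 ≤ M) (K : ℕ) {c d : ℝ}
    (hc : 0 ≤ c) (hd : 0 ≤ d)
    (h : ⌊(M : ℝ) ^ K * c⌋₊ = ⌊(M : ℝ) ^ K * d⌋₊) :
    ⌊(M : ℝ) ^ (K + 1) * cMap M j c⌋₊ = ⌊(M : ℝ) ^ (K + 1) * cMap M j d⌋₊ := by
  have hM' := cast_pos_of_two_le hM
  have key : ∀ c : ℝ, 0 ≤ c →
      ⌊(M : ℝ) ^ (K + 1) * cMap M j c⌋₊ = ⌊(M : ℝ) ^ K * c⌋₊ + M ^ K * j := by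
    intro c hc
    rw [← Nat.floor_add_natCast (by positivity), cMap, if_pos hj]
    congr 1
    push_cast
    field_simp
    ring
  rw [key c hc, key d hd, h]

theorem floor_cMap_pop {j : Fin (M + 1)} (hj : ¬ (j : ℕ) < M) (hM : 2 ≤ M) (K : ℕ) {c d : ℝ}
    (h : ⌊(M : ℝ) ^ (K + 1) * c⌋₊ = ⌊(M : ℝ) ^ (K + 1) * d⌋₊) :
    ⌊(M : ℝ) ^ K * cMap M j c⌋₊ = ⌊(M : ℝ) ^ K * cMap M j d⌋₊ := by
  have key : ∀ c : ℝ,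
      ⌊(M : ℝ) ^ K * cMap M j c⌋₊ = ⌊(M : ℝ) ^ (K + 1) * c⌋₊ - M ^ K * cDig M c := by
    intro c
    rw [← Nat.floor_sub_natCast, cMap, if_neg hj]
    congr 1
    push_cast
    ring
  rw [key c, key d, h, cDig_eq_of_floor_eq hM (Nat.le_add_left 1 K) h]

/-- Two points with the same word and the same first `depth + L` digits keep agreeing in their
first `L` digits. -/
theorem floor_iterate_eq (n : ℕ) : ∀ (K L : ℕ) (x y : cube),
    wordOf 𝐓 (sym M a) n x = wordOf 𝐓 (sym M a) n y →
    depth (wordOf 𝐓 (sym M a) n x) + L ≤ K →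
    ⌊(M : ℝ) ^ K * x.1.2.1⌋₊ = ⌊(M : ℝ) ^ K * y.1.2.1⌋₊ →
    ∀ i ≤ n, ⌊(M : ℝ) ^ L * (𝐓^[i] x).1.2.1⌋₊ = ⌊(M : ℝ) ^ L * (𝐓^[i] y).1.2.1⌋₊ := by
  induction n with
  | zero =>
    intro K L x y _ hK h i hi
    obtain rfl : i = 0 := by omega
    exact floor_pow_mul_eq_of_le (by omega) hM h
  | succ n ih =>
    intro K L x y hw hK h i hi
    rw [wordOf_succ, depth_cons] at hK
    obtain ⟨hxy, hw'⟩ := wordOf_succ_eq_iff.1 hw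
    cases i with
    | zero => exact floor_pow_mul_eq_of_le (by omega) hM h
    | succ i =>
      rw [Function.iterate_succ_apply, Function.iterate_succ_apply]
      by_cases hj : (sym M a x : ℕ) < M
      · rw [if_pos hj] at hK
        refine ih (K + 1) L _ _ hw' (by omega) ?_ i (by omega)
        rw [bakerMap_c, bakerMap_c, ← hxy]
        exact floor_cMap_push hj hM K x.2.2.1.1 y.2.2.1.1 h
      · rw [if_neg hj] at hK
        obtain ⟨K, rfl⟩ : ∃ K', K = K' + 1 := ⟨K - 1, by omega⟩
        refine ih K L _ _ hw' (by omega) ?_ i (by omega)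
        rw [bakerMap_c, bakerMap_c, ← hxy]
        exact floor_cMap_pop hj hM K h

/-- The height reached by the stack after `n` steps, relative to the initial height. -/
def height (T : cube → cube) (M : ℕ) (a : ℝ) (n : ℕ) (x : cube) : ℤ :=
  birkhoffSum T (fun x => stepHeight (sym M a x)) n x

theorem height_succ (T : cube → cube) (n : ℕ) (x : cube) :
    height T M a (n + 1) x = stepHeight (sym M a x) + height T M a n (T x) := by
  rw [height, birkhoffSum_succ']; rfl

theorem height_add (T : cube → cube) (m n : ℕ) (x : cube) :
    height T M a (m + n) x = height T M a m x + height T M a n (T^[m] x) :=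
  birkhoffSum_add T _ m n x

theorem height_eq_sum (T : cube → cube) (n : ℕ) (x : cube) :
    height T M a n x = ∑ i, stepHeight (wordOf T (sym M a) n x i) := by
  rw [height, birkhoffSum, Finset.sum_range]; rfl

/-- Points with the same word whose common digits suffice for all the pops of the word are mapped
affinely to each other in the central and in the contracting coordinate. -/
theorem sub_iterate_eq (n : ℕ) : ∀ (K : ℕ) (x y : cube),
    wordOf 𝐓 (sym M a) n x = wordOf 𝐓 (sym M a) n y →
    depth (wordOf 𝐓 (sym M a) n x) ≤ K →
    ⌊(M : ℝ) ^ K * x.1.2.1⌋₊ = ⌊(M : ℝ) ^ K * y.1.2.1⌋₊ →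
    ((𝐓^[n] x).1.2.1 - (𝐓^[n] y).1.2.1) * (M : ℝ) ^ height 𝐓 M a n x = x.1.2.1 - y.1.2.1 ∧
    (𝐓^[n] x).1.2.2 - (𝐓^[n] y).1.2.2 =
      (∏ i, sRate M b (wordOf 𝐓 (sym M a) n x i)) * (x.1.2.2 - y.1.2.2) := by
  have hM' := cast_pos_of_two_le hM
  induction n with
  | zero =>
    intro K x y _ _ _
    simp [height]
  | succ n ih =>
    intro K x y hw hK h
    rw [wordOf_succ, depth_cons] at hK
    obtain ⟨hxy, hw'⟩ := wordOf_succ_eq_iff.1 hw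
    rw [Function.iterate_succ_apply, Function.iterate_succ_apply, height_succ, wordOf_succ,
      Fin.prod_univ_succ, zpow_add₀ hM'.ne']
    simp only [Fin.cons_zero, Fin.cons_succ]
    by_cases hj : (sym M a x : ℕ) < M
    · rw [if_pos hj] at hK
      obtain ⟨h1, h2⟩ := ih (K + 1) (𝐓 x) (𝐓 y) hw' (by omega) (by
        rw [bakerMap_c, bakerMap_c, ← hxy]
        exact floor_cMap_push hj hM K x.2.2.1.1 y.2.2.1.1 h)
      rw [bakerMap_c, bakerMap_c, ← hxy, cMap, cMap, if_pos hj, if_pos hj] at h1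
      rw [bakerMap_s, bakerMap_s, ← hxy, sMap, sMap, if_pos hj, if_pos hj] at h2
      have hr : sRate M b (sym M a x) = 1 - (M : ℝ) * b := if_pos hj
      have hs : stepHeight (sym M a x) = 1 := if_pos hj
      rw [hr, hs, zpow_one]
      constructor
      · rw [mul_left_comm, h1]; field_simp; ring
      · rw [h2]; ring
    · rw [if_neg hj] at hK
      obtain ⟨K, rfl⟩ : ∃ K', K = K' + 1 := ⟨K - 1, by omega⟩
      have hd := cDig_eq_of_floor_eq hM (Nat.le_add_left 1 K) h
      obtain ⟨h1, h2⟩ := ih K (𝐓 x) (𝐓 y) hw' (by omega) (by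
        rw [bakerMap_c, bakerMap_c, ← hxy]
        exact floor_cMap_pop hj hM K h)
      rw [bakerMap_c, bakerMap_c, ← hxy, cMap, cMap, if_neg hj, if_neg hj, hd] at h1
      rw [bakerMap_s, bakerMap_s, ← hxy, sMap, sMap, if_neg hj, if_neg hj, hd] at h2
      have hr : sRate M b (sym M a x) = b := if_neg hj
      have hs : stepHeight (sym M a x) = -1 := if_neg hj
      rw [hr, hs, zpow_neg_one]
      constructor
      · rw [mul_left_comm, h1]; field_simp; ring
      · rw [h2]; ring

/-- The depth of a word is the largest drop of the height below its initial value. -/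
theorem depth_le_iff (T : cube → cube) (n : ℕ) : ∀ (K : ℕ) (x : cube),
    depth (wordOf T (sym M a) n x) ≤ K ↔ ∀ i ≤ n, 0 ≤ K + height T M a i x := by
  induction n with
  | zero =>
    intro K x
    simp [depth, height]
  | succ n ih =>
    intro K x
    have h0 : (∀ i ≤ n + 1, 0 ≤ K + height T M a i x) ↔
        ∀ i ≤ n, 0 ≤ K + (stepHeight (sym M a x) + height T M a i (T x)) := by
      constructor
      · intro h i hi
        rw [← height_succ]
        exact h _ (by omega)
      · intro h i hi
        cases i with
        | zero => simp [height]
        | succ i => rw [height_succ]; exact h i (by omega)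
    rw [h0, wordOf_succ, depth_cons]
    by_cases hj : (sym M a x : ℕ) < M
    · simp only [stepHeight, if_pos hj]
      have := ih (K + 1) (T x)
      rw [show depth (wordOf T (sym M a) n (T x)) - 1 ≤ K ↔
        depth (wordOf T (sym M a) n (T x)) ≤ K + 1 by omega, this]
      push_cast
      simp only [add_assoc]
    · simp only [stepHeight, if_neg hj]
      cases K with
      | zero =>
        simp only [Nat.le_zero, Nat.add_eq_zero_iff, one_ne_zero, and_false, false_iff]
        intro h
        have := h 0 (by omega)
        simp [height] at this
      | succ K =>
        rw [Nat.succ_le_succ_iff, ih K (T x)]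
        push_cast
        simp only [add_assoc, add_neg_cancel_left]

end Parameters

/-! ### Entropy of random variables with finitely many values -/

section FiniteEntropy

variable {Ω ι κ : Type*} [MeasurableSpace Ω] {μ : Measure Ω}

/-- The Shannon entropy of a random variable with values in a finite type. -/
def entropyOf [Fintype ι] (μ : Measure Ω) (X : Ω → ι) : ℝ :=
  ∑ w, Real.negMulLog (μ.real (X ⁻¹' {w}))

theorem joinEntropy_eq {X : Type*} [MeasurableSpace X] (μ : Measure X) (T : X → X) {k : ℕ}
    (ξ : X → Fin k) (n : ℕ) : joinEntropy μ T ξ n = entropyOf μ (wordOf T ξ n) := by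
  unfold joinEntropy entropyOf
  refine Finset.sum_congr rfl fun w _ => ?_
  congr 2
  ext x
  simp [wordOf, funext_iff]

theorem measurable_wordOf {X : Type*} [MeasurableSpace X] {T : X → X} [MeasurableSpace ι]
    (hT : Measurable T) {ξ : X → ι} (hξ : Measurable ξ) (n : ℕ) : Measurable (wordOf T ξ n) :=
  measurable_pi_lambda _ fun i => hξ.comp (hT.iterate i)

theorem entropyOf_nonneg [Fintype ι] [IsProbabilityMeasure μ] (X : Ω → ι) :
    0 ≤ entropyOf μ X :=
  Finset.sum_nonneg fun _ _ => Real.negMulLog_nonneg measureReal_nonneg measureReal_le_one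

variable [Fintype ι] [MeasurableSpace ι] [MeasurableSingletonClass ι]
variable [Fintype κ] [MeasurableSpace κ] [MeasurableSingletonClass κ]

theorem integral_comp_fintype [IsFiniteMeasure μ] {X : Ω → ι} (hX : Measurable X) (f : ι → ℝ) :
    ∫ x, f (X x) ∂μ = ∑ w, μ.real (X ⁻¹' {w}) * f w := by
  have hf : Measurable f := measurable_of_countable f
  rw [← integral_map hX.aemeasurable hf.aestronglyMeasurable, integral_fintype (by simp)]
  simp [map_measureReal_apply hX, smul_eq_mul]

theorem integrable_comp_fintype [IsFiniteMeasure μ] {X : Ω → ι} (hX : Measurable X) (f : ι → ℝ) :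
    Integrable (fun x => f (X x)) μ := by
  have hf : Measurable f := measurable_of_countable f
  exact (Integrable.of_finite (μ := μ.map X) (f := f)).comp_measurable hX

theorem sum_law [IsProbabilityMeasure μ] {X : Ω → ι} (hX : Measurable X) :
    ∑ w, μ.real (X ⁻¹' {w}) = 1 := by
  simpa using (integral_comp_fintype (μ := μ) hX fun _ => 1).symm

theorem entropyOf_eq_integral [IsProbabilityMeasure μ] {X : Ω → ι} (hX : Measurable X) :
    entropyOf μ X = ∫ x, -Real.log (μ.real (X ⁻¹' {X x})) ∂μ := by
  rw [integral_comp_fintype hX fun w => -Real.log (μ.real (X ⁻¹' {w}))]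
  simp [entropyOf, Real.negMulLog]

theorem ae_law_pos [IsFiniteMeasure μ] (X : Ω → ι) :
    ∀ᵐ x ∂μ, 0 < μ.real (X ⁻¹' {X x}) := by
  rw [ae_iff]
  refine measure_mono_null (t := ⋃ w : {w // μ.real (X ⁻¹' {w}) = 0}, X ⁻¹' {w.1}) ?_ ?_
  · intro x hx
    have hx' : μ.real (X ⁻¹' {X x}) = 0 := le_antisymm (not_lt.1 hx) measureReal_nonneg
    exact mem_iUnion.2 ⟨⟨X x, hx'⟩, rfl⟩
  · refine measure_iUnion_null fun w => ?_
    have := w.2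
    rwa [measureReal_eq_zero_iff] at this

theorem negMulLog_le_of_pos {p q : ℝ} (hp : 0 ≤ p) (hq : 0 ≤ q) (h : p ≠ 0 → 0 < q) :
    Real.negMulLog p ≤ p * -Real.log q + (q - p) := by
  rcases hp.eq_or_lt with rfl | hp
  · simpa [Real.negMulLog] using hq
  · have hq := h hp.ne'
    have := Real.log_le_sub_one_of_pos (div_pos hq hp)
    rw [Real.log_div hq.ne' hp.ne'] at this
    have h2 := mul_le_mul_of_nonneg_left this hp.le
    rw [mul_sub, mul_sub, mul_one, mul_div_cancel₀ _ hp.ne'] at h2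
    rw [Real.negMulLog]
    linarith

/-- **Gibbs' inequality**: the entropy is bounded by the cross entropy with respect to any
subprobability vector `q`. -/
theorem entropyOf_le_integral [IsProbabilityMeasure μ] {X : Ω → ι} (hX : Measurable X)
    (q : ι → ℝ) (hq0 : ∀ w, 0 ≤ q w) (hq1 : ∑ w, q w ≤ 1) (hpos : ∀ᵐ x ∂μ, 0 < q (X x))
    {g : Ω → ℝ} (hg : Integrable g μ) (hqg : ∀ᵐ x ∂μ, -Real.log (q (X x)) ≤ g x) :
    entropyOf μ X ≤ ∫ x, g x ∂μ := by
  have h1 : entropyOf μ X ≤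
      ∑ w, (μ.real (X ⁻¹' {w}) * -Real.log (q w) + (q w - μ.real (X ⁻¹' {w}))) := by
    refine Finset.sum_le_sum fun w _ => negMulLog_le_of_pos measureReal_nonneg (hq0 w) fun hw => ?_
    by_contra hn
    apply hw
    rw [measureReal_eq_zero_iff]
    refine measure_mono_null (fun x hx => ?_) (ae_iff.1 hpos)
    rw [mem_ofPred_eq, show X x = w from hx]
    exact hn
  rw [Finset.sum_add_distrib, Finset.sum_sub_distrib, sum_law hX,
    ← integral_comp_fintype hX fun w => -Real.log (q w)] at h1
  have h2 := integral_mono_ae (integrable_comp_fintype hX fun w => -Real.log (q w)) hg hqg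
  linarith

/-- The entropy of `Z` is bounded by guessing `Z` through a random variable `Y` with guessed law
`r` and a channel `k` from `Y` to `Z`. -/
theorem entropyOf_le_channel [IsProbabilityMeasure μ] {Y : Ω → κ} {Z : Ω → ι}
    (hZ : Measurable Z) (r : κ → ℝ) (hr0 : ∀ y, 0 ≤ r y)
    (hr1 : ∑ y, r y ≤ 1) (hr : ∀ᵐ x ∂μ, 0 < r (Y x)) (k : κ → ι → ℝ) (hk0 : ∀ y z, 0 ≤ k y z)
    (hk1 : ∀ y, ∑ z, k y z ≤ 1) (hk : ∀ᵐ x ∂μ, 0 < k (Y x) (Z x)) {g : Ω → ℝ}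
    (hg : Integrable g μ)
    (hrg : ∀ᵐ x ∂μ, -Real.log (r (Y x)) + -Real.log (k (Y x) (Z x)) ≤ g x) :
    entropyOf μ Z ≤ ∫ x, g x ∂μ := by
  have key : ∀ x, r (Y x) * k (Y x) (Z x) ≤ ∑ y, r y * k y (Z x) := fun x =>
    Finset.single_le_sum (f := fun y => r y * k y (Z x))
      (fun y _ => mul_nonneg (hr0 y) (hk0 y _)) (Finset.mem_univ (Y x))
  refine entropyOf_le_integral hZ (fun z => ∑ y, r y * k y z)
    (fun z => Finset.sum_nonneg fun y _ => mul_nonneg (hr0 y) (hk0 y z)) ?_ ?_ hg ?_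
  · rw [Finset.sum_comm]
    simp_rw [← Finset.mul_sum]
    exact (Finset.sum_le_sum fun y _ => mul_le_of_le_one_right (hr0 y) (hk1 y)).trans hr1
  · filter_upwards [hr, hk] with x h1 h2
    exact (mul_pos h1 h2).trans_le (key x)
  · filter_upwards [hr, hk, hrg] with x h1 h2 h3
    refine le_trans ?_ h3
    rw [← neg_add, neg_le_neg_iff, ← Real.log_mul h1.ne' h2.ne']
    exact Real.log_le_log (mul_pos h1 h2) (key x)

theorem entropyOf_le_entropyOf_add [IsProbabilityMeasure μ] {Y : Ω → κ} {Z : Ω → ι}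
    (hY : Measurable Y) (hZ : Measurable Z) (k : κ → ι → ℝ) (hk0 : ∀ y z, 0 ≤ k y z)
    (hk1 : ∀ y, ∑ z, k y z ≤ 1) (hk : ∀ᵐ x ∂μ, 0 < k (Y x) (Z x)) {g : Ω → ℝ}
    (hg : Integrable g μ) (hrg : ∀ᵐ x ∂μ, -Real.log (k (Y x) (Z x)) ≤ g x) :
    entropyOf μ Z ≤ entropyOf μ Y + ∫ x, g x ∂μ := by
  have hi := integrable_comp_fintype (μ := μ) hY fun y => -Real.log (μ.real (Y ⁻¹' {y}))
  rw [entropyOf_eq_integral hY, ← integral_add hi hg]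
  refine entropyOf_le_channel hZ (fun y => μ.real (Y ⁻¹' {y})) (fun _ => measureReal_nonneg)
    (sum_law hY).le (ae_law_pos Y) k hk0 hk1 hk (hi.add hg) ?_
  filter_upwards [hrg] with x hx
  exact add_le_add_right hx _

open Classical in
/-- If `Z` takes at most `N y` values where `Y = y`, then guessing `Y` with the law `r` costs
`log N` more for guessing `Z`. -/
theorem entropyOf_le_of_card_le [IsProbabilityMeasure μ] {Y : Ω → κ} {Z : Ω → ι}
    (hY : Measurable Y) (hZ : Measurable Z) (r : κ → ℝ) (hr0 : ∀ y, 0 ≤ r y)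
    (hr1 : ∑ y, r y ≤ 1) (hr : ∀ᵐ x ∂μ, 0 < r (Y x)) (N : κ → ℕ)
    (hN : ∀ y, (Finset.univ.filter fun z => ∃ x, Y x = y ∧ Z x = z).card ≤ N y) :
    entropyOf μ Z ≤ ∫ x, (-Real.log (r (Y x)) + Real.log (N (Y x))) ∂μ := by
  have hmem : ∀ x, Z x ∈ Finset.univ.filter fun z => ∃ x', Y x' = Y x ∧ Z x' = z := fun x => by
    simp only [Finset.mem_filter, Finset.mem_univ, true_and]
    exact ⟨x, rfl, rfl⟩
  have hpos : ∀ x, (0 : ℝ) < N (Y x) := fun x => by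
    exact_mod_cast (Finset.card_pos.2 ⟨_, hmem x⟩).trans_le (hN (Y x))
  refine entropyOf_le_channel hZ r hr0 hr1 hr
    (fun y z => if z ∈ Finset.univ.filter (fun z => ∃ x, Y x = y ∧ Z x = z) then (N y : ℝ)⁻¹ else 0)
    (fun y z => by split_ifs <;> positivity) (fun y => ?_) (ae_of_all _ fun x => ?_) ?_
    (ae_of_all _ fun x => ?_)
  · rw [← Finset.sum_filter, Finset.sum_const, nsmul_eq_mul]
    refine mul_inv_le_one_of_le₀ ?_ (Nat.cast_nonneg _)
    refine le_trans ?_ (Nat.cast_le.2 (hN y))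
    simp
  · rw [if_pos (hmem x)]
    exact inv_pos.2 (hpos x)
  · exact integrable_comp_fintype hY fun y => -Real.log (r y) + Real.log (N y)
  · rw [if_pos (hmem x), Real.log_inv, neg_neg]

theorem entropyOf_le_add_of_eq {κ' : Type*} [Fintype κ'] [MeasurableSpace κ']
    [MeasurableSingletonClass κ'] [IsProbabilityMeasure μ] {Y : Ω → κ} {Y' : Ω → κ'} {Z : Ω → ι}
    (hY : Measurable Y) (hY' : Measurable Y') (hZ : Measurable Z) (F : κ → κ' → ι)
    (hF : ∀ x, Z x = F (Y x) (Y' x)) : entropyOf μ Z ≤ entropyOf μ Y + entropyOf μ Y' := by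
  classical
  have hi := integrable_comp_fintype (μ := μ) hY' fun y => -Real.log (μ.real (Y' ⁻¹' {y}))
  have key : ∀ x, μ.real (Y' ⁻¹' {Y' x}) ≤
      ∑ y', if F (Y x) y' = Z x then μ.real (Y' ⁻¹' {y'}) else 0 := by
    intro x
    have := Finset.single_le_sum
      (f := fun y' => if F (Y x) y' = Z x then μ.real (Y' ⁻¹' {y'}) else 0)
      (fun y' _ => by split_ifs <;> positivity) (Finset.mem_univ (Y' x))
    simpa only [hF x, if_true] using this
  rw [entropyOf_eq_integral hY']
  refine entropyOf_le_entropyOf_add hY hZ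
    (fun y z => ∑ y', if F y y' = z then μ.real (Y' ⁻¹' {y'}) else 0)
    (fun y z => Finset.sum_nonneg fun y' _ => by split_ifs <;> positivity) (fun y => ?_) ?_ hi ?_
  · rw [Finset.sum_comm]
    simp [sum_law hY']
  · filter_upwards [ae_law_pos (μ := μ) Y'] with x hx
    exact hx.trans_le (key x)
  · filter_upwards [ae_law_pos (μ := μ) Y'] with x hx
    exact neg_le_neg (Real.log_le_log hx (key x))

theorem entropyOf_le_log_card [IsProbabilityMeasure μ] [Nonempty ι] {X : Ω → ι}
    (hX : Measurable X) : entropyOf μ X ≤ Real.log (Fintype.card ι) := by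
  have := entropyOf_le_integral (μ := μ) hX (fun _ => (Fintype.card ι : ℝ)⁻¹)
    (fun _ => by positivity) (by simp) (ae_of_all _ fun _ => by positivity)
    (g := fun _ => Real.log (Fintype.card ι)) (integrable_const _) (ae_of_all _ fun _ => by simp)
  simpa using this

/-- Only the uniform law has the maximal entropy. -/
theorem law_eq_of_entropyOf_eq [IsProbabilityMeasure μ] [Nonempty ι] {X : Ω → ι}
    (hX : Measurable X) (h : Real.log (Fintype.card ι) ≤ entropyOf μ X) (w : ι) :
    μ.real (X ⁻¹' {w}) = (Fintype.card ι : ℝ)⁻¹ := by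
  set q : ℝ := (Fintype.card ι : ℝ)⁻¹ with hq
  have hq0 : 0 < q := by positivity
  have hle : ∀ w, Real.negMulLog (μ.real (X ⁻¹' {w})) ≤
      μ.real (X ⁻¹' {w}) * -Real.log q + (q - μ.real (X ⁻¹' {w})) := fun w =>
    negMulLog_le_of_pos measureReal_nonneg hq0.le fun _ => hq0
  have hsum : ∑ w, (μ.real (X ⁻¹' {w}) * -Real.log q + (q - μ.real (X ⁻¹' {w}))) =
      Real.log (Fintype.card ι) := by
    rw [Finset.sum_add_distrib, Finset.sum_sub_distrib, ← Finset.sum_mul, sum_law hX, hq]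
    simp
  have heq : ∑ w, Real.negMulLog (μ.real (X ⁻¹' {w})) =
      ∑ w, (μ.real (X ⁻¹' {w}) * -Real.log q + (q - μ.real (X ⁻¹' {w}))) :=
    le_antisymm (Finset.sum_le_sum fun w _ => hle w) (hsum.trans_le h)
  have hw := (Finset.sum_eq_sum_iff_of_le fun w _ => hle w).1 heq w (Finset.mem_univ w)
  rcases (measureReal_nonneg (μ := μ) (s := X ⁻¹' {w})).eq_or_lt with h0 | h0
  · rw [← h0] at hw
    simp at hw
    exact absurd hw.symm hq0.ne'
  · by_contra hne
    have := Real.log_lt_sub_one_of_pos (div_pos hq0 h0) (by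
      rw [ne_eq, div_eq_one_iff_eq h0.ne']; exact fun h => hne h.symm)
    rw [Real.log_div hq0.ne' h0.ne'] at this
    have h2 := mul_lt_mul_of_pos_left this h0
    rw [mul_sub, mul_sub, mul_one, mul_div_cancel₀ _ h0.ne'] at h2
    rw [Real.negMulLog] at hw
    linarith

theorem entropyOf_eq_log_card [Nonempty ι] {X : Ω → ι}
    (h : ∀ w, μ.real (X ⁻¹' {w}) = (Fintype.card ι : ℝ)⁻¹) :
    entropyOf μ X = Real.log (Fintype.card ι) := by
  simp [entropyOf, h, Real.negMulLog]

end FiniteEntropy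

/-! ### Dynamical entropy -/

section Dynamical

variable {X ι : Type*} [MeasurableSpace X] {μ : Measure X} {T : X → X}

theorem wordOf_iterate (ξ : X → ι) (m n : ℕ) (x : X) (i : Fin m) :
    wordOf T ξ m (T^[n] x) i = ξ (T^[n + i] x) := by
  rw [wordOf, add_comm, Function.iterate_add_apply]

theorem wordOf_append (ξ : X → ι) (m n : ℕ) (x : X) :
    wordOf T ξ (m + n) x = Fin.append (wordOf T ξ m x) (wordOf T ξ n (T^[m] x)) := by
  funext i
  refine Fin.addCases (fun i => ?_) (fun i => ?_) i
  · simp [wordOf]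
  · rw [Fin.append_right, wordOf_iterate]
    rfl

theorem law_comp_iterate (hT : MeasurePreserving T μ μ) {β : Type*} [MeasurableSpace β]
    {Z : X → β} (hZ : Measurable Z) (n : ℕ) {s : Set β} (hs : MeasurableSet s) :
    μ.real ((fun x => Z (T^[n] x)) ⁻¹' s) = μ.real (Z ⁻¹' s) := by
  have := (hT.iterate n).measureReal_preimage (hZ hs).nullMeasurableSet
  rw [← this]
  rfl

variable [Fintype ι] [MeasurableSpace ι] [MeasurableSingletonClass ι]

theorem entropyOf_comp_iterate (hT : MeasurePreserving T μ μ) {Z : X → ι} (hZ : Measurable Z)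
    (n : ℕ) : entropyOf μ (fun x => Z (T^[n] x)) = entropyOf μ Z := by
  unfold entropyOf
  refine Finset.sum_congr rfl fun w _ => ?_
  rw [law_comp_iterate hT hZ n (measurableSet_singleton w)]

/-- The entropies of the words of a stationary process are subadditive. -/
theorem subadditive_entropyOf [IsProbabilityMeasure μ] (hT : MeasurePreserving T μ μ) {ξ : X → ι}
    (hξ : Measurable ξ) : Subadditive fun n => entropyOf μ (wordOf T ξ n) := by
  intro m n
  change entropyOf μ (wordOf T ξ (m + n)) ≤
    entropyOf μ (wordOf T ξ m) + entropyOf μ (wordOf T ξ n)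
  rw [← entropyOf_comp_iterate hT (measurable_wordOf hT.measurable hξ n) m]
  exact entropyOf_le_add_of_eq (measurable_wordOf hT.measurable hξ m)
    ((measurable_wordOf hT.measurable hξ n).comp (hT.measurable.iterate m))
    (measurable_wordOf hT.measurable hξ (m + n)) (fun y z => Fin.append y z)
    fun x => wordOf_append ξ m n x

theorem eventually_entropyOf_le [IsProbabilityMeasure μ] (hT : MeasurePreserving T μ μ) {ξ : X → ι}
    (hξ : Measurable ξ) {m : ℕ} (hm : m ≠ 0) {ε : ℝ} (hε : 0 < ε) :
    ∀ᶠ n : ℕ in atTop,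
      entropyOf μ (wordOf T ξ n) ≤ n * (entropyOf μ (wordOf T ξ m) / m + ε) := by
  have hsub := subadditive_entropyOf hT hξ
  have hbdd : BddBelow (range fun n : ℕ => entropyOf μ (wordOf T ξ n) / n) :=
    ⟨0, by rintro _ ⟨n, rfl⟩; exact div_nonneg (entropyOf_nonneg _) (Nat.cast_nonneg _)⟩
  have hlim := hsub.tendsto_lim hbdd
  have hle := hsub.lim_le_div hbdd hm
  filter_upwards [hlim.eventually (gt_mem_nhds (show hsub.lim <
    entropyOf μ (wordOf T ξ m) / m + ε by linarith)), eventually_gt_atTop 0] with n hn hn0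
  have : (0 : ℝ) < n := by exact_mod_cast hn0
  rw [div_lt_iff₀ this] at hn
  linarith

/-- The labelling `ξ` dominates the labelling `ζ` up to small errors: if the words of `ξ` determine
a guess of `ζ ∘ T^N` that is wrong on a set of small measure only, then the words of `ζ` have
little more entropy than those of `ξ`. -/
theorem entropyOf_wordOf_le_of_guess [IsProbabilityMeasure μ] (hT : MeasurePreserving T μ μ)
    {ξ : X → ι} (hξ : Measurable ξ) {k : ℕ} (hk : 0 < k) {ζ : X → Fin k} (hζ : Measurable ζ)
    {N m : ℕ} (e : (Fin m → ι) → Fin k) {B : Set X} (hB : MeasurableSet B)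
    (he : ∀ x, T^[N] x ∉ B → e (wordOf T ξ m x) = ζ (T^[N] x)) {ε : ℝ} (hε : 0 < ε) (n : ℕ) :
    entropyOf μ (wordOf T ζ n) ≤ entropyOf μ (wordOf T ξ (n + m)) +
      n * (ε + Real.log (k / (1 - Real.exp (-ε))) * μ.real B) := by
  classical
  -- chosen such that a right guess, which has weight at least `1 - θ`, costs at most `ε`
  set θ : ℝ := 1 - Real.exp (-ε) with hθ
  have hexp : Real.exp (-ε) < 1 := by rw [Real.exp_lt_one_iff]; linarith
  have hθ0 : 0 < θ := by linarith
  have hθ1 : θ < 1 := by have := Real.exp_pos (-ε); linarith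
  have hk' : (0 : ℝ) < k := by exact_mod_cast hk
  have hC : 0 ≤ Real.log (k / θ) := by
    refine Real.log_nonneg ?_
    rw [le_div_iff₀ hθ0]
    have : (1 : ℝ) ≤ k := by exact_mod_cast hk
    linarith
  -- trust the guess, but spread the weight `θ` over all labels so that a wrong guess costs only
  -- `log (k / θ)`
  set q : Fin k → Fin k → ℝ := fun u v => (if u = v then 1 - θ else 0) + θ / k with hq
  have hq0 : ∀ u v, 0 < q u v := fun u v => by
    have : 0 < θ / k := by positivity
    simp only [hq]
    split_ifs <;> linarith
  have hq1 : ∀ u, ∑ v, q u v = 1 := fun u => by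
    simp only [hq, Finset.sum_add_distrib, Finset.sum_ite_eq, Finset.mem_univ, if_true,
      Finset.sum_const, Finset.card_univ, Fintype.card_fin, nsmul_eq_mul]
    field_simp
    ring
  set blk : (Fin (n + m) → ι) → Fin n → Fin m → ι :=
    fun y i j => y ⟨i + j, by omega⟩ with hblk
  have hblk' : ∀ x i, blk (wordOf T ξ (n + m) x) i = wordOf T ξ m (T^[i] x) := fun x i => by
    funext j
    rw [wordOf_iterate]
    rfl
  set g : X → ℝ := fun x => ∑ i : Fin n, (ε + Real.log (k / θ) * B.indicator 1
    (T^[i + N] x)) with hg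
  have hmeas : ∀ i : ℕ, MeasurableSet (T^[i] ⁻¹' B) := fun i => hT.measurable.iterate i hB
  have hind : ∀ i : ℕ, (fun x => B.indicator (1 : X → ℝ) (T^[i] x)) = (T^[i] ⁻¹' B).indicator 1 :=
    fun i => by funext x; simp [indicator]
  have hint : ∀ i : ℕ, Integrable (fun x => B.indicator (1 : X → ℝ) (T^[i] x)) μ := fun i => by
    rw [hind]
    exact (integrable_const (1 : ℝ)).indicator (hmeas i)
  have hgi : Integrable g μ :=
    integrable_finsetSum _ fun i _ => (integrable_const _).add ((hint _).const_mul _)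
  have hgval : ∫ x, g x ∂μ = n * (ε + Real.log (k / θ) * μ.real B) := by
    have : ∀ i : ℕ, ∫ x, (ε + Real.log (k / θ) * B.indicator (1 : X → ℝ) (T^[i] x)) ∂μ =
        ε + Real.log (k / θ) * μ.real B := fun i => by
      rw [integral_add (integrable_const _) ((hint _).const_mul _), integral_const_mul, hind,
        integral_indicator_one (hmeas i),
        (hT.iterate i).measureReal_preimage hB.nullMeasurableSet]
      simp
    rw [hg, integral_finsetSum _ fun i _ => ?_]
    · simp [this]
      ring
    · exact (integrable_const _).add ((hint _).const_mul _)
  rw [← hgval, ← entropyOf_comp_iterate hT (measurable_wordOf hT.measurable hζ n) N]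
  have hlog : ∀ x, -Real.log (∏ i, q (e (blk (wordOf T ξ (n + m) x) i))
      (wordOf T ζ n (T^[N] x) i)) ≤ g x := by
    intro x
    rw [Real.log_prod (fun i _ => (hq0 _ _).ne'), ← Finset.sum_neg_distrib]
    refine Finset.sum_le_sum fun i _ => ?_
    have hstep : T^[i + N] x = T^[N] (T^[i] x) := by
      rw [add_comm, Function.iterate_add_apply]
    by_cases hx : T^[i + N] x ∈ B
    · have h1 : θ / k ≤ q (e (blk (wordOf T ξ (n + m) x) i)) (wordOf T ζ n (T^[N] x) i) := by
        simp only [hq]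
        split_ifs <;> linarith
      have h2 := Real.log_le_log (by positivity) h1
      rw [indicator_of_mem hx, Pi.one_apply, mul_one, ← inv_div, Real.log_inv]
      linarith
    · have h1 : e (blk (wordOf T ξ (n + m) x) i) = wordOf T ζ n (T^[N] x) i := by
        rw [hblk', he _ (by rwa [← hstep]), wordOf_iterate, ← hstep, add_comm]
      have h2 : Real.exp (-ε) ≤ q (e (blk (wordOf T ξ (n + m) x) i)) (wordOf T ζ n (T^[N] x) i) :=
        by
        have : 0 ≤ θ / k := by positivity
        simp only [hq, if_pos h1]
        linarith
      have h3 := Real.log_le_log (Real.exp_pos _) h2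
      rw [Real.log_exp] at h3
      rw [indicator_of_notMem hx, mul_zero]
      linarith
  refine entropyOf_le_entropyOf_add (measurable_wordOf hT.measurable hξ (n + m))
    ((measurable_wordOf hT.measurable hζ n).comp (hT.measurable.iterate N))
    (fun y z => ∏ i, q (e (blk y i)) (z i)) (fun y z => Finset.prod_nonneg fun i _ => (hq0 _ _).le)
    (fun y => ?_) (ae_of_all _ fun x => Finset.prod_pos fun i _ => hq0 _ _) hgi (ae_of_all _ hlog)
  have := Finset.prod_univ_sum (fun _ : Fin n => (Finset.univ : Finset (Fin k)))
    (fun i v => q (e (blk y i)) v)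
  simp only [hq1, Finset.prod_const_one, Fintype.piFinset_univ] at this
  exact this.ge

end Dynamical

section Generator

variable {X : Type*} [MetricSpace X] [CompactSpace X] [MeasurableSpace X] [BorelSpace X]

/-- Every finite measurable partition is, up to small measure, a partition into closed sets with
positive mutual distances. -/
theorem exists_separated_closed {μ : Measure X} [IsProbabilityMeasure μ] {k : ℕ} {ζ : X → Fin k}
    (hζ : Measurable ζ) {η : ℝ} (hη : 0 < η) :
    ∃ B : Set X, MeasurableSet B ∧ μ.real B ≤ η ∧
      ∃ δ > 0, ∀ x ∉ B, ∀ y ∉ B, dist x y < δ → ζ x = ζ y := by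
  rcases Nat.eq_zero_or_pos k with rfl | hk
  · obtain ⟨x⟩ : Nonempty X := nonempty_of_isProbabilityMeasure μ
    exact (ζ x).elim0
  have hk' : (0 : ℝ) < k := by exact_mod_cast hk
  have hε : ENNReal.ofReal (η / k) ≠ 0 := by simp; positivity
  have h1 : ∀ j : Fin k, ∃ F ⊆ ζ ⁻¹' {j}, IsClosed F ∧ μ (ζ ⁻¹' {j} \ F) < ENNReal.ofReal (η / k) :=
    fun j => (hζ (measurableSet_singleton j)).exists_isClosed_sdiff_lt (measure_ne_top _ _) hε
  choose F hFs hFc hFμ using h1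
  have h2 : ∀ i j : Fin k, ∀ᶠ δ : ℝ in 𝓝[>] 0, i ≠ j →
      ∀ x ∈ F i, ∀ y ∈ F j, δ ≤ dist x y := by
    intro i j
    by_cases hij : i = j
    · exact Eventually.of_forall fun _ h => absurd hij h
    have hdisj : Disjoint (F i) (F j) :=
      disjoint_of_subset (hFs i) (hFs j) (disjoint_singleton.2 hij |>.preimage ζ)
    obtain ⟨δ, hδ, hd⟩ := hdisj.exists_thickenings (hFc i).isCompact (hFc j)
    filter_upwards [Ioo_mem_nhdsGT hδ] with δ' hδ' _ x hx y hy
    by_contra hlt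
    refine disjoint_left.1 hd (Metric.self_subset_thickening hδ _ hx) ?_
    exact Metric.mem_thickening_iff.2 ⟨y, hy, (not_le.1 hlt).trans hδ'.2⟩
  obtain ⟨δ, h3, hδ⟩ := ((eventually_all.2 fun i => eventually_all.2 fun j => h2 i j).and
    self_mem_nhdsWithin).exists
  refine ⟨(⋃ j, F j)ᶜ, (MeasurableSet.iUnion fun j => (hFc j).measurableSet).compl, ?_, δ, hδ, ?_⟩
  · have hsub : (⋃ j, F j)ᶜ ⊆ ⋃ j, (ζ ⁻¹' {j} \ F j) := fun x hx =>
      mem_iUnion.2 ⟨ζ x, rfl, fun h => hx (mem_iUnion.2 ⟨_, h⟩)⟩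
    have hle : μ (⋃ j, F j)ᶜ ≤ ENNReal.ofReal η := by
      calc μ (⋃ j, F j)ᶜ ≤ ∑ j, μ (ζ ⁻¹' {j} \ F j) :=
            (measure_mono hsub).trans (measure_iUnion_fintype_le _ _)
        _ ≤ ∑ _j : Fin k, ENNReal.ofReal (η / k) := Finset.sum_le_sum fun j _ => (hFμ j).le
        _ = ENNReal.ofReal η := by
            rw [Finset.sum_const, Finset.card_univ, Fintype.card_fin, nsmul_eq_mul,
              ← ENNReal.ofReal_natCast, ← ENNReal.ofReal_mul hk'.le]
            congr 1
            field_simp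
    exact ENNReal.toReal_le_of_le_ofReal hη.le hle
  · intro x hx y hy hxy
    obtain ⟨i, hi⟩ := mem_iUnion.1 (not_notMem.1 hx)
    obtain ⟨j, hj⟩ := mem_iUnion.1 (not_notMem.1 hy)
    rw [show ζ x = i from hFs i hi, show ζ y = j from hFs j hj]
    by_contra hij
    exact absurd (h3 i j hij x hi y hj) (not_le.2 hxy)

/-- If, at every scale, there is a finite labelling whose words locate the orbit at some time and
have entropy growing at a rate of at most `h`, then the Kolmogorov-Sinai entropy is at most `h`. -/
theorem measureEntropy_le_of_generator {μ : Measure X} [IsProbabilityMeasure μ] {T : X → X}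
    (hT : MeasurePreserving T μ μ) {h : ℝ} (h0 : 0 ≤ h)
    (H : ∀ δ > 0, ∃ (k : ℕ) (ξ : X → Fin k) (N m : ℕ), Measurable ξ ∧
      (∀ x y, wordOf T ξ m x = wordOf T ξ m y → dist (T^[N] x) (T^[N] y) < δ) ∧
      ∀ ε > 0, ∀ᶠ n : ℕ in atTop, entropyOf μ (wordOf T ξ n) ≤ n * (h + ε)) :
    measureEntropy μ T ≤ ENNReal.ofReal h := by
  refine iSup_le fun k => iSup_le fun ζ => iSup_le fun hζ => ?_
  refine ENNReal.le_of_forall_pos_le_add fun ε hε _ => ?_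
  have hε' : (0 : ℝ) < ε := by exact_mod_cast hε
  rcases Nat.eq_zero_or_pos k with rfl | hk
  · obtain ⟨x⟩ : Nonempty X := nonempty_of_isProbabilityMeasure μ
    exact (ζ x).elim0
  -- the errors add up to at most `5 ε₁`
  set ε₁ : ℝ := ε / 5 with hε₁
  have hε₁0 : 0 < ε₁ := by positivity
  set C : ℝ := Real.log (k / (1 - Real.exp (-ε₁))) with hC
  obtain ⟨B, hB, hBμ, δ, hδ, hsep⟩ := exists_separated_closed (μ := μ) hζ
    (η := ε₁ / (|C| + 1)) (by positivity)
  have hCB : C * μ.real B ≤ ε₁ := by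
    have h1 : C * μ.real B ≤ |C| * μ.real B :=
      mul_le_mul_of_nonneg_right (le_abs_self _) measureReal_nonneg
    have h2 : |C| * μ.real B ≤ (|C| + 1) * (ε₁ / (|C| + 1)) := by
      gcongr
      linarith
    rw [mul_div_cancel₀ _ (by positivity)] at h2
    linarith
  obtain ⟨l, ξ, N, m, hξ, hclose, hent⟩ := H δ hδ
  classical
  -- off `B`, nearby points have the same label, so any representative of a word gives a right guess
  set e : (Fin m → Fin l) → Fin k := fun v =>
    if hv : ∃ x, wordOf T ξ m x = v ∧ T^[N] x ∉ B then ζ (T^[N] hv.choose) else ⟨0, hk⟩ with he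
  have he' : ∀ x, T^[N] x ∉ B → e (wordOf T ξ m x) = ζ (T^[N] x) := by
    intro x hx
    have hv : ∃ x', wordOf T ξ m x' = wordOf T ξ m x ∧ T^[N] x' ∉ B := ⟨x, rfl, hx⟩
    simp only [he, dif_pos hv]
    exact hsep _ hv.choose_spec.2 _ hx (hclose _ _ hv.choose_spec.1)
  have hev : ∀ᶠ n : ℕ in atTop,
      entropyOf μ (wordOf T ζ n) / n ≤ h + ε := by
    have h1 := (tendsto_add_atTop_nat m).eventually (hent ε₁ hε₁0)
    have h2 : ∀ᶠ n : ℕ in atTop, (m : ℝ) * (h + ε₁) ≤ n * ε₁ := by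
      have : Tendsto (fun n : ℕ => (n : ℝ) * ε₁) atTop atTop :=
        tendsto_natCast_atTop_atTop.atTop_mul_const hε₁0
      exact this.eventually_ge_atTop _
    filter_upwards [h1, h2, eventually_gt_atTop 0] with n h1 h2 hn
    have hn' : (0 : ℝ) < n := by exact_mod_cast hn
    rw [div_le_iff₀ hn']
    have h3 := entropyOf_wordOf_le_of_guess hT hξ hk hζ e hB he' hε₁0 n
    have h4 : (n : ℝ) * (C * μ.real B) ≤ n * ε₁ := mul_le_mul_of_nonneg_left hCB hn'.le
    push_cast at h1
    have h5 : (n : ℝ) * ε = 5 * (n * ε₁) := by rw [hε₁]; ring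
    have h6 : (0 : ℝ) < n * ε₁ := by positivity
    rw [← hC] at h3
    nlinarith
  unfold partitionEntropy
  refine limsup_le_of_le (by isBoundedDefault) ?_
  filter_upwards [hev] with n hn
  rw [joinEntropy_eq, ← ENNReal.ofReal_coe_nnreal, ← ENNReal.ofReal_add h0 hε'.le]
  exact ENNReal.ofReal_le_ofReal hn

end Generator

/-! ### Bernoulli measures and self-similar measures -/

section Bernoulli

variable (ι : Type) [Fintype ι] [Nonempty ι] [MeasurableSpace ι] [MeasurableSingletonClass ι]

/-- The law of an independent uniformly distributed sequence. -/
def bernoulli : Measure (ℕ → ι) :=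
  Measure.infinitePi fun _ : ℕ => (PMF.uniformOfFintype ι).toMeasure

instance : IsProbabilityMeasure (bernoulli ι) := by
  unfold bernoulli; infer_instance

variable {ι}

theorem uniform_singleton (j : ι) :
    (PMF.uniformOfFintype ι).toMeasure {j} = (Fintype.card ι : ENNReal)⁻¹ := by
  rw [PMF.toMeasure_apply_singleton _ _ (measurableSet_singleton j), PMF.uniformOfFintype_apply]

/-- Prepend a symbol to a sequence. -/
def consSeq (j : ι) (ω : ℕ → ι) : ℕ → ι
  | 0 => j
  | n + 1 => ω n

/-- The shift map on sequences. -/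
def shiftSeq (ω : ℕ → ι) : ℕ → ι := fun n => ω (n + 1)

theorem measurable_shiftSeq : Measurable (shiftSeq : (ℕ → ι) → ℕ → ι) :=
  measurable_pi_lambda _ fun n => measurable_pi_apply (n + 1)

theorem measurable_consSeq : Measurable fun p : ι × (ℕ → ι) => consSeq p.1 p.2 := by
  refine measurable_pi_lambda _ fun n => ?_
  cases n with
  | zero => exact measurable_fst
  | succ n => exact (measurable_pi_apply n).comp measurable_snd

theorem shiftSeq_iterate (n : ℕ) (ω : ℕ → ι) (i : ℕ) : shiftSeq^[n] ω i = ω (i + n) := by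
  induction n generalizing ω with
  | zero => rfl
  | succ n ih => rw [Function.iterate_succ_apply, ih]; rfl

theorem map_consSeq_bernoulli :
    ((PMF.uniformOfFintype ι).toMeasure.prod (bernoulli ι)).map
      (fun p : ι × (ℕ → ι) => consSeq p.1 p.2) = bernoulli ι := by
  classical
  refine Measure.eq_infinitePi _ fun s t ht => ?_
  rw [Measure.map_apply measurable_consSeq (.pi s.countable_toSet fun i _ => ht i)]
  set s' : Finset ℕ := (s.erase 0).image Nat.pred with hs'
  have hmem : ∀ n, n ∈ s' ↔ n + 1 ∈ s := by
    intro n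
    simp only [hs', Finset.mem_image, Finset.mem_erase]
    constructor
    · rintro ⟨m, ⟨h0, hm⟩, rfl⟩
      rwa [Nat.pred_eq_sub_one, Nat.sub_add_cancel (Nat.one_le_iff_ne_zero.2 h0)]
    · intro h
      exact ⟨n + 1, ⟨n.succ_ne_zero, h⟩, rfl⟩
  have hset : (fun p : ι × (ℕ → ι) => consSeq p.1 p.2) ⁻¹' Set.pi s t =
      (if 0 ∈ s then t 0 else univ) ×ˢ Set.pi s' fun n => t (n + 1) := by
    ext ⟨j, ω⟩
    simp only [mem_preimage, Set.mem_pi, Finset.mem_coe, mem_prod, hmem]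
    constructor
    · intro h
      refine ⟨?_, fun n hn => h (n + 1) hn⟩
      split_ifs with h0
      · exact h 0 h0
      · trivial
    · rintro ⟨h0, h1⟩ n hn
      cases n with
      | zero => rw [if_pos hn] at h0; exact h0
      | succ n => exact h1 n hn
  have hprod : ∏ n ∈ s', (PMF.uniformOfFintype ι).toMeasure (t (n + 1)) =
      ∏ n ∈ s.erase 0, (PMF.uniformOfFintype ι).toMeasure (t n) := by
    refine Finset.prod_bij (fun n _ => n + 1) (fun n hn => ?_) (fun _ _ _ _ h => by omega)
      (fun n hn => ?_) fun _ _ => rfl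
    · exact Finset.mem_erase.2 ⟨n.succ_ne_zero, (hmem n).1 hn⟩
    · obtain ⟨h0, hn'⟩ := Finset.mem_erase.1 hn
      obtain ⟨m, rfl⟩ := Nat.exists_eq_succ_of_ne_zero h0
      exact ⟨m, (hmem m).2 hn', rfl⟩
  rw [hset, Measure.prod_prod, bernoulli, Measure.infinitePi_pi _ fun n _ => ht (n + 1), hprod]
  by_cases h0 : 0 ∈ s
  · rw [if_pos h0, Finset.mul_prod_erase s (fun n => (PMF.uniformOfFintype ι).toMeasure (t n)) h0]
  · rw [if_neg h0, measure_univ, one_mul, Finset.erase_eq_of_notMem h0]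

theorem lintegral_bernoulli {g : (ℕ → ι) → ENNReal} (hg : Measurable g) :
    ∫⁻ ω, g ω ∂bernoulli ι =
      (Fintype.card ι : ENNReal)⁻¹ * ∑ j, ∫⁻ ω, g (consSeq j ω) ∂bernoulli ι := by
  conv_lhs => rw [← map_consSeq_bernoulli]
  rw [lintegral_map hg measurable_consSeq,
    lintegral_prod (fun p : ι × (ℕ → ι) => g (consSeq p.1 p.2))
      (hg.comp measurable_consSeq).aemeasurable, lintegral_fintype,
    Finset.mul_sum]
  exact Finset.sum_congr rfl fun j _ => by rw [uniform_singleton, mul_comm]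

theorem measurePreserving_shiftSeq :
    MeasurePreserving shiftSeq (bernoulli ι) (bernoulli ι) := by
  refine ⟨measurable_shiftSeq, ?_⟩
  conv_lhs => rw [← map_consSeq_bernoulli]
  rw [Measure.map_map measurable_shiftSeq measurable_consSeq]
  have : (shiftSeq ∘ fun p : ι × (ℕ → ι) => consSeq p.1 p.2) = Prod.snd := rfl
  rw [this, Measure.map_snd_prod, measure_univ, one_smul]

/-- The Bernoulli shift is ergodic, by the zero-one law: invariant sets are tail events. -/
theorem ergodic_shiftSeq : Ergodic shiftSeq (bernoulli ι) := by
  refine ⟨measurePreserving_shiftSeq, ⟨fun {s} hs hinv => ?_⟩⟩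
  set 𝓜 : ℕ → MeasurableSpace (ℕ → ι) :=
    fun n => MeasurableSpace.comap (fun ω => ω n) inferInstance with h𝓜
  have hle : ∀ n, 𝓜 n ≤ (inferInstance : MeasurableSpace (ℕ → ι)) := fun n =>
    (measurable_pi_apply n).comap_le
  have hindep : ProbabilityTheory.iIndep 𝓜 (bernoulli ι) := by
    have := ProbabilityTheory.iIndepFun_infinitePi
      (P := fun _ : ℕ => (PMF.uniformOfFintype ι).toMeasure) (X := fun _ x => x)
      fun _ => measurable_id
    exact (ProbabilityTheory.iIndepFun_iff_iIndep _ _ _).1 this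
  have hiter : ∀ n, shiftSeq^[n] ⁻¹' s = s := fun n => by
    induction n with
    | zero => rfl
    | succ n ih => rw [Function.iterate_succ', preimage_comp, hinv, ih]
  have htail : MeasurableSet[limsup 𝓜 atTop] s := by
    rw [Filter.limsup_eq_iInf_iSup_of_nat, MeasurableSpace.measurableSet_iInf]
    intro n
    rw [← hiter n]
    have : Measurable[⨆ i ≥ n, 𝓜 i] (shiftSeq^[n] : (ℕ → ι) → ℕ → ι) := by
      refine @measurable_pi_lambda _ _ _ (⨆ i ≥ n, 𝓜 i) _ _ fun i => ?_
      have h1 : Measurable[𝓜 (i + n)] fun ω : ℕ → ι => ω (i + n) := comap_measurable _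
      have h2 : (fun ω : ℕ → ι => shiftSeq^[n] ω i) = fun ω => ω (i + n) :=
        funext fun ω => shiftSeq_iterate n ω i
      rw [h2]
      exact h1.mono (le_iSup₂_of_le (i + n) (Nat.le_add_left n i) le_rfl) le_rfl
    exact this hs
  rw [eventuallyConst_set']
  rcases ProbabilityTheory.measure_zero_or_one_of_measurableSet_limsup_atTop hle hindep htail
    with h | h
  · exact Or.inl (ae_eq_empty.2 h)
  · exact Or.inr (ae_eq_univ.2 ((prob_compl_eq_zero_iff hs).2 h))

/-- A probability measure on sequences whose finite words are all uniformly distributed is the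
Bernoulli measure. -/
theorem eq_bernoulli_of_law {P : Measure (ℕ → ι)} [IsProbabilityMeasure P]
    (h : ∀ n (w : Fin n → ι), P {ω | (fun i : Fin n => ω i) = w} =
      (Fintype.card ι : ENNReal)⁻¹ ^ n) : P = bernoulli ι := by
  have hrestr : ∀ (Q : Measure (ℕ → ι)) n (w : Fin n → ι),
      Q.map (fun ω (i : Fin n) => ω i) {w} = Q {ω | (fun i : Fin n => ω i) = w} := by
    intro Q n w
    rw [Measure.map_apply (by fun_prop) (measurableSet_singleton w)]
    rfl
  have hB : ∀ n (w : Fin n → ι), bernoulli ι {ω | (fun i : Fin n => ω i) = w} =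
      (Fintype.card ι : ENNReal)⁻¹ ^ n := by
    intro n w
    have hset : {ω : ℕ → ι | (fun i : Fin n => ω i) = w} =
        Set.pi (Finset.range n) fun i => if hi : i < n then {w ⟨i, hi⟩} else univ := by
      ext ω
      simp only [mem_ofPred_eq, funext_iff, Fin.forall_iff, Set.mem_pi, Finset.coe_range, mem_Iio]
      refine forall₂_congr fun i hi => ?_
      rw [dif_pos hi]
      simp
    rw [hset, bernoulli, Measure.infinitePi_pi _ fun i _ => by split_ifs <;> measurability]
    rw [Finset.prod_congr rfl (g := fun _ => (Fintype.card ι : ENNReal)⁻¹), Finset.prod_const,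
      Finset.card_range]
    intro i hi
    rw [dif_pos (Finset.mem_range.1 hi), uniform_singleton]
  have hmap : ∀ n, P.map (fun ω (i : Fin n) => ω i) =
      (bernoulli ι).map (fun ω (i : Fin n) => ω i) := fun n =>
    Measure.ext_of_singleton fun w => by rw [hrestr, hrestr, h, hB]
  refine Measure.eq_infinitePi _ fun s t ht => ?_
  obtain ⟨n, hn⟩ : ∃ n, ∀ i ∈ s, i < n := ⟨s.sup id + 1, fun i hi =>
    Nat.lt_succ_of_le (Finset.le_sup (f := id) hi)⟩
  set R : Set (Fin n → ι) := {w | ∀ i (hi : i ∈ s), w ⟨i, hn i hi⟩ ∈ t i} with hR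
  have hpre : Set.pi s t = (fun (ω : ℕ → ι) (i : Fin n) => ω i) ⁻¹' R := by
    ext ω
    simp [hR, Set.mem_pi]
  have hRm : MeasurableSet R := R.toFinite.measurableSet
  rw [hpre, ← Measure.map_apply (by fun_prop) hRm, hmap, Measure.map_apply (by fun_prop) hRm,
    ← hpre, bernoulli, Measure.infinitePi_pi _ fun i _ => ht i]

end Bernoulli

section SelfSimilar

variable {ι : Type} [Fintype ι] [Nonempty ι] [MeasurableSpace ι] [MeasurableSingletonClass ι]
variable {r t : ι → ℝ}

/-- The limit point `S_{ω 0} ∘ S_{ω 1} ∘ ⋯` of the iterated function system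
`S_j x = r_j x + t_j`. -/
def seqCode (r t : ι → ℝ) (ω : ℕ → ι) : ℝ :=
  ∑' i, (∏ j ∈ Finset.range i, r (ω j)) * t (ω i)

/-- The affine map `x ↦ r x + t`, as a map of the unit interval. -/
def affMap (r t : ℝ) (x : unitInterval) : unitInterval :=
  projIcc 0 1 zero_le_one (r * x + t)

theorem coe_affMap {r t : ℝ} (hr : 0 ≤ r) (ht : 0 ≤ t) (hrt : r + t ≤ 1) (x : unitInterval) :
    (affMap r t x : ℝ) = r * x + t := by
  have h0 : 0 ≤ r * x := mul_nonneg hr x.2.1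
  have h1 : r * x ≤ r := mul_le_of_le_one_right hr x.2.2
  rw [affMap, projIcc_of_mem zero_le_one (show r * x + t ∈ Icc (0 : ℝ) 1 from
    ⟨by linarith, by linarith⟩)]

theorem measurable_affMap {r t : ℝ} : Measurable (affMap r t) :=
  (continuous_projIcc.comp (by fun_prop)).measurable

theorem sum_seqCode_le (hr : ∀ j, 0 ≤ r j) (hrt : ∀ j, r j + t j ≤ 1) (ω : ℕ → ι) (n : ℕ) :
    ∑ i ∈ Finset.range n, (∏ j ∈ Finset.range i, r (ω j)) * t (ω i) +
      ∏ j ∈ Finset.range n, r (ω j) ≤ 1 := by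
  induction n with
  | zero => simp
  | succ n ih =>
    rw [Finset.sum_range_succ, Finset.prod_range_succ]
    have := mul_le_mul_of_nonneg_left (hrt (ω n))
      (Finset.prod_nonneg fun j _ => hr (ω j) : 0 ≤ ∏ j ∈ Finset.range n, r (ω j))
    nlinarith

theorem summable_seqCode (hr : ∀ j, 0 ≤ r j) (ht : ∀ j, 0 ≤ t j) (hrt : ∀ j, r j + t j ≤ 1)
    (ω : ℕ → ι) : Summable fun i => (∏ j ∈ Finset.range i, r (ω j)) * t (ω i) :=
  summable_of_sum_range_le (c := 1)
    (fun i => mul_nonneg (Finset.prod_nonneg fun j _ => hr _) (ht _)) fun n => by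
      have := sum_seqCode_le hr hrt ω n
      have h2 : 0 ≤ ∏ j ∈ Finset.range n, r (ω j) := Finset.prod_nonneg fun j _ => hr _
      linarith

theorem seqCode_mem (hr : ∀ j, 0 ≤ r j) (ht : ∀ j, 0 ≤ t j) (hrt : ∀ j, r j + t j ≤ 1)
    (ω : ℕ → ι) : seqCode r t ω ∈ Icc (0 : ℝ) 1 := by
  refine ⟨tsum_nonneg fun i => mul_nonneg (Finset.prod_nonneg fun j _ => hr _) (ht _), ?_⟩
  refine (summable_seqCode hr ht hrt ω).tsum_le_of_sum_range_le fun n => ?_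
  have := sum_seqCode_le hr hrt ω n
  have h2 : 0 ≤ ∏ j ∈ Finset.range n, r (ω j) := Finset.prod_nonneg fun j _ => hr _
  linarith

theorem seqCode_eq (hr : ∀ j, 0 ≤ r j) (ht : ∀ j, 0 ≤ t j) (hrt : ∀ j, r j + t j ≤ 1)
    (ω : ℕ → ι) : seqCode r t ω = r (ω 0) * seqCode r t (shiftSeq ω) + t (ω 0) := by
  rw [seqCode, (summable_seqCode hr ht hrt ω).tsum_eq_zero_add, seqCode, ← tsum_mul_left, add_comm]
  simp only [Finset.prod_range_succ', Finset.prod_range_zero, one_mul]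
  congr 1
  refine tsum_congr fun i => ?_
  simp only [shiftSeq]
  ring

theorem measurable_seqCode (hr : ∀ j, 0 ≤ r j) (ht : ∀ j, 0 ≤ t j) (hrt : ∀ j, r j + t j ≤ 1) :
    Measurable (seqCode r t) := by
  refine measurable_of_tendsto_metrizable (f := fun n (ω : ℕ → ι) =>
    ∑ i ∈ Finset.range n, (∏ j ∈ Finset.range i, r (ω j)) * t (ω i)) (fun n => ?_)
    (tendsto_pi_nhds.2 fun ω => (summable_seqCode hr ht hrt ω).hasSum.tendsto_sum_nat)
  have hr' : Measurable r := measurable_of_countable r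
  have ht' : Measurable t := measurable_of_countable t
  refine Finset.measurable_fun_sum _ fun i _ => Measurable.mul ?_ (ht'.comp (measurable_pi_apply i))
  exact Finset.measurable_fun_prod _ fun j _ => hr'.comp (measurable_pi_apply j)

/-- The self-similar measure with uniform weights of the iterated function system
`S_j x = r_j x + t_j` of the unit interval. -/
def selfSimilar (r t : ι → ℝ) : Measure unitInterval :=
  (bernoulli ι).map fun ω => projIcc 0 1 zero_le_one (seqCode r t ω)

theorem measurable_projIcc_seqCode (hr : ∀ j, 0 ≤ r j) (ht : ∀ j, 0 ≤ t j)
    (hrt : ∀ j, r j + t j ≤ 1) :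
    Measurable fun ω => (projIcc 0 1 zero_le_one (seqCode r t ω) : unitInterval) :=
  continuous_projIcc.measurable.comp (measurable_seqCode hr ht hrt)

theorem isProbabilityMeasure_selfSimilar (hr : ∀ j, 0 ≤ r j) (ht : ∀ j, 0 ≤ t j)
    (hrt : ∀ j, r j + t j ≤ 1) : IsProbabilityMeasure (selfSimilar r t) :=
  Measure.isProbabilityMeasure_map (measurable_projIcc_seqCode hr ht hrt).aemeasurable

theorem lintegral_selfSimilar (hr : ∀ j, 0 ≤ r j) (ht : ∀ j, 0 ≤ t j) (hrt : ∀ j, r j + t j ≤ 1)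
    {g : unitInterval → ENNReal} (hg : Measurable g) :
    ∫⁻ x, g x ∂selfSimilar r t =
      (Fintype.card ι : ENNReal)⁻¹ * ∑ j, ∫⁻ x, g (affMap (r j) (t j) x) ∂selfSimilar r t := by
  have hm := measurable_projIcc_seqCode hr ht hrt
  rw [selfSimilar, lintegral_map hg hm, lintegral_bernoulli
    (g := fun ω => g (projIcc 0 1 zero_le_one (seqCode r t ω))) (hg.comp hm)]
  congr 1
  refine Finset.sum_congr rfl fun j _ => ?_
  rw [lintegral_map (f := fun x => g (affMap (r j) (t j) x)) (hg.comp measurable_affMap) hm]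
  refine lintegral_congr fun ω => ?_
  congr 1
  rw [affMap, seqCode_eq hr ht hrt (consSeq j ω),
    projIcc_of_mem zero_le_one (seqCode_mem hr ht hrt ω)]
  rfl

theorem selfSimilar_apply (hr : ∀ j, 0 ≤ r j) (ht : ∀ j, 0 ≤ t j) (hrt : ∀ j, r j + t j ≤ 1)
    {B : Set unitInterval} (hB : MeasurableSet B) :
    selfSimilar r t B =
      (Fintype.card ι : ENNReal)⁻¹ * ∑ j, selfSimilar r t (affMap (r j) (t j) ⁻¹' B) := by
  have := lintegral_selfSimilar hr ht hrt (g := B.indicator 1) (measurable_one.indicator hB)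
  rw [lintegral_indicator_one hB] at this
  rw [this]
  congr 1
  refine Finset.sum_congr rfl fun j _ => ?_
  rw [← lintegral_indicator_one (measurable_affMap hB)]
  rfl

/-- A point that is reached by a single map of the system, from itself only, is not an atom. -/
theorem selfSimilar_singleton_eq_zero (hr : ∀ j, 0 ≤ r j) (ht : ∀ j, 0 ≤ t j)
    (hrt : ∀ j, r j + t j ≤ 1) (hcard : 2 ≤ Fintype.card ι) {y : unitInterval} (j₀ : ι)
    (h : ∀ j x, affMap (r j) (t j) x = y → j = j₀ ∧ x = y) : selfSimilar r t {y} = 0 := by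
  have := isProbabilityMeasure_selfSimilar hr ht hrt
  have h1 := selfSimilar_apply hr ht hrt (measurableSet_singleton y)
  have h2 : ∑ j, selfSimilar r t (affMap (r j) (t j) ⁻¹' {y}) ≤ selfSimilar r t {y} := by
    rw [Finset.sum_eq_single j₀]
    · exact measure_mono fun x hx => (h j₀ x hx).2
    · intro j _ hj
      have : affMap (r j) (t j) ⁻¹' {y} = ∅ :=
        eq_empty_of_forall_notMem fun x hx => hj (h j x hx).1
      rw [this, measure_empty]
    · simp
  have h3 : (Fintype.card ι : ENNReal)⁻¹ ≤ 2⁻¹ := ENNReal.inv_le_inv.2 (by exact_mod_cast hcard)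
  have h4 : selfSimilar r t {y} ≤ 2⁻¹ * selfSimilar r t {y} := by
    conv_lhs => rw [h1]
    exact mul_le_mul' h3 h2
  have h5 : (selfSimilar r t).real {y} ≤ 2⁻¹ * (selfSimilar r t).real {y} := by
    have := ENNReal.toReal_mono (by finiteness) h4
    rwa [ENNReal.toReal_mul, ENNReal.toReal_inv] at this
  rw [← measureReal_eq_zero_iff]
  have := measureReal_nonneg (μ := selfSimilar r t) (s := {y})
  linarith

end SelfSimilar

/-! ### The invariant product measure -/

section Product

variable {ι : Type} [Fintype ι] [Nonempty ι] [MeasurableSpace ι] [MeasurableSingletonClass ι]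
variable {r t : ι → ℝ} {β : Type*} [MeasurableSpace β] {ρ : Measure β} [SFinite ρ]

theorem lintegral_selfSimilar_prod (hr : ∀ j, 0 ≤ r j) (ht : ∀ j, 0 ≤ t j)
    (hrt : ∀ j, r j + t j ≤ 1) {g : unitInterval × β → ENNReal} (hg : Measurable g) :
    ∫⁻ p, g p ∂(selfSimilar r t).prod ρ = (Fintype.card ι : ENNReal)⁻¹ *
      ∑ j, ∫⁻ p, g (affMap (r j) (t j) p.1, p.2) ∂(selfSimilar r t).prod ρ := by
  have := isProbabilityMeasure_selfSimilar hr ht hrt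
  rw [lintegral_prod _ hg.aemeasurable, lintegral_selfSimilar hr ht hrt hg.lintegral_prod_right']
  congr 1
  refine Finset.sum_congr rfl fun j _ => ?_
  rw [lintegral_prod (fun p : unitInterval × β => g (affMap (r j) (t j) p.1, p.2))]
  exact (hg.comp ((measurable_affMap.comp measurable_fst).prodMk measurable_snd)).aemeasurable

theorem lintegral_prod_selfSimilar (hr : ∀ j, 0 ≤ r j) (ht : ∀ j, 0 ≤ t j)
    (hrt : ∀ j, r j + t j ≤ 1) {g : β × unitInterval → ENNReal} (hg : Measurable g) :
    ∫⁻ p, g p ∂ρ.prod (selfSimilar r t) = (Fintype.card ι : ENNReal)⁻¹ *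
      ∑ j, ∫⁻ p, g (p.1, affMap (r j) (t j) p.2) ∂ρ.prod (selfSimilar r t) := by
  have := isProbabilityMeasure_selfSimilar hr ht hrt
  have hg' : ∀ j, Measurable fun p : β × unitInterval => g (p.1, affMap (r j) (t j) p.2) :=
    fun j => hg.comp (measurable_fst.prodMk (measurable_affMap.comp measurable_snd))
  rw [← lintegral_prod_swap, lintegral_selfSimilar_prod (g := fun p => g p.swap) hr ht hrt
    (hg.comp measurable_swap)]
  congr 1
  refine Finset.sum_congr rfl fun j _ => ?_
  rw [← lintegral_prod_swap]
  rfl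

end Product

section Coefficients

variable {M : ℕ} {a b : ℝ}

/-- The contraction rates of the inverse branches in the expanding coordinate. -/
def uRate (M : ℕ) (a : ℝ) (j : Fin (M + 1)) : ℝ := if (j : ℕ) < M then a else 1 - (M : ℝ) * a

/-- The translations of the inverse branches in the expanding coordinate. -/
def uShift (M : ℕ) (a : ℝ) (j : Fin (M + 1)) : ℝ := (j : ℝ) * a

/-- The contraction rates of the maps `c ↦ (c + k) / M`. -/
def cRate (M : ℕ) (_ : Fin M) : ℝ := 1 / (M : ℝ)

/-- The translations of the maps `c ↦ (c + k) / M`. -/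
def cShift (M : ℕ) (k : Fin M) : ℝ := (k : ℝ) / M

/-- The contraction rates of the branches in the contracting coordinate. A branch is given by a
symbol and the digit that it pops, which is ignored by the symbols `j < M`. -/
def sRate' (M : ℕ) (b : ℝ) (p : Fin (M + 1) × Fin M) : ℝ := sRate M b p.1

/-- The translations of the branches in the contracting coordinate. -/
def sShift (M : ℕ) (b : ℝ) (p : Fin (M + 1) × Fin M) : ℝ :=
  if (p.1 : ℕ) < M then 0 else 1 + b * ((p.2 : ℝ) - M)

theorem cast_add_one_le (k : Fin M) : (k : ℝ) + 1 ≤ M := by exact_mod_cast k.isLt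

theorem not_lt_eq {j : Fin (M + 1)} (h : ¬ (j : ℕ) < M) : (j : ℕ) = M := by omega

theorem uRate_pos (hM : 2 ≤ M) (ha : a ∈ Ioo 0 (1 / (M : ℝ))) (j) : 0 < uRate M a j := by
  have := mul_lt_one_of_mem hM ha
  unfold uRate; split_ifs <;> linarith [ha.1]

theorem uRate_nonneg (hM : 2 ≤ M) (ha : a ∈ Ioo 0 (1 / (M : ℝ))) (j) : 0 ≤ uRate M a j :=
  (uRate_pos hM ha j).le

theorem uShift_nonneg (ha : a ∈ Ioo 0 (1 / (M : ℝ))) (j) : 0 ≤ uShift M a j :=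
  mul_nonneg (Nat.cast_nonneg _) ha.1.le

theorem uRate_add_le (hM : 2 ≤ M) (ha : a ∈ Ioo 0 (1 / (M : ℝ))) (j) :
    uRate M a j + uShift M a j ≤ 1 := by
  have h := mul_lt_one_of_mem hM ha
  unfold uRate uShift
  split_ifs with hj
  · have : (j : ℝ) + 1 ≤ M := by exact_mod_cast hj
    nlinarith [ha.1]
  · rw [not_lt_eq hj]; linarith

theorem cRate_nonneg (k) : 0 ≤ cRate M k := by unfold cRate; positivity

theorem cShift_nonneg (k) : 0 ≤ cShift M k := by unfold cShift; positivity

theorem cRate_add_le (hM : 2 ≤ M) (k) : cRate M k + cShift M k ≤ 1 := by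
  unfold cRate cShift
  rw [← add_div, div_le_one (cast_pos_of_two_le hM), add_comm]
  exact cast_add_one_le k

theorem sRate_pos (hM : 2 ≤ M) (hb : b ∈ Ioo 0 (1 / (M : ℝ))) (j) : 0 < sRate M b j := by
  have := mul_lt_one_of_mem hM hb
  unfold sRate; split_ifs <;> linarith [hb.1]

theorem uRate_lt_one (hM : 2 ≤ M) (ha : a ∈ Ioo 0 (1 / (M : ℝ))) (j) : uRate M a j < 1 := by
  have h1 := mul_lt_one_of_mem hM ha
  have h2 := two_le_cast hM
  have h3 := ha.1
  unfold uRate; split_ifs <;> nlinarith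

theorem sShift_nonneg (hM : 2 ≤ M) (hb : b ∈ Ioo 0 (1 / (M : ℝ))) (p) : 0 ≤ sShift M b p := by
  have := mul_lt_one_of_mem hM hb
  unfold sShift
  split_ifs
  · exact le_rfl
  · have := hb.1
    have : 0 ≤ b * (p.2 : ℝ) := by positivity
    nlinarith

theorem sRate_add_le (hM : 2 ≤ M) (hb : b ∈ Ioo 0 (1 / (M : ℝ))) (p) :
    sRate' M b p + sShift M b p ≤ 1 := by
  have h := hb.1
  unfold sRate' sShift sRate
  split_ifs
  · have := cast_pos_of_two_le hM
    nlinarith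
  · nlinarith [cast_add_one_le p.2]

/-- The symbol of a point in the image of an inverse branch. -/
theorem uSym_affine (hM : 2 ≤ M) (ha : a ∈ Ioo 0 (1 / (M : ℝ))) (j : Fin (M + 1)) {u : ℝ}
    (hu : u ∈ Ico (0 : ℝ) 1) : uSym M a (uRate M a j * u + uShift M a j) = j := by
  have h := mul_lt_one_of_mem hM ha
  have ha0 := ha.1
  ext
  simp only [uSym, uRate, uShift]
  split_ifs with hj
  · have : ⌊(a * u + (j : ℝ) * a) / a⌋₊ = j := by
      rw [Nat.floor_eq_iff (by have := hu.1; positivity), le_div_iff₀ ha0, div_lt_iff₀ ha0]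
      constructor <;> nlinarith [hu.1, hu.2]
    rw [this]; omega
  · have : (j : ℕ) ≤ ⌊((1 - (M : ℝ) * a) * u + (j : ℝ) * a) / a⌋₊ := by
      apply Nat.le_floor
      rw [le_div_iff₀ ha0]
      nlinarith [hu.1]
    omega

theorem uMap_affine (hM : 2 ≤ M) (ha : a ∈ Ioo 0 (1 / (M : ℝ))) (j : Fin (M + 1)) (u : ℝ) :
    uMap M a j (uRate M a j * u + uShift M a j) = u := by
  have h := mul_lt_one_of_mem hM ha
  have ha0 := ha.1
  simp only [uMap, uRate, uShift]
  split_ifs with hj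
  · field_simp; ring
  · have : 1 - (M : ℝ) * a ≠ 0 := by linarith
    rw [not_lt_eq hj]
    field_simp
    ring

theorem affine_uMap (hM : 2 ≤ M) (ha : a ∈ Ioo 0 (1 / (M : ℝ))) (j : Fin (M + 1)) (u : ℝ) :
    uRate M a j * uMap M a j u + uShift M a j = u := by
  have h := mul_lt_one_of_mem hM ha
  have ha0 := ha.1
  simp only [uMap, uRate, uShift]
  split_ifs with hj
  · field_simp; ring
  · have : 1 - (M : ℝ) * a ≠ 0 := by linarith
    rw [not_lt_eq hj]
    field_simp
    ring

theorem cDig_affine (hM : 2 ≤ M) (k : Fin M) {c : ℝ} (hc : c ∈ Ico (0 : ℝ) 1) :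
    cDig M (1 / (M : ℝ) * c + (k : ℝ) / M) = k := by
  have hM' := cast_pos_of_two_le hM
  have h1 : (M : ℝ) * (1 / (M : ℝ) * c + (k : ℝ) / M) = c + k := by field_simp
  have h2 : ⌊c + (k : ℝ)⌋₊ = k := by
    rw [Nat.floor_eq_iff (by have := hc.1; positivity)]
    constructor <;> linarith [hc.1, hc.2]
  rw [cDig, h1, h2]
  omega

end Coefficients

section AlphaMeasure

variable {M : ℕ} {a b : ℝ}

/-- The point of the cube with the given coordinates. -/
def mkCube (p : unitInterval × unitInterval × unitInterval) : cube :=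
  ⟨(p.1, p.2.1, p.2.2), p.1.2, p.2.1.2, p.2.2.2⟩

theorem measurable_mkCube : Measurable mkCube :=
  Measurable.subtype_mk (by fun_prop)

theorem cube_ext {x y : cube} (h1 : x.1.1 = y.1.1) (h2 : x.1.2.1 = y.1.2.1)
    (h3 : x.1.2.2 = y.1.2.2) : x = y :=
  Subtype.ext (Prod.ext h1 (Prod.ext h2 h3))

variable [NeZero M]

/-- The product measure on the coordinates that gives rise to `alphaMeasure`. -/
def alphaProd (M : ℕ) (a b : ℝ) [NeZero M] :
    Measure (unitInterval × unitInterval × unitInterval) :=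
  (selfSimilar (uRate M a) (uShift M a)).prod
    ((selfSimilar (cRate M) (cShift M)).prod (selfSimilar (sRate' M b) (sShift M b)))

/-- The measure of maximal entropy that gives equal masses to the domains `Ω_{α_k}`. The three
coordinates are independent with self-similar laws: the symbols that determine the expanding
coordinate are uniformly distributed, so are the digits of the central coordinate, and the
contracting coordinate is determined by the past symbols and the digits popped in the past. -/
def alphaMeasure (M : ℕ) (a b : ℝ) [NeZero M] : Measure cube := (alphaProd M a b).map mkCube

theorem isProbabilityMeasure_u (hM : 2 ≤ M) (ha : a ∈ Ioo 0 (1 / (M : ℝ))) : IsProbabilityMeasure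
    (selfSimilar (uRate M a) (uShift M a)) :=
  isProbabilityMeasure_selfSimilar (uRate_nonneg hM ha) (uShift_nonneg ha) (uRate_add_le hM ha)

theorem isProbabilityMeasure_c (hM : 2 ≤ M) : IsProbabilityMeasure
    (selfSimilar (cRate M) (cShift M)) :=
  isProbabilityMeasure_selfSimilar cRate_nonneg cShift_nonneg (cRate_add_le hM)

theorem isProbabilityMeasure_s (hM : 2 ≤ M) (hb : b ∈ Ioo 0 (1 / (M : ℝ))) : IsProbabilityMeasure
    (selfSimilar (sRate' M b) (sShift M b)) :=
  isProbabilityMeasure_selfSimilar (fun _ => (sRate_pos hM hb _).le) (sShift_nonneg hM hb)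
    (sRate_add_le hM hb)

theorem isProbabilityMeasure_alphaProd (hM : 2 ≤ M)
    (ha : a ∈ Ioo 0 (1 / (M : ℝ))) (hb : b ∈ Ioo 0 (1 / (M : ℝ))) : IsProbabilityMeasure
      (alphaProd M a b) := by
  have := isProbabilityMeasure_u hM ha
  have := isProbabilityMeasure_c hM
  have := isProbabilityMeasure_s hM hb
  unfold alphaProd; infer_instance

theorem isProbabilityMeasure_alphaMeasure (hM : 2 ≤ M)
    (ha : a ∈ Ioo 0 (1 / (M : ℝ))) (hb : b ∈ Ioo 0 (1 / (M : ℝ))) : IsProbabilityMeasure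
      (alphaMeasure M a b) :=
  have := isProbabilityMeasure_alphaProd hM ha hb
  Measure.isProbabilityMeasure_map measurable_mkCube.aemeasurable

theorem u_ne_one_ae (hM : 2 ≤ M) (ha : a ∈ Ioo 0 (1 / (M : ℝ))) : ∀ᵐ u ∂selfSimilar (uRate M a)
    (uShift M a), u ≠ 1 := by
  have h := selfSimilar_singleton_eq_zero (uRate_nonneg hM ha) (uShift_nonneg ha)
    (uRate_add_le hM ha) (y := 1) (by simp; omega) (Fin.last M) (by
      intro j x hx
      have hx' := congrArg Subtype.val hx
      rw [coe_affMap (uRate_nonneg hM ha j) (uShift_nonneg ha j) (uRate_add_le hM ha j)] at hx'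
      have h1 := mul_lt_one_of_mem hM ha
      have hx1 := x.2.2
      have ha0 := ha.1
      simp only [uRate, uShift, Icc.coe_one] at hx'
      split_ifs at hx' with hj
      · have : (j : ℝ) + 1 ≤ M := by exact_mod_cast hj
        nlinarith
      · rw [not_lt_eq hj] at hx'
        refine ⟨Fin.ext (not_lt_eq hj), Subtype.ext ?_⟩
        have : (1 - (M : ℝ) * a) * (x : ℝ) = (1 - (M : ℝ) * a) * 1 := by linarith
        exact mul_left_cancel₀ (by linarith) this)
  rw [ae_iff]
  simpa using h

theorem c_ne_one_ae (hM : 2 ≤ M) : ∀ᵐ c ∂selfSimilar (cRate M) (cShift M), c ≠ 1 := by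
  have hM' := cast_pos_of_two_le hM
  have h := selfSimilar_singleton_eq_zero cRate_nonneg cShift_nonneg
    (cRate_add_le hM) (y := 1) (by simp; omega) ⟨M - 1, by omega⟩ (by
      intro j x hx
      have hx' := congrArg Subtype.val hx
      rw [coe_affMap (cRate_nonneg j) (cShift_nonneg j) (cRate_add_le hM j)] at hx'
      have hx1 := x.2.2
      have hj1 := cast_add_one_le j
      simp only [cRate, cShift, Icc.coe_one] at hx'
      have h1 : (x : ℝ) + j = M := by
        field_simp at hx'
        linarith
      have h2 : (M : ℝ) ≤ (j : ℝ) + 1 := by linarith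
      have h3 : M ≤ (j : ℕ) + 1 := by exact_mod_cast h2
      exact ⟨Fin.ext (by simp only; omega), Subtype.ext (by rw [Icc.coe_one]; linarith)⟩)
  rw [ae_iff]
  simpa using h

theorem c_ne_zero_ae (hM : 2 ≤ M) : ∀ᵐ c ∂selfSimilar (cRate M) (cShift M), c ≠ 0 := by
  have hM' := cast_pos_of_two_le hM
  have h := selfSimilar_singleton_eq_zero cRate_nonneg cShift_nonneg
    (cRate_add_le hM) (y := 0) (by simp; omega) ⟨0, by omega⟩ (by
      intro j x hx
      have hx' := congrArg Subtype.val hx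
      rw [coe_affMap (cRate_nonneg j) (cShift_nonneg j) (cRate_add_le hM j)] at hx'
      have hx0 := x.2.1
      simp only [cRate, cShift, Icc.coe_zero] at hx'
      have h1 : (x : ℝ) + j = 0 := by
        field_simp at hx'
        linarith
      have h2 : (j : ℝ) ≤ 0 := by linarith
      have h3 : (j : ℕ) ≤ 0 := by exact_mod_cast h2
      have hj0 : (0 : ℝ) ≤ (j : ℕ) := Nat.cast_nonneg _
      exact ⟨Fin.ext (by simp only; omega), Subtype.ext (by rw [Icc.coe_zero]; linarith)⟩)
  rw [ae_iff]
  simpa using h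

theorem lt_one_of_ne_one {x : unitInterval} (h : x ≠ 1) : (x : ℝ) ∈ Ico (0 : ℝ) 1 :=
  ⟨x.2.1, lt_of_le_of_ne x.2.2 fun h' => h (Subtype.ext h')⟩

variable (hM : 2 ≤ M) (ha : a ∈ Ioo 0 (1 / (M : ℝ))) (hb : b ∈ Ioo 0 (1 / (M : ℝ)))

local notation "𝐓" => bakerMap M a b hM ha hb

theorem bakerMap_mkCube_push (j : Fin M) {u : unitInterval} (hu : u ≠ 1) (c s : unitInterval) :
    𝐓 (mkCube (affMap (uRate M a j.castSucc) (uShift M a j.castSucc) u, c, s)) =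
      mkCube (u, affMap (cRate M j) (cShift M j) c, affMap (1 - (M : ℝ) * b) 0 s) := by
  have hu' := lt_one_of_ne_one hu
  have hb1 := mul_lt_one_of_mem hM hb
  have hb0 : 0 < (M : ℝ) * b := mul_pos (cast_pos_of_two_le hM) hb.1
  have hcoe := coe_affMap (uRate_nonneg hM ha j.castSucc) (uShift_nonneg ha j.castSucc)
    (uRate_add_le hM ha j.castSucc) u
  have hsym : sym M a (mkCube (affMap (uRate M a j.castSucc) (uShift M a j.castSucc) u, c, s)) =
      j.castSucc := by
    rw [sym]
    simp only [mkCube]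
    rw [hcoe, uSym_affine hM ha _ hu']
  have hj : ((j.castSucc : Fin (M + 1)) : ℕ) < M := j.isLt
  refine cube_ext ?_ ?_ ?_
  · rw [bakerMap_u, hsym]
    simp only [mkCube]
    rw [hcoe, uMap_affine hM ha]
  · rw [bakerMap_c, hsym, cMap, if_pos hj]
    simp only [mkCube]
    rw [coe_affMap (cRate_nonneg j) (cShift_nonneg j) (cRate_add_le hM j), cRate, cShift,
      Fin.val_castSucc]
    ring
  · rw [bakerMap_s, hsym, sMap, if_pos hj]
    simp only [mkCube]
    rw [coe_affMap (by linarith) le_rfl (by linarith), add_zero]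

theorem bakerMap_mkCube_pop (k : Fin M) {u : unitInterval} (hu : u ≠ 1) {c : unitInterval}
    (hc : c ≠ 1) (s : unitInterval) :
    𝐓 (mkCube (affMap (uRate M a (Fin.last M)) (uShift M a (Fin.last M)) u,
      affMap (cRate M k) (cShift M k) c, s)) =
      mkCube (u, c, affMap b (1 + b * ((k : ℝ) - M)) s) := by
  have hu' := lt_one_of_ne_one hu
  have hc' := lt_one_of_ne_one hc
  have hM' := cast_pos_of_two_le hM
  have hcoe := coe_affMap (uRate_nonneg hM ha (Fin.last M)) (uShift_nonneg ha (Fin.last M))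
    (uRate_add_le hM ha (Fin.last M)) u
  have hccoe := coe_affMap (cRate_nonneg k) (cShift_nonneg k) (cRate_add_le hM k) c
  have hs1 := sShift_nonneg hM hb (Fin.last M, k)
  have hs2 := sRate_add_le hM hb (Fin.last M, k)
  simp only [sShift, sRate', sRate, Fin.val_last, lt_irrefl, if_false] at hs1 hs2
  set y := mkCube (affMap (uRate M a (Fin.last M)) (uShift M a (Fin.last M)) u,
      affMap (cRate M k) (cShift M k) c, s) with hy
  have hyc : y.1.2.1 = 1 / (M : ℝ) * c + (k : ℝ) / M := hccoe
  have hsym : sym M a y = Fin.last M := by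
    rw [sym, hy]
    simp only [mkCube]
    rw [hcoe, uSym_affine hM ha _ hu']
  have hdig : cDig M y.1.2.1 = k := by
    rw [hyc, cDig_affine hM k hc']
  have hj : ¬ ((Fin.last M : Fin (M + 1)) : ℕ) < M := by simp
  refine cube_ext ?_ ?_ ?_
  · rw [bakerMap_u, hsym]
    simp only [hy, mkCube]
    rw [hcoe, uMap_affine hM ha]
  · rw [bakerMap_c, hsym, cMap, if_neg hj, hdig, hyc]
    simp only [mkCube]
    field_simp
    ring
  · rw [bakerMap_s, hsym, sMap, if_neg hj, hdig]
    simp only [hy, mkCube]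
    rw [coe_affMap hb.1.le hs1 hs2]
    ring

theorem measurePreserving_alphaMeasure :
    MeasurePreserving 𝐓 (alphaMeasure M a b) (alphaMeasure M a b) := by
  have := isProbabilityMeasure_u hM ha
  have := isProbabilityMeasure_c hM
  have := isProbabilityMeasure_s hM hb
  have hT := measurable_bakerMap hM ha hb
  refine ⟨hT, Measure.ext_of_lintegral _ fun g hg => ?_⟩
  rw [lintegral_map hg hT, alphaMeasure, lintegral_map hg measurable_mkCube,
    lintegral_map (f := fun x => g (𝐓 x)) (hg.comp hT) measurable_mkCube]
  have hae : ∀ᵐ p ∂alphaProd M a b, p.1 ≠ 1 ∧ p.2.1 ≠ 1 := by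
    have h1 := Measure.quasiMeasurePreserving_fst (μ := selfSimilar (uRate M a) (uShift M a))
      (ν := (selfSimilar (cRate M) (cShift M)).prod (selfSimilar (sRate' M b) (sShift M b)))
      |>.ae (u_ne_one_ae hM ha)
    have h2 := (Measure.quasiMeasurePreserving_fst (μ := selfSimilar (cRate M) (cShift M))
      (ν := selfSimilar (sRate' M b) (sShift M b))).comp
      (Measure.quasiMeasurePreserving_snd (μ := selfSimilar (uRate M a) (uShift M a))
      (ν := (selfSimilar (cRate M) (cShift M)).prod (selfSimilar (sRate' M b) (sShift M b))))
      |>.ae (c_ne_one_ae hM)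
    filter_upwards [h1, h2] with p h1 h2 using ⟨h1, h2⟩
  -- self-similarity of the three factors
  have hU : ∀ h : unitInterval × unitInterval × unitInterval → ENNReal, Measurable h →
      ∫⁻ p, h p ∂alphaProd M a b = ((M : ENNReal) + 1)⁻¹ *
        ∑ j, ∫⁻ p, h (affMap (uRate M a j) (uShift M a j) p.1, p.2) ∂alphaProd M a b := by
    intro h hh
    have := lintegral_selfSimilar_prod (uRate_nonneg hM ha) (uShift_nonneg ha)
      (uRate_add_le hM ha) (ρ := (selfSimilar (cRate M) (cShift M)).prod
        (selfSimilar (sRate' M b) (sShift M b))) hh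
    simpa using! this
  have hC : ∀ h : unitInterval × unitInterval × unitInterval → ENNReal, Measurable h →
      ∫⁻ p, h p ∂alphaProd M a b = (M : ENNReal)⁻¹ *
        ∑ k, ∫⁻ p, h (p.1, affMap (cRate M k) (cShift M k) p.2.1, p.2.2) ∂alphaProd M a b := by
    intro h hh
    have hm : ∀ k, Measurable fun p : unitInterval × unitInterval × unitInterval =>
        h (p.1, affMap (cRate M k) (cShift M k) p.2.1, p.2.2) := fun k =>
      hh.comp (measurable_fst.prodMk ((measurable_affMap.comp (measurable_fst.comp
        measurable_snd)).prodMk (measurable_snd.comp measurable_snd)))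
    rw [alphaProd, lintegral_prod _ hh.aemeasurable]
    have h1 : ∀ u, ∫⁻ q, h (u, q) ∂(selfSimilar (cRate M) (cShift M)).prod
        (selfSimilar (sRate' M b) (sShift M b)) = (M : ENNReal)⁻¹ * ∑ k, ∫⁻ q,
          h (u, affMap (cRate M k) (cShift M k) q.1, q.2)
            ∂(selfSimilar (cRate M) (cShift M)).prod (selfSimilar (sRate' M b) (sShift M b)) := by
      intro u
      have := lintegral_selfSimilar_prod cRate_nonneg cShift_nonneg (cRate_add_le hM)
        (ρ := selfSimilar (sRate' M b) (sShift M b)) (hh.comp (measurable_prodMk_left (x := u)))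
      simpa using! this
    simp_rw [h1]
    rw [lintegral_const_mul _ (Finset.measurable_fun_sum _ fun k _ =>
      (hm k).lintegral_prod_right'), lintegral_finsetSum _ fun k _ => (hm k).lintegral_prod_right']
    congr 1
    exact Finset.sum_congr rfl fun k _ => (lintegral_prod _ (hm k).aemeasurable).symm
  have hS : ∀ h : unitInterval × unitInterval × unitInterval → ENNReal, Measurable h →
      ∫⁻ p, h p ∂alphaProd M a b = (((M : ENNReal) + 1) * M)⁻¹ * ∑ q, ∫⁻ p,
        h (p.1, p.2.1, affMap (sRate' M b q) (sShift M b q) p.2.2) ∂alphaProd M a b := by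
    intro h hh
    have hm : ∀ q, Measurable fun p : unitInterval × unitInterval × unitInterval =>
        h (p.1, p.2.1, affMap (sRate' M b q) (sShift M b q) p.2.2) := fun q =>
      hh.comp (measurable_fst.prodMk ((measurable_fst.comp measurable_snd).prodMk
        (measurable_affMap.comp (measurable_snd.comp measurable_snd))))
    rw [alphaProd, lintegral_prod _ hh.aemeasurable]
    have h1 : ∀ u, ∫⁻ q, h (u, q) ∂(selfSimilar (cRate M) (cShift M)).prod
        (selfSimilar (sRate' M b) (sShift M b)) = (((M : ENNReal) + 1) * M)⁻¹ * ∑ q, ∫⁻ p,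
          h (u, p.1, affMap (sRate' M b q) (sShift M b q) p.2)
            ∂(selfSimilar (cRate M) (cShift M)).prod (selfSimilar (sRate' M b) (sShift M b)) := by
      intro u
      have := lintegral_prod_selfSimilar (r := sRate' M b) (fun _ => (sRate_pos hM hb _).le)
        (sShift_nonneg hM hb) (sRate_add_le hM hb)
        (ρ := selfSimilar (cRate M) (cShift M)) (hh.comp (measurable_prodMk_left (x := u)))
      simpa using! this
    simp_rw [h1]
    rw [lintegral_const_mul _ (Finset.measurable_fun_sum _ fun k _ =>
      (hm k).lintegral_prod_right'), lintegral_finsetSum _ fun k _ => (hm k).lintegral_prod_right']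
    congr 1
    exact Finset.sum_congr rfl fun k _ => (lintegral_prod _ (hm k).aemeasurable).symm
  have hg' : Measurable fun p => g (mkCube p) := hg.comp measurable_mkCube
  have hgT : Measurable fun p => g (𝐓 (mkCube p)) := hg.comp (hT.comp measurable_mkCube)
  set A : ENNReal := ∫⁻ p, g (mkCube (p.1, p.2.1, affMap (1 - (M : ℝ) * b) 0 p.2.2))
    ∂alphaProd M a b with hA
  set B : Fin M → ENNReal := fun k => ∫⁻ p, g (mkCube (p.1, p.2.1,
    affMap b (1 + b * ((k : ℝ) - M)) p.2.2)) ∂alphaProd M a b with hB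
  have hM0 : (M : ENNReal) ≠ 0 := by simp; omega
  have hMt : (M : ENNReal) ≠ ⊤ := ENNReal.natCast_ne_top M
  have hM1 : (M : ENNReal) + 1 ≠ 0 := by simp
  have hM1t : (M : ENNReal) + 1 ≠ ⊤ := by finiteness
  have hR : ∫⁻ p, g (mkCube p) ∂alphaProd M a b =
      (((M : ENNReal) + 1) * M)⁻¹ * (M * (M * A) + ∑ k, B k) := by
    rw [hS _ hg', Fintype.sum_prod_type, Fin.sum_univ_castSucc]
    congr 2
    · simp [sRate', sRate, sShift, hA]
    · simp [sRate', sRate, sShift, hB]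
  have hL1 : ∑ j : Fin M, ∫⁻ p, g (𝐓 (mkCube (affMap (uRate M a j.castSucc)
      (uShift M a j.castSucc) p.1, p.2))) ∂alphaProd M a b = M * A := by
    have h1 := hC (fun p => g (mkCube (p.1, p.2.1, affMap (1 - (M : ℝ) * b) 0 p.2.2)))
      (hg'.comp (measurable_fst.prodMk ((measurable_fst.comp measurable_snd).prodMk
        (measurable_affMap.comp (measurable_snd.comp measurable_snd)))))
    rw [← hA] at h1
    rw [h1, ← mul_assoc, ENNReal.mul_inv_cancel hM0 hMt, one_mul]
    refine Finset.sum_congr rfl fun j _ => lintegral_congr_ae ?_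
    filter_upwards [hae] with p hp
    rw [bakerMap_mkCube_push hM ha hb j hp.1]
  have hL2 : ∫⁻ p, g (𝐓 (mkCube (affMap (uRate M a (Fin.last M))
      (uShift M a (Fin.last M)) p.1, p.2))) ∂alphaProd M a b = (M : ENNReal)⁻¹ * ∑ k, B k := by
    rw [hC (fun p => g (𝐓 (mkCube (affMap (uRate M a (Fin.last M))
      (uShift M a (Fin.last M)) p.1, p.2)))) (hgT.comp
        ((measurable_affMap.comp measurable_fst).prodMk measurable_snd))]
    congr 1
    refine Finset.sum_congr rfl fun k _ => lintegral_congr_ae ?_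
    filter_upwards [hae] with p hp
    rw [bakerMap_mkCube_pop hM ha hb k hp.1 hp.2]
  rw [hR, hU _ hgT, Fin.sum_univ_castSucc, hL1, hL2, ENNReal.mul_inv (Or.inl hM1) (Or.inl hM1t),
    mul_assoc]
  congr 1
  rw [mul_add, ← mul_assoc (M : ENNReal)⁻¹, ENNReal.inv_mul_cancel hM0 hMt, one_mul]

end AlphaMeasure

/-! ### The words of the product measure -/

section Words

variable {M : ℕ} {a b : ℝ}

/-- The full-branched expanding interval map that the baker map induces in the first coordinate. -/
def uStep (M : ℕ) (a u : ℝ) : ℝ := uMap M a (uSym M a u) u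

theorem iterate_u (hM : 2 ≤ M) (ha : a ∈ Ioo 0 (1 / (M : ℝ))) (hb : b ∈ Ioo 0 (1 / (M : ℝ)))
    (n : ℕ) (x : cube) :
    ((bakerMap M a b hM ha hb)^[n] x).1.1 = (uStep M a)^[n] x.1.1 := by
  induction n generalizing x with
  | zero => rfl
  | succ n ih =>
    rw [Function.iterate_succ_apply, Function.iterate_succ_apply, ih, bakerMap_u]
    rfl

theorem wordOf_sym_eq (hM : 2 ≤ M) (ha : a ∈ Ioo 0 (1 / (M : ℝ)))
    (hb : b ∈ Ioo 0 (1 / (M : ℝ))) (n : ℕ) (x : cube) :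
    wordOf (bakerMap M a b hM ha hb) (sym M a) n x = wordOf (uStep M a) (uSym M a) n x.1.1 := by
  funext i
  simp only [wordOf, sym, iterate_u]

theorem measurable_uStep : Measurable (uStep M a) := by
  have hj : Measurable fun u : ℝ => ((uSym M a u : ℕ) : ℝ) :=
    (measurable_from_top (f := fun j : Fin (M + 1) => ((j : ℕ) : ℝ))).comp measurable_uSym
  have hset : MeasurableSet {u : ℝ | (uSym M a u : ℕ) < M} :=
    measurable_uSym (MeasurableSet.of_discrete (s := {j : Fin (M + 1) | (j : ℕ) < M}))
  exact Measurable.ite hset (by fun_prop) (by fun_prop)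

/-- Points of the unit interval with a common word are exponentially close. -/
theorem abs_sub_le_of_wordOf_eq (hM : 2 ≤ M) (ha : a ∈ Ioo 0 (1 / (M : ℝ))) (n : ℕ) :
    ∀ u v : ℝ, (∀ i ≤ n, (uStep M a)^[i] u ∈ Icc (0 : ℝ) 1) →
    (∀ i ≤ n, (uStep M a)^[i] v ∈ Icc (0 : ℝ) 1) →
    wordOf (uStep M a) (uSym M a) n u = wordOf (uStep M a) (uSym M a) n v →
    |u - v| ≤ max a (1 - M * a) ^ n := by
  induction n with
  | zero =>
    intro u v hu hv _
    have h1 := hu 0 le_rfl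
    have h2 := hv 0 le_rfl
    simp only [Function.iterate_zero, id] at h1 h2
    rw [pow_zero, abs_sub_le_iff]
    constructor <;> linarith [h1.1, h1.2, h2.1, h2.2]
  | succ n ih =>
    intro u v hu hv h
    obtain ⟨h1, h2⟩ := wordOf_succ_eq_iff.1 h
    have h3 := ih (uStep M a u) (uStep M a v) (fun i hi => hu (i + 1) (by omega))
      (fun i hi => hv (i + 1) (by omega)) h2
    have h4 : u - v = uRate M a (uSym M a u) * (uStep M a u - uStep M a v) := by
      have hu' := affine_uMap hM ha (uSym M a u) u
      have hv' := affine_uMap hM ha (uSym M a v) v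
      unfold uStep
      rw [← h1] at hv' ⊢
      linear_combination hv' - hu'
    have h5 : uRate M a (uSym M a u) ≤ max a (1 - M * a) := by
      unfold uRate; split_ifs
      · exact le_max_left _ _
      · exact le_max_right _ _
    have h6 := uRate_nonneg hM ha (uSym M a u)
    rw [h4, abs_mul, abs_of_nonneg h6, pow_succ']
    exact mul_le_mul h5 h3 (abs_nonneg _) (h6.trans h5)

theorem max_uRate_lt_one (hM : 2 ≤ M) (ha : a ∈ Ioo 0 (1 / (M : ℝ))) :
    max a (1 - M * a) < 1 := by
  have h1 := mul_lt_one_of_mem hM ha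
  have h2 := two_le_cast hM
  have h3 := ha.1
  refine max_lt ?_ ?_ <;> nlinarith

theorem max_uRate_pos (ha : a ∈ Ioo 0 (1 / (M : ℝ))) : 0 < max a (1 - M * a) :=
  lt_max_of_lt_left ha.1

theorem max_sRate_lt_one (hM : 2 ≤ M) (hb : b ∈ Ioo 0 (1 / (M : ℝ))) :
    max (1 - M * b) b < 1 := by
  rw [max_comm]; exact max_uRate_lt_one hM hb

theorem prod_sRate_le (hM : 2 ≤ M) (hb : b ∈ Ioo 0 (1 / (M : ℝ))) {n : ℕ}
    (w : Fin n → Fin (M + 1)) : ∏ i, sRate M b (w i) ≤ max (1 - M * b) b ^ n := by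
  calc ∏ i, sRate M b (w i) ≤ ∏ _ : Fin n, max (1 - M * b) b :=
        Finset.prod_le_prod (fun i _ => (sRate_pos hM hb _).le) fun _ _ => by
          unfold sRate; split_ifs
          · exact le_max_left _ _
          · exact le_max_right _ _
    _ = _ := by simp

theorem prod_sRate_nonneg (hM : 2 ≤ M) (hb : b ∈ Ioo 0 (1 / (M : ℝ))) {n : ℕ}
    (w : Fin n → Fin (M + 1)) : 0 ≤ ∏ i, sRate M b (w i) :=
  Finset.prod_nonneg fun _ _ => (sRate_pos hM hb _).le

variable [NeZero M]

theorem law_u (hM : 2 ≤ M) (ha : a ∈ Ioo 0 (1 / (M : ℝ))) (n : ℕ) :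
    ∀ w : Fin n → Fin (M + 1), selfSimilar (uRate M a) (uShift M a)
      {u | wordOf (uStep M a) (uSym M a) n (u : ℝ) = w} = ((M : ENNReal) + 1)⁻¹ ^ n := by
  have := isProbabilityMeasure_u hM ha
  have hmeas : ∀ n (w : Fin n → Fin (M + 1)),
      MeasurableSet {u : unitInterval | wordOf (uStep M a) (uSym M a) n (u : ℝ) = w} := fun n w =>
    ((measurable_wordOf measurable_uStep measurable_uSym n).comp measurable_subtype_coe)
      (measurableSet_singleton w)
  induction n with
  | zero =>
    intro w
    have : {u : unitInterval | wordOf (uStep M a) (uSym M a) 0 (u : ℝ) = w} = univ :=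
      eq_univ_of_forall fun u => Subsingleton.elim _ _
    rw [this, measure_univ, pow_zero]
  | succ n ih =>
    intro w
    rw [selfSimilar_apply (uRate_nonneg hM ha) (uShift_nonneg ha) (uRate_add_le hM ha) (hmeas _ w)]
    have h1 : ∀ j, selfSimilar (uRate M a) (uShift M a) (affMap (uRate M a j) (uShift M a j) ⁻¹'
        {u | wordOf (uStep M a) (uSym M a) (n + 1) (u : ℝ) = w}) =
        if j = w 0 then ((M : ENNReal) + 1)⁻¹ ^ n else 0 := by
      intro j
      have h2 : ∀ u : unitInterval, u ≠ 1 → (wordOf (uStep M a) (uSym M a) (n + 1)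
          (affMap (uRate M a j) (uShift M a j) u : ℝ) = w ↔
          j = w 0 ∧ wordOf (uStep M a) (uSym M a) n (u : ℝ) = Fin.tail w) := by
        intro u hu
        rw [coe_affMap (uRate_nonneg hM ha j) (uShift_nonneg ha j) (uRate_add_le hM ha j),
          wordOf_succ, uStep, uSym_affine hM ha j (lt_one_of_ne_one hu), uMap_affine hM ha]
        conv_lhs => rw [← Fin.cons_self_tail w]
        rw [Fin.cons_inj]
      split_ifs with hj
      · rw [← ih (Fin.tail w)]
        refine measure_congr ?_
        filter_upwards [u_ne_one_ae hM ha] with u hu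
        exact propext ((h2 u hu).trans (and_iff_right hj))
      · rw [measure_eq_zero_iff_ae_notMem]
        filter_upwards [u_ne_one_ae hM ha] with u hu hmem
        exact hj ((h2 u hu).1 hmem).1
    simp only [h1, Finset.sum_ite_eq', Finset.mem_univ, if_true, Fintype.card_fin, Nat.cast_add,
      Nat.cast_one]
    rw [pow_succ']

variable (hM : 2 ≤ M) (ha : a ∈ Ioo 0 (1 / (M : ℝ))) (hb : b ∈ Ioo 0 (1 / (M : ℝ)))

local notation "𝐓" => bakerMap M a b hM ha hb

theorem alphaMeasure_u (hM : 2 ≤ M) (ha : a ∈ Ioo 0 (1 / (M : ℝ)))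
    (hb : b ∈ Ioo 0 (1 / (M : ℝ))) {s : Set ℝ} (hs : MeasurableSet s) :
    alphaMeasure M a b {x | x.1.1 ∈ s} = selfSimilar (uRate M a) (uShift M a) {u | (u : ℝ) ∈ s} :=
      by
  have := isProbabilityMeasure_u hM ha
  have := isProbabilityMeasure_c hM
  have := isProbabilityMeasure_s hM hb
  have hu : Measurable fun x : cube => x.1.1 := measurable_fst.comp measurable_subtype_coe
  rw [alphaMeasure, Measure.map_apply (s := {x | x.1.1 ∈ s}) measurable_mkCube (hu hs), alphaProd]
  have : mkCube ⁻¹' {x | x.1.1 ∈ s} = {u : unitInterval | (u : ℝ) ∈ s} ×ˢ univ := by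
    ext p; simp [mkCube]
  rw [this, Measure.prod_prod, measure_univ, mul_one]

theorem alphaMeasure_c (hM : 2 ≤ M) (ha : a ∈ Ioo 0 (1 / (M : ℝ)))
    (hb : b ∈ Ioo 0 (1 / (M : ℝ))) {s : Set ℝ} (hs : MeasurableSet s) :
    alphaMeasure M a b {x | x.1.2.1 ∈ s} = selfSimilar (cRate M) (cShift M) {c | (c : ℝ) ∈ s} := by
  have := isProbabilityMeasure_u hM ha
  have := isProbabilityMeasure_c hM
  have := isProbabilityMeasure_s hM hb
  have hc : Measurable fun x : cube => x.1.2.1 :=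
    (measurable_fst.comp measurable_snd).comp measurable_subtype_coe
  rw [alphaMeasure, Measure.map_apply (s := {x | x.1.2.1 ∈ s}) measurable_mkCube (hc hs), alphaProd]
  have : mkCube ⁻¹' {x | x.1.2.1 ∈ s} = univ ×ˢ ({c : unitInterval | (c : ℝ) ∈ s} ×ˢ univ) := by
    ext p; simp [mkCube]
  rw [this, Measure.prod_prod, Measure.prod_prod, measure_univ, measure_univ, mul_one, one_mul]

/-- The words read along the orbits are uniformly distributed. -/
theorem law_alphaMeasure (n : ℕ) (w : Fin n → Fin (M + 1)) :
    alphaMeasure M a b (wordOf 𝐓 (sym M a) n ⁻¹' {w}) = ((M : ENNReal) + 1)⁻¹ ^ n := by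
  rw [← law_u hM ha n w]
  have h := alphaMeasure_u hM ha hb (s := {u | wordOf (uStep M a) (uSym M a) n u = w})
    (measurable_wordOf measurable_uStep measurable_uSym n (measurableSet_singleton w))
  refine Eq.trans ?_ h
  congr 1
  ext x
  simp only [mem_preimage, mem_singleton_iff, wordOf_sym_eq]
  rfl

theorem real_law_alphaMeasure (n : ℕ) (w : Fin n → Fin (M + 1)) :
    (alphaMeasure M a b).real (wordOf 𝐓 (sym M a) n ⁻¹' {w}) = ((M : ℝ) + 1)⁻¹ ^ n := by
  rw [measureReal_def, law_alphaMeasure, ENNReal.toReal_pow, ENNReal.toReal_inv,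
    ENNReal.toReal_add (by finiteness) (by finiteness)]
  simp

theorem alphaMeasure_c_lt_one (hM : 2 ≤ M) (ha : a ∈ Ioo 0 (1 / (M : ℝ)))
    (hb : b ∈ Ioo 0 (1 / (M : ℝ))) : ∀ᵐ x ∂alphaMeasure M a b, x.1.2.1 < 1 := by
  have h := alphaMeasure_c hM ha hb (s := {1}) (measurableSet_singleton _)
  have h2 := c_ne_one_ae hM
  rw [ae_iff] at h2
  have h3 : {c : unitInterval | (c : ℝ) ∈ ({1} : Set ℝ)} = {c | ¬ c ≠ 1} :=
    Set.ext fun c => ⟨fun h => not_not.2 (Subtype.ext h), fun h => congrArg Subtype.val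
      (not_not.1 h)⟩
  rw [h3, h2] at h
  rw [ae_iff]
  refine measure_mono_null (fun x hx => ?_) h
  exact le_antisymm x.2.2.1.2 (not_lt.1 hx)

theorem alphaMeasure_c_pos (hM : 2 ≤ M) (ha : a ∈ Ioo 0 (1 / (M : ℝ)))
    (hb : b ∈ Ioo 0 (1 / (M : ℝ))) : ∀ᵐ x ∂alphaMeasure M a b, 0 < x.1.2.1 := by
  have h := alphaMeasure_c hM ha hb (s := {0}) (measurableSet_singleton _)
  have h2 := c_ne_zero_ae hM
  rw [ae_iff] at h2
  have h3 : {c : unitInterval | (c : ℝ) ∈ ({0} : Set ℝ)} = {c | ¬ c ≠ 0} :=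
    Set.ext fun c => ⟨fun h => not_not.2 (Subtype.ext h), fun h => congrArg Subtype.val
      (not_not.1 h)⟩
  rw [h3, h2] at h
  rw [ae_iff]
  refine measure_mono_null (fun x hx => ?_) h
  exact le_antisymm (not_lt.1 hx) x.2.2.1.1

/-- Sets of sequences of digits that begin with `L` times the digit `k₀` have measure at most
`M ^ (-L)`. -/
theorem selfSimilar_c_le (hM : 2 ≤ M) (s : ℕ → Set ℝ) (hs : ∀ L, MeasurableSet (s L))
    (k₀ : Fin M) (h : ∀ L (k : Fin M), ∀ c ∈ Icc (0 : ℝ) 1, (c + k) / M ∈ s (L + 1) →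
      k = k₀ ∧ c ∈ s L) (L : ℕ) :
    selfSimilar (cRate M) (cShift M) {c | (c : ℝ) ∈ s L} ≤ (M : ENNReal)⁻¹ ^ L := by
  have := isProbabilityMeasure_c hM
  induction L with
  | zero => rw [pow_zero]; exact prob_le_one
  | succ L ih =>
    rw [selfSimilar_apply cRate_nonneg cShift_nonneg (cRate_add_le hM)
      (B := {c | (c : ℝ) ∈ s (L + 1)}) (measurable_subtype_coe (hs (L + 1))), Fintype.card_fin,
        pow_succ']
    gcongr
    have h1 : ∀ (k : Fin M) (c : unitInterval), c ∈ affMap (cRate M k) (cShift M k) ⁻¹'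
        {c | (c : ℝ) ∈ s (L + 1)} → k = k₀ ∧ (c : ℝ) ∈ s L := by
      intro k c hc
      refine h L k c c.2 ?_
      have hc' : (affMap (cRate M k) (cShift M k) c : ℝ) ∈ s (L + 1) := hc
      rw [coe_affMap (cRate_nonneg k) (cShift_nonneg k) (cRate_add_le hM k), cRate, cShift] at hc'
      convert hc' using 1
      ring
    refine le_trans ?_ ih
    rw [Finset.sum_eq_single k₀]
    · exact measure_mono fun c hc => (h1 k₀ c hc).2
    · intro k _ hk
      rw [measure_eq_zero_iff_ae_notMem]
      exact ae_of_all _ fun c hc => hk (h1 k c hc).1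
    · simp

theorem alphaMeasure_c_lt_le (hM : 2 ≤ M) (ha : a ∈ Ioo 0 (1 / (M : ℝ)))
    (hb : b ∈ Ioo 0 (1 / (M : ℝ))) (L : ℕ) :
    alphaMeasure M a b {x | x.1.2.1 < ((M : ℝ) ^ L)⁻¹} ≤ (M : ENNReal)⁻¹ ^ L := by
  have hM' := cast_pos_of_two_le hM
  have h := alphaMeasure_c hM ha hb (s := Iio ((M : ℝ) ^ L)⁻¹) measurableSet_Iio
  refine h.le.trans (selfSimilar_c_le hM (fun L => Iio ((M : ℝ) ^ L)⁻¹)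
    (fun _ => measurableSet_Iio) ⟨0, by omega⟩ (fun L k c hc hmem => ?_) L)
  rw [mem_Iio, div_lt_iff₀ hM', pow_succ, mul_inv, mul_assoc, inv_mul_cancel₀ hM'.ne',
    mul_one] at hmem
  have h1 : ((M : ℝ) ^ L)⁻¹ ≤ 1 := inv_le_one_of_one_le₀ (one_le_pow₀ (by
    have := two_le_cast hM; linarith))
  have h2 : (k : ℝ) < 1 := by linarith [hc.1]
  have h3 : (k : ℕ) < 1 := by exact_mod_cast h2
  refine ⟨Fin.ext (by simp only; omega), ?_⟩
  have : (0 : ℝ) ≤ k := Nat.cast_nonneg _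
  rw [mem_Iio]
  linarith

theorem alphaMeasure_lt_c_le (hM : 2 ≤ M) (ha : a ∈ Ioo 0 (1 / (M : ℝ)))
    (hb : b ∈ Ioo 0 (1 / (M : ℝ))) (L : ℕ) :
    alphaMeasure M a b {x | 1 - ((M : ℝ) ^ L)⁻¹ < x.1.2.1} ≤ (M : ENNReal)⁻¹ ^ L := by
  have hM' := cast_pos_of_two_le hM
  have h := alphaMeasure_c hM ha hb (s := Ioi (1 - ((M : ℝ) ^ L)⁻¹)) measurableSet_Ioi
  refine h.le.trans (selfSimilar_c_le hM (fun L => Ioi (1 - ((M : ℝ) ^ L)⁻¹))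
    (fun _ => measurableSet_Ioi) ⟨M - 1, by omega⟩ (fun L k c hc hmem => ?_) L)
  rw [mem_Ioi, lt_div_iff₀ hM', sub_mul, one_mul, pow_succ, mul_inv, mul_assoc,
    inv_mul_cancel₀ hM'.ne', mul_one] at hmem
  have h1 : ((M : ℝ) ^ L)⁻¹ ≤ 1 := inv_le_one_of_one_le₀ (one_le_pow₀ (by
    have := two_le_cast hM; linarith))
  have h2 : (M : ℝ) < k + 2 := by linarith [hc.2]
  have h3 : M < (k : ℕ) + 2 := by exact_mod_cast h2
  have h4 : (k : ℕ) = M - 1 := by omega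
  refine ⟨Fin.ext h4, ?_⟩
  have : (k : ℝ) + 1 ≤ M := cast_add_one_le k
  rw [mem_Ioi]
  linarith

end Words

/-! ### Weak limits of invariant measures with uniformly distributed words -/

section Convergence

variable {M : ℕ} {a b : ℝ}

/-- The exponential rate of the probability that a uniform word does not increase the height. -/
def driftRate (M : ℕ) : ℝ := (2 / 3 * M + 3 / 2) / (M + 1)

theorem driftRate_nonneg : 0 ≤ driftRate M := by unfold driftRate; positivity

theorem driftRate_lt_one (hM : 2 ≤ M) : driftRate M < 1 := by
  have := two_le_cast hM
  rw [driftRate, div_lt_one (by positivity)]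
  linarith

/-- Chernoff's bound: most words increase the height. The weight `2/3` is one for which a single
uniform symbol has an exponential moment below one. -/
theorem card_height_lt_le (n R : ℕ) :
    ((Finset.univ.filter fun w : Fin n → Fin (M + 1) => ∑ i, stepHeight (w i) < R).card : ℝ) *
      ((M : ℝ) + 1)⁻¹ ^ n ≤ (3 / 2) ^ R * driftRate M ^ n := by
  classical
  set f : Fin (M + 1) → ℝ := fun j => (2 / 3 : ℝ) ^ stepHeight j with hf
  have hsum : ∑ j, f j = 2 / 3 * M + 3 / 2 := by
    rw [Fin.sum_univ_castSucc]
    simp [hf, stepHeight]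
    ring
  have h1 : ∑ w : Fin n → Fin (M + 1), (2 / 3 : ℝ) ^ (∑ i, stepHeight (w i)) =
      (2 / 3 * M + 3 / 2) ^ n := by
    have h := Finset.prod_univ_sum (fun _ : Fin n => (Finset.univ : Finset (Fin (M + 1))))
      fun _ j => f j
    rw [Finset.prod_const, Finset.card_univ, Fintype.card_fin, Fintype.piFinset_univ, hsum] at h
    rw [h]
    refine Finset.sum_congr rfl fun w _ => ?_
    simp only [hf]
    generalize (Finset.univ : Finset (Fin n)) = S
    induction S using Finset.induction_on with
    | empty => simp
    | insert i S hi ih => rw [Finset.sum_insert hi, Finset.prod_insert hi,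
        zpow_add₀ (by norm_num), ih]
  have h2 : ((Finset.univ.filter fun w : Fin n → Fin (M + 1) =>
      ∑ i, stepHeight (w i) < R).card : ℝ) * (2 / 3 : ℝ) ^ R ≤ (2 / 3 * M + 3 / 2) ^ n := by
    rw [← h1, ← nsmul_eq_mul, ← Finset.sum_const]
    refine (Finset.sum_le_sum fun w hw => ?_).trans
      (Finset.sum_le_sum_of_subset_of_nonneg (Finset.filter_subset _ _) fun w _ _ => by positivity)
    have := (Finset.mem_filter.1 hw).2
    rw [← zpow_natCast]
    exact zpow_le_zpow_right_of_le_one₀ (by norm_num) (by norm_num) this.le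
  have h3 : (3 / 2 : ℝ) ^ R * (2 / 3) ^ R = 1 := by rw [← mul_pow]; norm_num
  have h4 : (0 : ℝ) < ((M : ℝ) + 1)⁻¹ ^ n := by positivity
  have h5 : (0 : ℝ) < (3 / 2 : ℝ) ^ R := by positivity
  have h6 : driftRate M ^ n = (2 / 3 * M + 3 / 2) ^ n * ((M : ℝ) + 1)⁻¹ ^ n := by
    rw [driftRate, div_eq_mul_inv, mul_pow]
  rw [h6, ← mul_assoc]
  refine mul_le_mul_of_nonneg_right ?_ h4.le
  calc _ = (3 / 2 : ℝ) ^ R * (((Finset.univ.filter fun w : Fin n → Fin (M + 1) =>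
      ∑ i, stepHeight (w i) < R).card : ℝ) * (2 / 3 : ℝ) ^ R) := by
        rw [mul_left_comm, h3, mul_one]
    _ ≤ _ := mul_le_mul_of_nonneg_left h2 h5.le

variable (hM : 2 ≤ M) (ha : a ∈ Ioo 0 (1 / (M : ℝ))) (hb : b ∈ Ioo 0 (1 / (M : ℝ)))

local notation "𝐓" => bakerMap M a b hM ha hb

theorem c_lt_one_bakerMap {x : cube} (h : x.1.2.1 < 1) : (𝐓 x).1.2.1 < 1 := by
  have hM' := cast_pos_of_two_le hM
  rw [bakerMap_c, cMap]
  split_ifs with hj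
  · have : ((sym M a x : ℕ) : ℝ) + 1 ≤ M := by exact_mod_cast hj
    rw [div_lt_one hM']
    linarith
  · have h0 : ⌊(M : ℝ) * x.1.2.1⌋₊ < M := by
      rw [Nat.floor_lt (mul_nonneg hM'.le x.2.2.1.1)]
      nlinarith
    have h1 : cDig M x.1.2.1 = ⌊(M : ℝ) * x.1.2.1⌋₊ := by unfold cDig; omega
    rw [h1]
    have := Nat.lt_floor_add_one ((M : ℝ) * x.1.2.1)
    linarith

theorem c_lt_one_iterate {x : cube} (h : x.1.2.1 < 1) (n : ℕ) : (𝐓^[n] x).1.2.1 < 1 := by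
  induction n with
  | zero => exact h
  | succ n ih => rw [Function.iterate_succ_apply']; exact c_lt_one_bakerMap hM ha hb ih

theorem stepHeight_le (j : Fin (M + 1)) : stepHeight j ≤ 1 := by
  unfold stepHeight; split_ifs <;> omega

theorem height_le (T : cube → cube) (n : ℕ) (x : cube) : height T M a n x ≤ n := by
  rw [height_eq_sum]
  refine (Finset.sum_le_sum fun i _ => stepHeight_le _).trans ?_
  simp

theorem floor_eq_of_lt_one {x y : cube} (hx : x.1.2.1 < 1) (hy : y.1.2.1 < 1) :
    ⌊(M : ℝ) ^ 0 * x.1.2.1⌋₊ = ⌊(M : ℝ) ^ 0 * y.1.2.1⌋₊ := by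
  rw [pow_zero, one_mul, one_mul, Nat.floor_eq_zero.2 hx, Nat.floor_eq_zero.2 hy]

theorem u_iterate_mem (hM : 2 ≤ M) (ha : a ∈ Ioo 0 (1 / (M : ℝ)))
    (hb : b ∈ Ioo 0 (1 / (M : ℝ))) (n : ℕ) (x : cube) : (uStep M a)^[n] x.1.1 ∈ Icc (0 : ℝ) 1 := by
  rw [← iterate_u hM ha hb]
  exact ((bakerMap M a b hM ha hb)^[n] x).2.1

/-- If a common word raises the height by `2R`, then it locates the orbits up to an error that is
exponentially small in `R`, at the time at which `R` letters are left. -/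
theorem dist_iterate_lt {δ : ℝ} {R N : ℕ} (hu : max a (1 - M * a) ^ R < δ)
    (hs : max (1 - M * b) b ^ R < δ) (hc : ((M : ℝ) ^ R)⁻¹ < δ) {x y : cube}
    (hx : x.1.2.1 < 1) (hy : y.1.2.1 < 1)
    (hw : wordOf 𝐓 (sym M a) (N + R) x = wordOf 𝐓 (sym M a) (N + R) y)
    (hh : (2 * R : ℕ) ≤ height 𝐓 M a (N + R) x) : dist (𝐓^[N] x) (𝐓^[N] y) < δ := by
  have hM' := cast_pos_of_two_le hM
  have hM1 : (1 : ℝ) ≤ M := by have := two_le_cast hM; linarith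
  rw [wordOf_append, wordOf_append] at hw
  have hwN : wordOf 𝐓 (sym M a) N x = wordOf 𝐓 (sym M a) N y := by
    funext i
    simpa using congrFun hw (Fin.castAdd R i)
  have hwR : wordOf 𝐓 (sym M a) R (𝐓^[N] x) = wordOf 𝐓 (sym M a) R (𝐓^[N] y) := by
    funext i
    simpa using congrFun hw (Fin.natAdd N i)
  have hhN : (R : ℤ) ≤ height 𝐓 M a N x := by
    have h1 := height_add (M := M) (a := a) 𝐓 N R x
    have h2 := height_le (M := M) (a := a) 𝐓 R (𝐓^[N] x)
    push_cast at hh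
    linarith
  -- From a time `τ` of minimal height on, the initial stack is not touched, so the two orbits are
  -- contracted to each other.
  obtain ⟨τ, hτ, hmin⟩ := Finset.exists_min_image (Finset.range (N + 1))
    (fun i => height 𝐓 M a i x) ⟨0, by simp⟩
  have hτN : τ ≤ N := by have := Finset.mem_range.1 hτ; omega
  obtain ⟨n, rfl⟩ := Nat.exists_eq_add_of_le hτN
  have hτ0 : height 𝐓 M a τ x ≤ 0 := by
    have := hmin 0 (by simp)
    simpa [height] using this
  have hdepth : depth (wordOf 𝐓 (sym M a) n (𝐓^[τ] x)) ≤ 0 := by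
    rw [depth_le_iff]
    intro i hi
    have h1 := hmin (τ + i) (Finset.mem_range.2 (by omega))
    rw [height_add] at h1
    push_cast
    linarith
  have hwn : wordOf 𝐓 (sym M a) n (𝐓^[τ] x) = wordOf 𝐓 (sym M a) n (𝐓^[τ] y) := by
    rw [wordOf_append, wordOf_append] at hwN
    funext i
    simpa using congrFun hwN (Fin.natAdd τ i)
  have hH : (R : ℤ) ≤ height 𝐓 M a n (𝐓^[τ] x) := by
    rw [height_add] at hhN
    linarith
  have hRn : R ≤ n := by
    have := height_le (M := M) (a := a) 𝐓 n (𝐓^[τ] x)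
    omega
  have hxτ := c_lt_one_iterate hM ha hb hx τ
  have hyτ := c_lt_one_iterate hM ha hb hy τ
  obtain ⟨h1, h2⟩ := sub_iterate_eq hM ha hb n 0 (𝐓^[τ] x) (𝐓^[τ] y) hwn hdepth
    (floor_eq_of_lt_one hxτ hyτ)
  rw [← Function.iterate_add_apply, ← Function.iterate_add_apply, add_comm n τ] at h1 h2
  have habs : ∀ z z' : ℝ, z ∈ Icc (0 : ℝ) 1 → z' ∈ Icc (0 : ℝ) 1 → |z - z'| ≤ 1 := by
    intro z z' hz hz'
    rw [abs_sub_le_iff]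
    constructor <;> linarith [hz.1, hz.2, hz'.1, hz'.2]
  have hcdiff : |(𝐓^[τ + n] x).1.2.1 - (𝐓^[τ + n] y).1.2.1| < δ := by
    refine lt_of_le_of_lt ?_ hc
    have h3 : (M : ℝ) ^ R ≤ (M : ℝ) ^ height 𝐓 M a n (𝐓^[τ] x) := by
      rw [← zpow_natCast]
      exact zpow_le_zpow_right₀ hM1 hH
    have h4 := habs _ _ (𝐓^[τ] x).2.2.1 (𝐓^[τ] y).2.2.1
    rw [← h1, abs_mul, abs_of_pos (zpow_pos hM' _)] at h4
    rw [← one_div, le_div_iff₀ (by positivity)]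
    exact (mul_le_mul_of_nonneg_left h3 (abs_nonneg _)).trans h4
  have hsdiff : |(𝐓^[τ + n] x).1.2.2 - (𝐓^[τ + n] y).1.2.2| < δ := by
    refine lt_of_le_of_lt ?_ hs
    rw [h2, abs_mul, abs_of_nonneg (prod_sRate_nonneg hM hb _)]
    have h4 := habs _ _ (𝐓^[τ] x).2.2.2 (𝐓^[τ] y).2.2.2
    have hpos : 0 ≤ max (1 - M * b) b := le_max_of_le_right hb.1.le
    calc _ ≤ max (1 - M * b) b ^ n * 1 :=
          mul_le_mul (prod_sRate_le hM hb _) h4 (abs_nonneg _) (by positivity)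
      _ ≤ _ := by
          rw [mul_one]
          exact pow_le_pow_of_le_one hpos (max_sRate_lt_one hM hb).le hRn
  have hudiff : |(𝐓^[τ + n] x).1.1 - (𝐓^[τ + n] y).1.1| < δ := by
    refine lt_of_le_of_lt ?_ hu
    rw [wordOf_sym_eq, wordOf_sym_eq] at hwR
    exact abs_sub_le_of_wordOf_eq hM ha R _ _ (fun i _ => u_iterate_mem hM ha hb i _)
      (fun i _ => u_iterate_mem hM ha hb i _) hwR
  rw [Subtype.dist_eq, Prod.dist_eq, Prod.dist_eq, Real.dist_eq, Real.dist_eq, Real.dist_eq]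
  exact max_lt hudiff (max_lt hcdiff hsdiff)

instance : CompactSpace cube :=
  isCompact_iff_compactSpace.1 (isCompact_Icc.prod (isCompact_Icc.prod isCompact_Icc))

/-- Under the iteration, a continuous function becomes approximately a function of the word, outside
of a small set of words. -/
theorem exists_words_determine {φ : cube → ℝ} (hφ : Continuous φ) {ε : ℝ} (hε : 0 < ε) :
    ∃ (N m : ℕ) (B : Finset (Fin m → Fin (M + 1))), (B.card : ℝ) * ((M : ℝ) + 1)⁻¹ ^ m ≤ ε ∧
      ∀ x y : cube, x.1.2.1 < 1 → y.1.2.1 < 1 →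
        wordOf 𝐓 (sym M a) m x = wordOf 𝐓 (sym M a) m y → wordOf 𝐓 (sym M a) m x ∉ B →
        |φ (𝐓^[N] x) - φ (𝐓^[N] y)| ≤ ε := by
  have huc := CompactSpace.uniformContinuous_of_continuous hφ
  obtain ⟨δ, hδ, hφδ⟩ := Metric.uniformContinuous_iff.1 huc ε hε
  have hM' := two_le_cast hM
  have e1 := (tendsto_pow_atTop_nhds_zero_of_lt_one (max_uRate_pos ha).le
    (max_uRate_lt_one hM ha)).eventually (gt_mem_nhds hδ)
  have e2 := (tendsto_pow_atTop_nhds_zero_of_lt_one (le_max_of_le_right hb.1.le)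
    (max_sRate_lt_one hM hb)).eventually (gt_mem_nhds hδ)
  have e3 := (tendsto_inv_atTop_zero.comp (tendsto_pow_atTop_atTop_of_one_lt
    (show (1 : ℝ) < M by linarith))).eventually (gt_mem_nhds hδ)
  obtain ⟨R, h1, h2, h3⟩ := (e1.and (e2.and e3)).exists
  have e4 := ((tendsto_pow_atTop_nhds_zero_of_lt_one (driftRate_nonneg (M := M))
    (driftRate_lt_one hM)).const_mul ((3 / 2 : ℝ) ^ (2 * R))).comp
      (tendsto_add_atTop_nat R)
  rw [mul_zero] at e4
  obtain ⟨N, h4⟩ := (e4.eventually (gt_mem_nhds hε)).exists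
  refine ⟨N, N + R, Finset.univ.filter fun w => ∑ i, stepHeight (w i) < ((2 * R : ℕ) : ℤ),
    (card_height_lt_le (N + R) (2 * R)).trans h4.le, fun x y hx hy hw hB => ?_⟩
  have hB' : ((2 * R : ℕ) : ℤ) ≤ height 𝐓 M a (N + R) x := by
    rw [height_eq_sum]
    simpa using hB
  have := hφδ (dist_iterate_lt hM ha hb h1 h2 h3 hx hy hw hB')
  rw [Real.dist_eq] at this
  exact this.le

variable [NeZero M]

/-- Invariant probability measures whose words become uniformly distributed converge weakly to
`alphaMeasure`. -/
theorem tendsto_integral_alphaMeasure {κ : Type*} {l : Filter κ} {μ : κ → Measure cube}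
    (hμ : ∀ᶠ n in l, IsProbabilityMeasure (μ n) ∧ MeasurePreserving 𝐓 (μ n) (μ n) ∧
      ∀ᵐ x ∂μ n, x.1.2.1 < 1)
    (hlaw : ∀ m w, Tendsto (fun n => (μ n).real (wordOf 𝐓 (sym M a) m ⁻¹' {w})) l
      (𝓝 (((M : ℝ) + 1)⁻¹ ^ m)))
    {φ : cube → ℝ} (hφ : Continuous φ) :
    Tendsto (fun n => ∫ x, φ x ∂μ n) l (𝓝 (∫ x, φ x ∂alphaMeasure M a b)) := by
  classical
  have := isProbabilityMeasure_alphaMeasure hM ha hb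
  obtain ⟨C, hC⟩ : ∃ C, ∀ x, |φ x| ≤ C := by
    obtain ⟨C, hC⟩ := (isCompact_univ (X := cube)).exists_bound_of_continuousOn hφ.continuousOn
    exact ⟨C, fun x => hC x (mem_univ x)⟩
  have hC0 : 0 ≤ C := (abs_nonneg _).trans (hC (mkCube (0, 0, 0)))
  rw [Metric.tendsto_nhds]
  intro η hη
  -- the errors below add up to less than `(3 + 7 * C) * ε`
  set ε : ℝ := η / (3 + 7 * C) with hε
  have hε0 : 0 < ε := by positivity
  obtain ⟨N, m, B, hB, hdet⟩ := exists_words_determine hM ha hb hφ hε0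
  -- the value of `φ ∘ T^N` at some point with the given word
  set Φ : (Fin m → Fin (M + 1)) → ℝ := fun w =>
    if h : ∃ x : cube, x.1.2.1 < 1 ∧ wordOf 𝐓 (sym M a) m x = w then φ (𝐓^[N] h.choose) else 0
    with hΦ
  have hΦC : ∀ w, |Φ w| ≤ C := by
    intro w
    simp only [hΦ]
    split_ifs
    · exact hC _
    · simpa using hC0
  have hT := measurable_bakerMap hM ha hb
  have hmw := measurable_wordOf hT (measurable_sym (M := M) (a := a)) m
  have key : ∀ ν : Measure cube, IsProbabilityMeasure ν → MeasurePreserving 𝐓 ν ν →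
      (∀ᵐ x ∂ν, x.1.2.1 < 1) →
      |∫ x, φ x ∂ν - ∑ w, ν.real (wordOf 𝐓 (sym M a) m ⁻¹' {w}) * Φ w| ≤
        ε + 2 * C * ∑ w ∈ B, ν.real (wordOf 𝐓 (sym M a) m ⁻¹' {w}) := by
    intro ν hν hinv hc
    have hint : Integrable φ ν := hφ.integrable_of_hasCompactSupport
      (HasCompactSupport.of_compactSpace φ)
    have h1 : ∫ x, φ x ∂ν = ∫ x, φ (𝐓^[N] x) ∂ν := by
      have h2 := (hinv.iterate N).map_eq
      conv_lhs => rw [← h2]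
      rw [integral_map (hT.iterate N).aemeasurable hφ.aestronglyMeasurable]
    have hint' : Integrable (fun x => φ (𝐓^[N] x)) ν :=
      ((hinv.iterate N).integrable_comp hint.aestronglyMeasurable).2 hint
    have hΦi := integrable_comp_fintype (μ := ν) hmw Φ
    have h3 : ∑ w ∈ B, ν.real (wordOf 𝐓 (sym M a) m ⁻¹' {w}) =
        ∫ x, (if wordOf 𝐓 (sym M a) m x ∈ B then (1 : ℝ) else 0) ∂ν := by
      rw [integral_comp_fintype hmw fun w => if w ∈ B then (1 : ℝ) else 0]
      simp
    rw [h1, ← integral_comp_fintype hmw Φ, ← integral_sub hint' hΦi, h3, ← integral_const_mul]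
    have h4 : Integrable (fun x => ε + 2 * C * if wordOf 𝐓 (sym M a) m x ∈ B then
      (1 : ℝ) else 0) ν :=
      integrable_comp_fintype hmw fun w => ε + 2 * C * if w ∈ B then (1 : ℝ) else 0
    have h5 : ε + ∫ x, 2 * C * (if wordOf 𝐓 (sym M a) m x ∈ B then (1 : ℝ) else 0) ∂ν =
        ∫ x, (ε + 2 * C * if wordOf 𝐓 (sym M a) m x ∈ B then (1 : ℝ) else 0) ∂ν := by
      rw [integral_add (integrable_const _) (integrable_comp_fintype hmw fun w =>
        2 * C * if w ∈ B then (1 : ℝ) else 0)]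
      simp
    rw [h5]
    rw [← Real.norm_eq_abs]
    refine norm_integral_le_of_norm_le h4 ?_
    filter_upwards [hc] with x hx
    have hex : ∃ y : cube, y.1.2.1 < 1 ∧ wordOf 𝐓 (sym M a) m y = wordOf 𝐓 (sym M a) m x :=
      ⟨x, hx, rfl⟩
    rw [Real.norm_eq_abs]
    split_ifs with hxB
    · have h6 := abs_sub (φ (𝐓^[N] x)) (Φ (wordOf 𝐓 (sym M a) m x))
      have h7 := hC (𝐓^[N] x)
      have h8 := hΦC (wordOf 𝐓 (sym M a) m x)
      linarith
    · simp only [hΦ, dif_pos hex]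
      have := hdet x hex.choose hx hex.choose_spec.1 hex.choose_spec.2.symm hxB
      linarith
  set A : Measure cube := alphaMeasure M a b with hA
  have hlawA := fun w => real_law_alphaMeasure hM ha hb m w
  have keyA := key A this (measurePreserving_alphaMeasure hM ha hb)
    (alphaMeasure_c_lt_one hM ha hb)
  have hAB : ∑ w ∈ B, A.real (wordOf 𝐓 (sym M a) m ⁻¹' {w}) ≤ ε := by
    rw [Finset.sum_congr rfl fun w _ => hlawA w, Finset.sum_const, nsmul_eq_mul]
    exact hB
  have htend : Tendsto (fun n => ∑ w, |(μ n).real (wordOf 𝐓 (sym M a) m ⁻¹' {w}) -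
      A.real (wordOf 𝐓 (sym M a) m ⁻¹' {w})|) l (𝓝 0) := by
    rw [← Finset.sum_const_zero (ι := Fin m → Fin (M + 1)) (s := Finset.univ)]
    refine tendsto_finsetSum _ fun w _ => ?_
    rw [hlawA w]
    have := ((hlaw m w).sub_const (((M : ℝ) + 1)⁻¹ ^ m)).abs
    simpa using this
  filter_upwards [hμ, htend.eventually (gt_mem_nhds hε0)] with n hn hd
  have keyn := key (μ n) hn.1 hn.2.1 hn.2.2
  set d : ℝ := ∑ w, |(μ n).real (wordOf 𝐓 (sym M a) m ⁻¹' {w}) -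
      A.real (wordOf 𝐓 (sym M a) m ⁻¹' {w})| with hd'
  have h1 : ∑ w ∈ B, (μ n).real (wordOf 𝐓 (sym M a) m ⁻¹' {w}) ≤
      ∑ w ∈ B, A.real (wordOf 𝐓 (sym M a) m ⁻¹' {w}) + d := by
    have h2 : ∑ w ∈ B, ((μ n).real (wordOf 𝐓 (sym M a) m ⁻¹' {w}) -
        A.real (wordOf 𝐓 (sym M a) m ⁻¹' {w})) ≤ d :=
      (Finset.sum_le_sum fun w _ => le_abs_self _).trans
        (Finset.sum_le_sum_of_subset_of_nonneg (Finset.subset_univ _) fun _ _ _ => abs_nonneg _)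
    rw [Finset.sum_sub_distrib] at h2
    linarith
  have h2 : |∑ w, (μ n).real (wordOf 𝐓 (sym M a) m ⁻¹' {w}) * Φ w -
      ∑ w, A.real (wordOf 𝐓 (sym M a) m ⁻¹' {w}) * Φ w| ≤ C * d := by
    rw [← Finset.sum_sub_distrib, hd', Finset.mul_sum]
    refine (Finset.abs_sum_le_sum_abs _ _).trans (Finset.sum_le_sum fun w _ => ?_)
    rw [← sub_mul, abs_mul, mul_comm]
    exact mul_le_mul_of_nonneg_right (hΦC w) (abs_nonneg _)
  have h3 : 2 * C * ∑ w ∈ B, (μ n).real (wordOf 𝐓 (sym M a) m ⁻¹' {w}) ≤ 2 * C * (2 * ε) :=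
    mul_le_mul_of_nonneg_left (by linarith) (by positivity)
  have h4 : 2 * C * ∑ w ∈ B, A.real (wordOf 𝐓 (sym M a) m ⁻¹' {w}) ≤ 2 * C * ε :=
    mul_le_mul_of_nonneg_left hAB (by positivity)
  have h5 : C * d ≤ C * ε := mul_le_mul_of_nonneg_left hd.le hC0
  have h6 : (3 + 7 * C) * ε = η := by rw [hε]; field_simp
  rw [Real.dist_eq]
  rw [abs_le] at keyn keyA h2
  rw [abs_lt]
  constructor <;> nlinarith [keyn.1, keyn.2, keyA.1, keyA.2, h2.1, h2.2]

end Convergence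

/-! ### Characterization, ergodicity and entropy of the product measure -/

section Characterization

variable {M : ℕ} {a b : ℝ}
variable (hM : 2 ≤ M) (ha : a ∈ Ioo 0 (1 / (M : ℝ))) (hb : b ∈ Ioo 0 (1 / (M : ℝ)))

local notation "𝐓" => bakerMap M a b hM ha hb

/-- An orbit that stays in the face `x_c = 1` never reads the symbol `0`. -/
theorem sym_ne_zero_of_c_eq_one {x : cube} (h : (𝐓 x).1.2.1 = 1) : sym M a x ≠ 0 := by
  intro h0
  have hM' := two_le_cast hM
  rw [bakerMap_c, h0, cMap, if_pos (by simp; omega), div_eq_one_iff_eq (by positivity)] at h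
  simp only [Fin.coe_ofNat_eq_mod, Nat.zero_mod, Nat.cast_zero] at h
  linarith [x.2.2.1.2]

theorem c_eq_one_of_iterate {x : cube} {n i : ℕ} (hi : i ≤ n) (h : (𝐓^[n] x).1.2.1 = 1) :
    (𝐓^[i] x).1.2.1 = 1 := by
  obtain ⟨k, rfl⟩ := Nat.exists_eq_add_of_le hi
  refine le_antisymm (𝐓^[i] x).2.2.1.2 (not_lt.1 fun h' => ?_)
  have := c_lt_one_iterate hM ha hb h' k
  rw [← Function.iterate_add_apply, add_comm k i, h] at this
  exact lt_irrefl _ this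

/-- The face `x_c = 1` is null if the words are uniformly distributed. -/
theorem c_lt_one_ae_of_law {μ : Measure cube} [IsProbabilityMeasure μ]
    (hμ : MeasurePreserving 𝐓 μ μ)
    (hlaw : ∀ n w, μ.real (wordOf 𝐓 (sym M a) n ⁻¹' {w}) = ((M : ℝ) + 1)⁻¹ ^ n) :
    ∀ᵐ x ∂μ, x.1.2.1 < 1 := by
  classical
  have hc : Measurable fun x : cube => x.1.2.1 :=
    (measurable_fst.comp measurable_snd).comp measurable_subtype_coe
  have hT := measurable_bakerMap hM ha hb
  have hE : MeasurableSet {x : cube | x.1.2.1 = 1} := hc (measurableSet_singleton 1)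
  have hbound : ∀ n : ℕ, μ.real {x : cube | x.1.2.1 = 1} ≤ ((M : ℝ) / (M + 1)) ^ n := by
    intro n
    set S : Finset (Fin n → Fin (M + 1)) :=
      Fintype.piFinset fun _ => Finset.univ.erase 0 with hS
    have hcard : (S.card : ℝ) = (M : ℝ) ^ n := by
      rw [hS, Fintype.card_piFinset_const, Finset.card_erase_of_mem (Finset.mem_univ _),
        Finset.card_univ, Fintype.card_fin]
      simp
    have h1 : μ.real {x : cube | x.1.2.1 = 1} = μ.real {x : cube | (𝐓^[n] x).1.2.1 = 1} :=
      (law_comp_iterate hμ hc n (measurableSet_singleton 1)).symm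
    have h2 : {x : cube | (𝐓^[n] x).1.2.1 = 1} ⊆ ⋃ w ∈ S, wordOf 𝐓 (sym M a) n ⁻¹' {w} := by
      intro x hx
      simp only [mem_iUnion, mem_preimage, mem_singleton_iff, exists_prop, exists_eq_right']
      rw [hS, Fintype.mem_piFinset]
      intro i
      refine Finset.mem_erase.2 ⟨?_, Finset.mem_univ _⟩
      refine sym_ne_zero_of_c_eq_one hM ha hb (x := 𝐓^[i] x) ?_
      rw [← Function.iterate_succ_apply' 𝐓]
      exact c_eq_one_of_iterate hM ha hb i.2 hx
    rw [h1]
    refine (measureReal_mono h2 (measure_ne_top _ _)).trans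
      ((measureReal_biUnion_finset_le S _).trans ?_)
    rw [Finset.sum_congr rfl fun w _ => hlaw n w, Finset.sum_const, nsmul_eq_mul, hcard,
      ← mul_pow, div_eq_mul_inv]
  have hM' := two_le_cast hM
  have h0 : μ.real {x : cube | x.1.2.1 = 1} ≤ 0 :=
    ge_of_tendsto' (tendsto_pow_atTop_nhds_zero_of_lt_one (by positivity)
      ((div_lt_one (by positivity)).2 (by linarith))) hbound
  have h3 : μ {x : cube | x.1.2.1 = 1} = 0 :=
    (measureReal_eq_zero_iff (by finiteness)).1 (le_antisymm h0 measureReal_nonneg)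
  rw [ae_iff]
  exact measure_mono_null (fun x hx => le_antisymm x.2.2.1.2 (not_lt.1 hx)) h3

variable [NeZero M]

/-- An invariant probability measure with uniformly distributed words is `alphaMeasure`. -/
theorem eq_alphaMeasure_of_law {μ : Measure cube} [IsProbabilityMeasure μ]
    (hμ : MeasurePreserving 𝐓 μ μ)
    (hlaw : ∀ n w, μ.real (wordOf 𝐓 (sym M a) n ⁻¹' {w}) = ((M : ℝ) + 1)⁻¹ ^ n) :
    μ = alphaMeasure M a b := by
  have := isProbabilityMeasure_alphaMeasure hM ha hb
  refine ext_of_forall_integral_eq_of_IsFiniteMeasure fun f => ?_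
  have h := tendsto_integral_alphaMeasure hM ha hb (l := (atTop : Filter ℕ)) (μ := fun _ => μ)
    (.of_forall fun _ => ⟨‹_›, hμ, c_lt_one_ae_of_law hM ha hb hμ hlaw⟩)
    (fun m w => by rw [hlaw m w]; exact tendsto_const_nhds) f.continuous
  exact tendsto_nhds_unique tendsto_const_nhds h

/-- Conditioning on an invariant set gives an invariant measure, whose symbol process is absolutely
continuous with respect to the ergodic Bernoulli measure and hence equal to it. By
`eq_alphaMeasure_of_law`, the conditioned measure is `alphaMeasure`. -/
theorem ergodic_alphaMeasure : Ergodic 𝐓 (alphaMeasure M a b) := by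
  have := isProbabilityMeasure_alphaMeasure hM ha hb
  have hT := measurable_bakerMap hM ha hb
  have hpres := measurePreserving_alphaMeasure hM ha hb
  set μ := alphaMeasure M a b with hμ
  refine ⟨hpres, ⟨fun s hs hTs => ?_⟩⟩
  rw [eventuallyConst_set']
  by_cases h0 : μ s = 0
  · exact Or.inl (ae_eq_empty.2 h0)
  right
  have : IsProbabilityMeasure (ProbabilityTheory.cond μ s) :=
    ProbabilityTheory.cond_isProbabilityMeasure h0
  have hν : MeasurePreserving 𝐓 (ProbabilityTheory.cond μ s) (ProbabilityTheory.cond μ s) := by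
    have h1 := hpres.restrict_preimage hs
    rw [hTs] at h1
    exact h1.smul_measure _
  have hac : ProbabilityTheory.cond μ s ≪ μ := ProbabilityTheory.cond_absolutelyContinuous
  set I : cube → ℕ → Fin (M + 1) := fun x i => sym M a (𝐓^[i] x) with hI
  have hIm : Measurable I := measurable_pi_lambda _ fun i => measurable_sym.comp (hT.iterate i)
  have hword : ∀ n (w : Fin n → Fin (M + 1)),
      I ⁻¹' {ω | (fun i : Fin n => ω i) = w} = wordOf 𝐓 (sym M a) n ⁻¹' {w} := fun n w => rfl
  have hmw : ∀ n (w : Fin n → Fin (M + 1)),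
      MeasurableSet {ω : ℕ → Fin (M + 1) | (fun i : Fin n => ω i) = w} := fun n w =>
    (measurable_pi_lambda (fun (ω : ℕ → Fin (M + 1)) (i : Fin n) => ω i)
      fun i => measurable_pi_apply _) (measurableSet_singleton w)
  have : IsProbabilityMeasure (μ.map I) := Measure.isProbabilityMeasure_map hIm.aemeasurable
  have : IsProbabilityMeasure ((ProbabilityTheory.cond μ s).map I) :=
    Measure.isProbabilityMeasure_map hIm.aemeasurable
  have hmap : μ.map I = bernoulli (Fin (M + 1)) := by
    refine eq_bernoulli_of_law fun n w => ?_
    rw [Measure.map_apply hIm (hmw n w), hword, hμ, law_alphaMeasure hM ha hb, Fintype.card_fin]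
    push_cast
    rfl
  have hshift : MeasurePreserving shiftSeq ((ProbabilityTheory.cond μ s).map I)
      ((ProbabilityTheory.cond μ s).map I) := by
    refine ⟨measurable_shiftSeq, ?_⟩
    have h2 : shiftSeq ∘ I = I ∘ 𝐓 := by
      funext x
      funext i
      rfl
    rw [Measure.map_map measurable_shiftSeq hIm, h2, ← Measure.map_map hIm hT, hν.map_eq]
  have hmapν : (ProbabilityTheory.cond μ s).map I = μ.map I := by
    have herg : Ergodic shiftSeq (μ.map I) := by rw [hmap]; exact ergodic_shiftSeq
    exact herg.eq_of_absolutelyContinuous hshift (hac.map hIm)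
  have heq : ProbabilityTheory.cond μ s = μ := by
    rw [hμ]
    refine eq_alphaMeasure_of_law hM ha hb hν fun n w => ?_
    rw [← real_law_alphaMeasure hM ha hb n w, ← hword, measureReal_def, measureReal_def,
      ← Measure.map_apply hIm (hmw n w), hmapν, Measure.map_apply hIm (hmw n w)]
  have h3 : (ProbabilityTheory.cond μ s) sᶜ = 0 := by
    rw [ProbabilityTheory.cond_apply hs]
    simp
  rw [heq] at h3
  exact ae_eq_univ.2 h3

theorem le_measureEntropy_alphaMeasure :
    ENNReal.ofReal (Real.log (M + 1)) ≤ measureEntropy (alphaMeasure M a b) 𝐓 := by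
  refine le_trans (le_of_eq ?_) (le_iSup_of_le (M + 1) (le_iSup_of_le (sym M a)
    (le_iSup_of_le measurable_sym le_rfl)))
  have h : ∀ᶠ n : ℕ in atTop, ENNReal.ofReal (Real.log (M + 1)) =
      ENNReal.ofReal (joinEntropy (alphaMeasure M a b) 𝐓 (sym M a) n / n) := by
    filter_upwards [eventually_ne_atTop 0] with n hn
    rw [joinEntropy_eq, entropyOf_eq_log_card fun w => ?_]
    · have : (n : ℝ) ≠ 0 := by exact_mod_cast hn
      rw [Fintype.card_fun, Fintype.card_fin, Fintype.card_fin]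
      push_cast
      rw [Real.log_pow]
      field_simp
    · rw [real_law_alphaMeasure hM ha hb]
      simp
  rw [partitionEntropy, ← limsup_congr h, limsup_const]

end Characterization

/-! ### The refined partition and the universal entropy bound -/

section Refined

variable {M : ℕ} {a b : ℝ}

/-- The partition into the intersections of the strips on which the symbol is constant with the
`M`-adic strips of generation `L` in the central direction. -/
def refinedSym (M : ℕ) (a : ℝ) (L : ℕ) (x : cube) : Fin ((M + 1) * (M ^ L + 1)) :=
  finProdFinEquiv (sym M a x, ⟨min (M ^ L) ⌊(M : ℝ) ^ L * x.1.2.1⌋₊, by omega⟩)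

theorem measurable_refinedSym (L : ℕ) : Measurable (refinedSym M a L) := by
  have hc : Measurable fun x : cube => x.1.2.1 :=
    (measurable_fst.comp measurable_snd).comp measurable_subtype_coe
  have h : Measurable fun x : cube =>
      (sym M a x, (⟨min (M ^ L) ⌊(M : ℝ) ^ L * x.1.2.1⌋₊, by omega⟩ : Fin (M ^ L + 1))) := by
    refine measurable_sym.prodMk ?_
    have h1 : Measurable fun x : cube => ⌊(M : ℝ) ^ L * x.1.2.1⌋₊ :=
      Nat.measurable_floor.comp (hc.const_mul _)
    exact (Measurable.of_discrete
      (f := fun k : ℕ => (⟨min (M ^ L) k, by omega⟩ : Fin (M ^ L + 1)))).comp h1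
  exact Measurable.of_discrete.comp h

theorem refinedSym_eq_iff {L : ℕ} {x y : cube} : refinedSym M a L x = refinedSym M a L y ↔
    sym M a x = sym M a y ∧ ⌊(M : ℝ) ^ L * x.1.2.1⌋₊ = ⌊(M : ℝ) ^ L * y.1.2.1⌋₊ := by
  have h : ∀ z : cube, ⌊(M : ℝ) ^ L * z.1.2.1⌋₊ ≤ M ^ L := by
    intro z
    refine Nat.floor_le_of_le ?_
    push_cast
    exact mul_le_of_le_one_right (by positivity) z.2.2.1.2
  simp only [refinedSym, finProdFinEquiv.apply_eq_iff_eq, Prod.mk.injEq, Fin.mk.injEq,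
    min_eq_right (h _)]

theorem wordOf_sym_of_refinedSym {T : cube → cube} {L n : ℕ} {x y : cube}
    (h : wordOf T (refinedSym M a L) n x = wordOf T (refinedSym M a L) n y) :
    wordOf T (sym M a) n x = wordOf T (sym M a) n y :=
  wordOf_eq_iff.2 fun i hi => (refinedSym_eq_iff.1 (wordOf_eq_iff.1 h i hi)).1

variable (hM : 2 ≤ M) (ha : a ∈ Ioo 0 (1 / (M : ℝ))) (hb : b ∈ Ioo 0 (1 / (M : ℝ)))

local notation "𝐓" => bakerMap M a b hM ha hb

/-- The refined word determines the branches of the map along the orbit, including the popped digits,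
and all of them contract the third coordinate. -/
theorem abs_s_sub_le (n : ℕ) {L : ℕ} (hL : 1 ≤ L) (x y : cube)
    (h : wordOf 𝐓 (refinedSym M a L) n x = wordOf 𝐓 (refinedSym M a L) n y) :
    |(𝐓^[n] x).1.2.2 - (𝐓^[n] y).1.2.2| ≤ max (1 - M * b) b ^ n := by
  induction n generalizing x y with
  | zero =>
    rw [pow_zero, Function.iterate_zero_apply, Function.iterate_zero_apply, abs_sub_le_iff]
    have h1 := x.2.2.2
    have h2 := y.2.2.2
    constructor <;> linarith [h1.1, h1.2, h2.1, h2.2]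
  | succ n ih =>
    have hn := wordOf_eq_iff.1 h n (by omega)
    obtain ⟨h1, h2⟩ := refinedSym_eq_iff.1 hn
    have h3 := ih x y (wordOf_eq_iff.2 fun i hi => wordOf_eq_iff.1 h i (by omega))
    rw [Function.iterate_succ_apply', Function.iterate_succ_apply', bakerMap_s, bakerMap_s, ← h1,
      ← cDig_eq_of_floor_eq hM hL h2]
    have h4 : ∀ (j : Fin (M + 1)) (k : ℕ) (s t : ℝ),
        sMap M b j k s - sMap M b j k t = sRate M b j * (s - t) := by
      intro j k s t
      unfold sMap sRate
      split_ifs <;> ring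
    have h5 : ∀ j : Fin (M + 1), sRate M b j ≤ max (1 - M * b) b := by
      intro j
      unfold sRate
      split_ifs
      · exact le_max_left _ _
      · exact le_max_right _ _
    rw [h4, abs_mul, abs_of_pos (sRate_pos hM hb _), pow_succ']
    exact mul_le_mul (h5 _) h3 (abs_nonneg _) ((sRate_pos hM hb _).le.trans (h5 (sym M a x)))

/-- The entropy of an invariant measure is determined by the refined partitions. -/
theorem measureEntropy_le_of_refinedSym {μ : Measure cube} [IsProbabilityMeasure μ]
    (hμ : MeasurePreserving 𝐓 μ μ) {h : ℝ} (h0 : 0 ≤ h)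
    (H : ∀ L, ∀ ε > 0, ∀ᶠ n : ℕ in atTop,
      entropyOf μ (wordOf 𝐓 (refinedSym M a L) n) ≤ n * (h + ε)) :
    measureEntropy μ 𝐓 ≤ ENNReal.ofReal h := by
  refine measureEntropy_le_of_generator hμ h0 fun δ hδ => ?_
  have hM' := two_le_cast hM
  have e1 := (tendsto_pow_atTop_nhds_zero_of_lt_one (max_uRate_pos ha).le
    (max_uRate_lt_one hM ha)).eventually (gt_mem_nhds hδ)
  have e2 := (tendsto_pow_atTop_nhds_zero_of_lt_one (le_max_of_le_right hb.1.le)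
    (max_sRate_lt_one hM hb)).eventually (gt_mem_nhds hδ)
  have e3 := (tendsto_inv_atTop_zero.comp (tendsto_pow_atTop_atTop_of_one_lt
    (show (1 : ℝ) < M by linarith))).eventually (gt_mem_nhds hδ)
  obtain ⟨R, h1, h2, h3, hR⟩ := (e1.and (e2.and (e3.and (eventually_ge_atTop 1)))).exists
  -- At the time `R`, the first `R` letters locate `x_s`, the letter at that time locates `x_c`, and
  -- the last `R` letters locate `x_u`.
  refine ⟨_, refinedSym M a R, R, R + R, measurable_refinedSym R, fun x y hw => ?_, H R⟩
  have hws := wordOf_sym_of_refinedSym hw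
  have hwR : wordOf 𝐓 (sym M a) R (𝐓^[R] x) = wordOf 𝐓 (sym M a) R (𝐓^[R] y) := by
    refine wordOf_eq_iff.2 fun i hi => ?_
    rw [← Function.iterate_add_apply, ← Function.iterate_add_apply]
    exact wordOf_eq_iff.1 hws _ (by omega)
  have hudiff : |(𝐓^[R] x).1.1 - (𝐓^[R] y).1.1| < δ := by
    refine lt_of_le_of_lt ?_ h1
    rw [wordOf_sym_eq, wordOf_sym_eq] at hwR
    exact abs_sub_le_of_wordOf_eq hM ha R _ _ (fun i _ => u_iterate_mem hM ha hb i _)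
      (fun i _ => u_iterate_mem hM ha hb i _) hwR
  have hsdiff : |(𝐓^[R] x).1.2.2 - (𝐓^[R] y).1.2.2| < δ :=
    (abs_s_sub_le hM ha hb R hR x y
      (wordOf_eq_iff.2 fun i hi => wordOf_eq_iff.1 hw i (by omega))).trans_lt h2
  have hcdiff : |(𝐓^[R] x).1.2.1 - (𝐓^[R] y).1.2.1| < δ := by
    refine lt_trans ?_ h3
    have h4 := (refinedSym_eq_iff.1 (wordOf_eq_iff.1 hw R (by omega))).2
    have hp : (0 : ℝ) < (M : ℝ) ^ R := by positivity
    have h5 : ∀ z : cube, 0 ≤ (M : ℝ) ^ R * z.1.2.1 := fun z => mul_nonneg hp.le z.2.2.1.1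
    have h6 := Nat.floor_le (h5 (𝐓^[R] x))
    have h7 := Nat.floor_le (h5 (𝐓^[R] y))
    have h8 := Nat.lt_floor_add_one ((M : ℝ) ^ R * (𝐓^[R] x).1.2.1)
    have h9 := Nat.lt_floor_add_one ((M : ℝ) ^ R * (𝐓^[R] y).1.2.1)
    rw [h4] at h6 h8
    have h10 : |((𝐓^[R] x).1.2.1 - (𝐓^[R] y).1.2.1) * (M : ℝ) ^ R| < 1 := by
      rw [sub_mul, abs_sub_lt_iff]
      constructor <;> linarith
    rw [abs_mul, abs_of_pos hp] at h10
    simp only [Function.comp_apply]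
    rwa [← one_div, lt_div_iff₀ hp]
  rw [Subtype.dist_eq, Prod.dist_eq, Prod.dist_eq, Real.dist_eq, Real.dist_eq, Real.dist_eq]
  exact max_lt hudiff (max_lt hcdiff hsdiff)

open Classical in
/-- A word of symbols extends to few words of the refined partition: these are determined by the
digits of the initial stack that are read or shown. -/
theorem card_refined_le (L n : ℕ) (w : Fin n → Fin (M + 1)) :
    (Finset.univ.filter fun z => ∃ x, wordOf 𝐓 (sym M a) n x = w ∧
      wordOf 𝐓 (refinedSym M a L) n x = z).card ≤ M ^ (depth w + L) + 1 := by
  set S := Finset.univ.filter fun z => ∃ x, wordOf 𝐓 (sym M a) n x = w ∧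
      wordOf 𝐓 (refinedSym M a L) n x = z with hS
  have hex : ∀ z ∈ S, ∃ x, wordOf 𝐓 (sym M a) n x = w ∧ wordOf 𝐓 (refinedSym M a L) n x = z :=
    fun z hz => (Finset.mem_filter.1 hz).2
  have : Nonempty cube := ⟨mkCube (0, 0, 0)⟩
  choose! X hX1 hX2 using hex
  rw [← Finset.card_range (M ^ (depth w + L) + 1)]
  refine Finset.card_le_card_of_injOn (fun z => ⌊(M : ℝ) ^ (depth w + L) * (X z).1.2.1⌋₊)
    (fun z _ => ?_) (fun z hz z' hz' h => ?_)
  · rw [Finset.mem_coe, Finset.mem_range, Nat.lt_succ_iff]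
    refine Nat.floor_le_of_le ?_
    push_cast
    exact mul_le_of_le_one_right (by positivity) (X z).2.2.1.2
  · have hw : wordOf 𝐓 (sym M a) n (X z) = wordOf 𝐓 (sym M a) n (X z') :=
      (hX1 z hz).trans (hX1 z' hz').symm
    rw [← hX2 z hz, ← hX2 z' hz']
    refine wordOf_eq_iff.2 fun i hi => refinedSym_eq_iff.2 ⟨wordOf_eq_iff.1 hw i hi, ?_⟩
    refine floor_iterate_eq hM ha hb n (depth w + L) L (X z) (X z') hw ?_ h i hi.le
    rw [hX1 z hz]

theorem log_pow_add_one_le (hM : 2 ≤ M) (k : ℕ) :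
    Real.log ((M ^ k + 1 : ℕ) : ℝ) ≤ (k + 1) * Real.log M := by
  have h : M ^ k + 1 ≤ M ^ (k + 1) := by
    have := Nat.one_le_pow k M (by omega)
    rw [pow_succ]
    nlinarith
  calc Real.log ((M ^ k + 1 : ℕ) : ℝ) ≤ Real.log ((M ^ (k + 1) : ℕ) : ℝ) :=
        Real.log_le_log (by positivity) (by exact_mod_cast h)
    _ = _ := by push_cast; rw [Real.log_pow]; push_cast; ring

/-- Prepending a pushing symbol lowers the depth by one unless it vanishes, prepending the popping
symbol raises it by one, and there are `M` pushing symbols. -/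
theorem sum_pow_depth_le (n : ℕ) :
    ∑ w : Fin n → Fin (M + 1), (M : ℝ) ^ depth w ≤ (n + 1) * ((M : ℝ) + 1) ^ n := by
  induction n with
  | zero => simp [depth]
  | succ n ih =>
    rw [← (Fin.consEquiv fun _ : Fin (n + 1) => Fin (M + 1)).sum_comp, Fintype.sum_prod_type]
    have h1 : ∀ (j : Fin (M + 1)) (w : Fin n → Fin (M + 1)),
        (M : ℝ) ^ depth ((Fin.consEquiv fun _ : Fin (n + 1) => Fin (M + 1)) (j, w)) =
          if (j : ℕ) < M then (M : ℝ) ^ (depth w - 1) else (M : ℝ) ^ (depth w + 1) := by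
      intro j w
      change (M : ℝ) ^ depth (Fin.cons j w : Fin (n + 1) → Fin (M + 1)) = _
      rw [depth_cons]
      split_ifs <;> rfl
    simp only [h1]
    rw [Fin.sum_univ_castSucc]
    simp only [Fin.val_castSucc, Fin.is_lt, if_true, Fin.val_last, lt_irrefl, if_false,
      Finset.sum_const, Finset.card_univ, Fintype.card_fin, nsmul_eq_mul]
    have h2 : (M : ℝ) * ∑ w : Fin n → Fin (M + 1), (M : ℝ) ^ (depth w - 1) ≤
        ∑ w : Fin n → Fin (M + 1), (M : ℝ) ^ depth w + M * ((M : ℝ) + 1) ^ n := by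
      have h3 : (M : ℝ) * ((M : ℝ) + 1) ^ n = ∑ w : Fin n → Fin (M + 1), (M : ℝ) := by
        simp [mul_comm]
      rw [h3, Finset.mul_sum, ← Finset.sum_add_distrib]
      refine Finset.sum_le_sum fun w _ => ?_
      rcases Nat.eq_zero_or_pos (depth w) with h | h
      · rw [h]; simp
      · rw [← pow_succ', Nat.sub_add_cancel h]
        simp
    have h4 : ∑ w : Fin n → Fin (M + 1), (M : ℝ) ^ (depth w + 1) =
        M * ∑ w : Fin n → Fin (M + 1), (M : ℝ) ^ depth w := by
      rw [Finset.mul_sum]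
      exact Finset.sum_congr rfl fun w _ => pow_succ' _ _
    rw [h4]
    have h5 : (0 : ℝ) ≤ ((M : ℝ) + 1) ^ n := by positivity
    have h6 : (0 : ℝ) ≤ M := Nat.cast_nonneg _
    push_cast
    rw [pow_succ]
    nlinarith [mul_le_mul_of_nonneg_left ih (show (0 : ℝ) ≤ M + 1 by positivity)]

theorem eventually_log_le {C ε : ℝ} (hε : 0 < ε) :
    ∀ᶠ n : ℕ in atTop, C + Real.log (n + 1) ≤ n * ε := by
  have h1 : Tendsto (fun n : ℕ => Real.log ((n : ℝ) + 1) / ((n : ℝ) + 1)) atTop (𝓝 0) :=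
    (Real.isLittleO_log_id_atTop.tendsto_div_nhds_zero).comp
      (tendsto_atTop_add_const_right _ 1 tendsto_natCast_atTop_atTop)
  have h2 : Tendsto (fun n : ℕ => (n : ℝ) * (ε / 2)) atTop atTop :=
    tendsto_natCast_atTop_atTop.atTop_mul_const (by positivity)
  filter_upwards [h1.eventually (gt_mem_nhds (half_pos hε)),
    h2.eventually_ge_atTop (C + ε / 2)] with n h3 h4
  have h5 : (0 : ℝ) < (n : ℝ) + 1 := by positivity
  rw [div_lt_iff₀ h5] at h3
  linarith

/-- No invariant probability measure has entropy above `log (M + 1)`: guess a word `w` with a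
probability proportional to `M ^ depth w`, and then one of its refinements. -/
theorem measureEntropy_le_log {μ : Measure cube} [IsProbabilityMeasure μ]
    (hμ : MeasurePreserving 𝐓 μ μ) :
    measureEntropy μ 𝐓 ≤ ENNReal.ofReal (Real.log (M + 1)) := by
  have hM' := two_le_cast hM
  have hT := measurable_bakerMap hM ha hb
  refine measureEntropy_le_of_refinedSym hM ha hb hμ (Real.log_nonneg (by linarith))
    fun L ε hε => ?_
  filter_upwards [eventually_log_le (C := (L + 1) * Real.log M) hε] with n hn
  set Z : ℝ := ∑ w : Fin n → Fin (M + 1), (M : ℝ) ^ depth w with hZ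
  have hpos : ∀ w : Fin n → Fin (M + 1), 0 < (M : ℝ) ^ depth w := fun w => by positivity
  have hZ0 : 0 < Z := Finset.sum_pos (fun w _ => hpos w) Finset.univ_nonempty
  have h1 := entropyOf_le_of_card_le (μ := μ)
    (measurable_wordOf hT (measurable_sym (M := M) (a := a)) n)
    (measurable_wordOf hT (measurable_refinedSym (M := M) (a := a) L) n)
    (fun w => (M : ℝ) ^ depth w / Z) (fun w => (div_pos (hpos w) hZ0).le)
    (by rw [← Finset.sum_div, div_self hZ0.ne']) (ae_of_all _ fun x => div_pos (hpos _) hZ0)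
    (fun w => M ^ (depth w + L) + 1) (card_refined_le hM ha hb L n)
  have h2 : ∀ w : Fin n → Fin (M + 1), -Real.log ((M : ℝ) ^ depth w / Z) +
      Real.log ((M ^ (depth w + L) + 1 : ℕ) : ℝ) ≤ Real.log Z + (L + 1) * Real.log M := by
    intro w
    have := log_pow_add_one_le hM (depth w + L)
    rw [Real.log_div (hpos w).ne' hZ0.ne', Real.log_pow]
    push_cast at this ⊢
    linarith
  have h3 : Real.log Z ≤ Real.log (n + 1) + n * Real.log (M + 1) := by
    have := Real.log_le_log hZ0 (sum_pow_depth_le (M := M) n)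
    rwa [Real.log_mul (by positivity) (by positivity), Real.log_pow] at this
  have h4 : ∫ x, (-Real.log ((M : ℝ) ^ depth (wordOf 𝐓 (sym M a) n x) / Z) +
      Real.log ((M ^ (depth (wordOf 𝐓 (sym M a) n x) + L) + 1 : ℕ) : ℝ)) ∂μ ≤
      ∫ _, (Real.log Z + (L + 1) * Real.log M) ∂μ :=
    integral_mono (integrable_comp_fintype
      (measurable_wordOf hT (measurable_sym (M := M) (a := a)) n) fun w =>
        -Real.log ((M : ℝ) ^ depth w / Z) + Real.log ((M ^ (depth w + L) + 1 : ℕ) : ℝ))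
      (integrable_const _) fun x => h2 _
  rw [integral_const, probReal_univ, one_smul] at h4
  linarith

variable [NeZero M]

theorem measureEntropy_alphaMeasure :
    measureEntropy (alphaMeasure M a b) 𝐓 = ENNReal.ofReal (Real.log (M + 1)) := by
  have := isProbabilityMeasure_alphaMeasure hM ha hb
  exact le_antisymm (measureEntropy_le_log hM ha hb (measurePreserving_alphaMeasure hM ha hb))
    (le_measureEntropy_alphaMeasure hM ha hb)

end Refined

/-! ### Uniqueness under small popping depth -/

section Uniqueness

open Classical in
theorem entropyOf_le_add_integral_log {Ω ι κ : Type*} [MeasurableSpace Ω] {μ : Measure Ω}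
    [IsProbabilityMeasure μ] [Fintype ι] [MeasurableSpace ι] [MeasurableSingletonClass ι]
    [Fintype κ] [MeasurableSpace κ] [MeasurableSingletonClass κ] {Y : Ω → κ} {Z : Ω → ι}
    (hY : Measurable Y) (hZ : Measurable Z) (N : κ → ℕ)
    (hN : ∀ y, (Finset.univ.filter fun z => ∃ x, Y x = y ∧ Z x = z).card ≤ N y) :
    entropyOf μ Z ≤ entropyOf μ Y + ∫ x, Real.log (N (Y x)) ∂μ := by
  have h := entropyOf_le_of_card_le hY hZ (fun y => μ.real (Y ⁻¹' {y}))
    (fun _ => measureReal_nonneg) (sum_law hY).le (ae_law_pos Y) N hN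
  rwa [integral_add (integrable_comp_fintype hY fun y => -Real.log (μ.real (Y ⁻¹' {y})))
    (integrable_comp_fintype hY fun y => Real.log (N y)), ← entropyOf_eq_integral hY] at h

variable {M : ℕ} {a b : ℝ}

theorem depth_le {n : ℕ} (w : Fin n → Fin (M + 1)) : depth w ≤ n := by
  induction n with
  | zero => simp [depth]
  | succ n ih =>
    rw [← Fin.cons_self_tail w, depth_cons]
    have := ih (Fin.tail w)
    split_ifs <;> omega

theorem depth_wordOf_succ (T : cube → cube) (n : ℕ) (x : cube) :
    depth (wordOf T (sym M a) (n + 1) x) = if (sym M a x : ℕ) < M then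
      depth (wordOf T (sym M a) n (T x)) - 1 else depth (wordOf T (sym M a) n (T x)) + 1 := by
  rw [wordOf_succ, depth_cons]

theorem depth_wordOf_mono (T : cube → cube) (x : cube) :
    Monotone fun n => depth (wordOf T (sym M a) n x) := fun m n h =>
  (depth_le_iff T m _ x).2 fun i hi => (depth_le_iff T n _ x).1 le_rfl i (hi.trans h)

variable (hM : 2 ≤ M) (ha : a ∈ Ioo 0 (1 / (M : ℝ))) (hb : b ∈ Ioo 0 (1 / (M : ℝ)))

local notation "𝐓" => bakerMap M a b hM ha hb

/-- If the refined words carry no more entropy than the words of symbols, at exponential scale, then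
maximal entropy forces the words of symbols to be uniformly distributed. -/
theorem eq_alphaMeasure_of_entropyOf_le [NeZero M] {μ : Measure cube} [IsProbabilityMeasure μ]
    (hμ : MeasurePreserving 𝐓 μ μ)
    (hent : ENNReal.ofReal (Real.log (M + 1)) ≤ measureEntropy μ 𝐓)
    (H : ∀ L, ∀ ε > 0, ∀ᶠ n : ℕ in atTop, entropyOf μ (wordOf 𝐓 (refinedSym M a L) n) ≤
      entropyOf μ (wordOf 𝐓 (sym M a) n) + n * ε) :
    μ = alphaMeasure M a b := by
  have hT := measurable_bakerMap hM ha hb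
  refine eq_alphaMeasure_of_law hM ha hb hμ fun m w => ?_
  have hmw := measurable_wordOf hT (measurable_sym (M := M) (a := a)) m
  have hcard : (Fintype.card (Fin m → Fin (M + 1)) : ℝ) = ((M : ℝ) + 1) ^ m := by simp
  rw [inv_pow, ← hcard]
  refine law_eq_of_entropyOf_eq hmw ?_ w
  rcases Nat.eq_zero_or_pos m with rfl | hm
  · simpa using entropyOf_nonneg _
  have hm' : (0 : ℝ) < m := by exact_mod_cast hm
  have h0 : 0 ≤ entropyOf μ (wordOf 𝐓 (sym M a) m) / m :=
    div_nonneg (entropyOf_nonneg _) hm'.le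
  have h1 := measureEntropy_le_of_refinedSym hM ha hb hμ h0 fun L ε hε => by
    filter_upwards [H L (ε / 2) (by positivity), eventually_entropyOf_le hμ
      (measurable_sym (M := M) (a := a)) hm.ne'
      (half_pos hε)] with n h2 h3
    linarith
  have h4 := (ENNReal.ofReal_le_ofReal_iff h0).1 (hent.trans h1)
  rw [le_div_iff₀ hm'] at h4
  rw [hcard, Real.log_pow]
  linarith

/-- The cost of the refinement is governed by the mean popping depth. -/
theorem entropyOf_refined_le {μ : Measure cube} [IsProbabilityMeasure μ] (L n : ℕ) :
    entropyOf μ (wordOf 𝐓 (refinedSym M a L) n) ≤ entropyOf μ (wordOf 𝐓 (sym M a) n) +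
      (L + 1 + ∫ x, (depth (wordOf 𝐓 (sym M a) n x) : ℝ) ∂μ) * Real.log M := by
  have hT := measurable_bakerMap hM ha hb
  have hmw := measurable_wordOf hT (measurable_sym (M := M) (a := a)) n
  refine (entropyOf_le_add_integral_log hmw (measurable_wordOf hT (measurable_refinedSym L) n)
    (fun w => M ^ (depth w + L) + 1) (card_refined_le hM ha hb L n)).trans ?_
  have hi : Integrable (fun x => (depth (wordOf 𝐓 (sym M a) n x) : ℝ)) μ :=
    integrable_comp_fintype hmw fun w => (depth w : ℝ)
  have h : ∫ x, Real.log ((M ^ (depth (wordOf 𝐓 (sym M a) n x) + L) + 1 : ℕ) : ℝ) ∂μ ≤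
      ∫ x, ((L + 1 : ℝ) + depth (wordOf 𝐓 (sym M a) n x)) * Real.log M ∂μ := by
    refine integral_mono (integrable_comp_fintype hmw fun w =>
      Real.log ((M ^ (depth w + L) + 1 : ℕ) : ℝ)) (((integrable_const _).add hi).mul_const _)
      fun x => ?_
    have := log_pow_add_one_le hM (depth (wordOf 𝐓 (sym M a) n x) + L)
    refine this.trans_eq ?_
    push_cast
    ring
  rw [integral_mul_const, integral_add (integrable_const _) hi, integral_const, probReal_univ,
    one_smul] at h
  linarith

/-- If the symbols push at least as often as they pop, the mean popping depth is sublinear. -/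
theorem tendsto_integral_depth_div {μ : Measure cube} [IsProbabilityMeasure μ]
    (hμ : Ergodic 𝐓 μ) (hdrift : 0 ≤ ∫ x, (stepHeight (sym M a x) : ℝ) ∂μ) :
    Tendsto (fun n : ℕ => (∫ x, (depth (wordOf 𝐓 (sym M a) n x) : ℝ) ∂μ) / n) atTop (𝓝 0) := by
  have hT := measurable_bakerMap hM ha hb
  set d : ℕ → cube → ℕ := fun n x => depth (wordOf 𝐓 (sym M a) n x) with hd
  have hmw := fun n => measurable_wordOf hT (measurable_sym (M := M) (a := a)) n
  have hdm : ∀ n, Measurable (d n) := fun n =>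
    (Measurable.of_discrete (f := fun w : Fin n → Fin (M + 1) => depth w)).comp (hmw n)
  have hdi : ∀ n, Integrable (fun x => (d n x : ℝ)) μ := fun n =>
    integrable_comp_fintype (hmw n) fun w => (depth w : ℝ)
  have hsucc : ∀ n x, d (n + 1) x = if (sym M a x : ℕ) < M then d n (𝐓 x) - 1 else d n (𝐓 x) + 1 :=
    fun n x => depth_wordOf_succ 𝐓 n x
  have hmono : ∀ x, Monotone fun n => d n x := fun x => depth_wordOf_mono 𝐓 x
  -- By ergodicity, the depths are almost surely bounded or almost surely unbounded in `n`.
  set A : Set cube := {x | ∃ K, ∀ n, d n x ≤ K} with hA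
  have hAm : MeasurableSet A := by
    have : A = ⋃ K, ⋂ n, d n ⁻¹' Iic K := by ext x; simp [hA]
    rw [this]
    exact .iUnion fun K => .iInter fun n => hdm n measurableSet_Iic
  have hTA : 𝐓 ⁻¹' A = A := by
    ext x
    constructor
    · rintro ⟨K, hK⟩
      refine ⟨K + 1, fun n => (hmono x (Nat.le_succ n)).trans ?_⟩
      have h1 := hsucc n x
      have h2 := hK n
      change d (n + 1) x ≤ K + 1
      rw [h1]
      split_ifs <;> omega
    · rintro ⟨K, hK⟩
      refine ⟨K + 1, fun n => ?_⟩
      have h1 := hsucc n x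
      have h2 := hK (n + 1)
      rw [h1] at h2
      split_ifs at h2 <;> omega
  rcases hμ.ae_mem_or_ae_notMem hAm hTA with hfull | hnull
  · have h := tendsto_integral_of_dominated_convergence (F := fun (n : ℕ) x => (d n x : ℝ) / n)
      (f := fun _ => (0 : ℝ)) (μ := μ) (fun _ => 1)
      (fun n => ((hdi n).div_const _).aestronglyMeasurable) (integrable_const _)
      (fun n => ae_of_all _ fun x => ?_) ?_
    · simpa [integral_div] using h
    · rw [Real.norm_of_nonneg (by positivity)]
      exact div_le_one_of_le₀ (by exact_mod_cast depth_le _) (Nat.cast_nonneg _)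
    · filter_upwards [hfull] with x hx
      obtain ⟨K, hK⟩ := hx
      refine squeeze_zero (fun n => by positivity) (fun n => ?_)
        (tendsto_const_div_atTop_nhds_zero_nat (K : ℝ))
      gcongr
      exact hK n
  -- Prepending a symbol changes the depth by minus the step of the height, except that it stays
  -- `0` when a symbol is pushed at depth `0`. As the drift is not negative, the mean depth grows by
  -- at most the probability `q n` of depth `0`, which tends to `0`.
  · set q : ℕ → ℝ := fun n => μ.real {x | d n x = 0} with hq
    have hZm : ∀ n, MeasurableSet {x | d n x = 0} := fun n => hdm n (measurableSet_singleton 0)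
    have hq0 : Tendsto q atTop (𝓝 0) := by
      have h1 := tendsto_measure_iInter_atTop (μ := μ) (s := fun n => {x | d n x = 0})
        (fun n => (hZm n).nullMeasurableSet)
        (fun m n hmn x hx => Nat.le_zero.1 ((hmono x hmn).trans (le_of_eq hx)))
        ⟨0, measure_ne_top _ _⟩
      have h2 : μ (⋂ n, {x | d n x = 0}) = 0 := by
        refine measure_mono_null (fun x hx => ?_) (measure_eq_zero_iff_ae_notMem.2 hnull)
        exact ⟨0, fun n => le_of_eq (mem_iInter.1 hx n)⟩
      rw [h2] at h1
      have h3 := (ENNReal.tendsto_toReal ENNReal.zero_ne_top).comp h1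
      rw [ENNReal.toReal_zero] at h3
      exact h3
    have hstep : ∀ n, ∫ x, (d (n + 1) x : ℝ) ∂μ ≤ ∫ x, (d n x : ℝ) ∂μ + q n := by
      intro n
      have hi1 : Integrable (fun x => (d n (𝐓 x) : ℝ)) μ :=
        (hμ.toMeasurePreserving.integrable_comp (hdi n).aestronglyMeasurable).2 (hdi n)
      have hi2 : Integrable (fun x => (stepHeight (sym M a x) : ℝ)) μ :=
        integrable_comp_fintype measurable_sym fun j => (stepHeight j : ℝ)
      have hind : MeasurableSet {x | d n (𝐓 x) = 0} := hT (hZm n)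
      have hi3 : Integrable ({x | d n (𝐓 x) = 0}.indicator fun _ => (1 : ℝ)) μ :=
        (integrable_const _).indicator hind
      have e1 : ∫ x, (d n (𝐓 x) : ℝ) ∂μ = ∫ x, (d n x : ℝ) ∂μ := by
        have h := integral_map (μ := μ) hT.aemeasurable (f := fun x => (d n x : ℝ)) (by
          rw [hμ.toMeasurePreserving.map_eq]
          exact (hdi n).aestronglyMeasurable)
        rw [hμ.toMeasurePreserving.map_eq] at h
        exact h.symm
      have e2 : ∫ x, {x | d n (𝐓 x) = 0}.indicator (fun _ => (1 : ℝ)) x ∂μ = q n := by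
        rw [integral_indicator_const _ hind, smul_eq_mul, mul_one]
        exact hμ.toMeasurePreserving.measureReal_preimage (hZm n).nullMeasurableSet
      have h1 : ∫ x, (d (n + 1) x : ℝ) ∂μ ≤ ∫ x, ((d n (𝐓 x) : ℝ) - stepHeight (sym M a x) +
          {x | d n (𝐓 x) = 0}.indicator (fun _ => (1 : ℝ)) x) ∂μ := by
        refine integral_mono (hdi _) ((hi1.sub hi2).add hi3) fun x => ?_
        simp only [hsucc n x, stepHeight]
        rcases Nat.eq_zero_or_pos (d n (𝐓 x)) with h0 | h0
        · rw [indicator_of_mem (by exact h0), h0]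
          split_ifs <;> norm_num
        · rw [indicator_of_notMem (s := {x | d n (𝐓 x) = 0}) fun h => h0.ne' h]
          split_ifs
          · rw [Nat.cast_sub h0]; norm_num
          · push_cast; linarith
      rw [integral_add (f := fun x => (d n (𝐓 x) : ℝ) - stepHeight (sym M a x)) (hi1.sub hi2) hi3,
        integral_sub hi1 hi2, e1, e2] at h1
      linarith
    have hsum : ∀ n : ℕ, ∫ x, (d n x : ℝ) ∂μ ≤ ∑ i ∈ Finset.range n, q i := by
      intro n
      induction n with
      | zero => simp [hd, depth]
      | succ n ih =>
        rw [Finset.sum_range_succ]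
        linarith [hstep n]
    refine squeeze_zero (fun n => div_nonneg (integral_nonneg fun x => Nat.cast_nonneg _)
      (Nat.cast_nonneg _)) (fun n => ?_) hq0.cesaro
    rw [div_eq_inv_mul]
    exact mul_le_mul_of_nonneg_left (hsum n) (by positivity)

/-- An ergodic measure of maximal entropy that pushes at least as often as it pops is `alphaMeasure`. -/
theorem eq_alphaMeasure_of_drift [NeZero M] {μ : Measure cube} [IsProbabilityMeasure μ]
    (hμ : Ergodic 𝐓 μ) (hent : ENNReal.ofReal (Real.log (M + 1)) ≤ measureEntropy μ 𝐓)
    (hdrift : 0 ≤ ∫ x, (stepHeight (sym M a x) : ℝ) ∂μ) : μ = alphaMeasure M a b := by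
  have hM' := two_le_cast hM
  refine eq_alphaMeasure_of_entropyOf_le hM ha hb hμ.toMeasurePreserving hent fun L ε hε => ?_
  have hlog : 0 ≤ Real.log M := Real.log_nonneg (by linarith)
  have h1 : Tendsto (fun n : ℕ => ((L + 1 : ℝ) / n +
      (∫ x, (depth (wordOf 𝐓 (sym M a) n x) : ℝ) ∂μ) / n) * Real.log M) atTop (𝓝 0) := by
    have := ((tendsto_const_div_atTop_nhds_zero_nat (L + 1 : ℝ)).add
      (tendsto_integral_depth_div hM ha hb hμ hdrift)).mul_const (Real.log M)
    simpa using this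
  filter_upwards [h1.eventually (gt_mem_nhds hε), eventually_gt_atTop 0] with n h2 hn
  have hn' : (0 : ℝ) < n := by exact_mod_cast hn
  refine (entropyOf_refined_le hM ha hb L n).trans ?_
  rw [← add_div, div_mul_eq_mul_div, div_lt_iff₀ hn'] at h2
  linarith

/-- The `M`-adic rationals: in `[0, 1)` these are the central coordinates with finitely many nonzero
digits in base `M`. -/
def adicSet (M : ℕ) : Set ℝ := range fun p : ℕ × ℤ => (p.2 : ℝ) / (M : ℝ) ^ p.1

theorem adicSet_iff (hM : 2 ≤ M) {x y : ℝ} {k : ℤ} (h : M * y = x + k) :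
    x ∈ adicSet M ↔ y ∈ adicSet M := by
  have hM' := cast_pos_of_two_le hM
  constructor
  · rintro ⟨⟨K, i⟩, rfl⟩
    refine ⟨(K + 1, i + k * (M : ℤ) ^ K), ?_⟩
    have hp : (0 : ℝ) < (M : ℝ) ^ K := by positivity
    push_cast
    simp only at h
    rw [div_eq_iff (by positivity), pow_succ]
    field_simp at h
    linear_combination -h
  · rintro ⟨⟨K, i⟩, rfl⟩
    refine ⟨(K, M * i - k * (M : ℤ) ^ K), ?_⟩
    have hp : (0 : ℝ) < (M : ℝ) ^ K := by positivity
    push_cast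
    simp only at h
    rw [div_eq_iff (by positivity)]
    field_simp at h
    linear_combination h

theorem bakerMap_mem_adicSet (x : cube) : (𝐓 x).1.2.1 ∈ adicSet M ↔ x.1.2.1 ∈ adicSet M := by
  have hM' := cast_pos_of_two_le hM
  rw [bakerMap_c, cMap]
  split_ifs with hj
  · refine (adicSet_iff (k := (sym M a x : ℕ)) hM ?_).symm
    rw [mul_div_cancel₀ _ hM'.ne']
    push_cast
    rfl
  · refine adicSet_iff (k := cDig M x.1.2.1) hM ?_
    push_cast
    ring

open Classical in
/-- If the initial stack is almost surely finite, then it takes few values up to a small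
probability, and the refined words carry no more entropy than the words of symbols. -/
theorem eventually_entropyOf_refined_le_of_adicSet {μ : Measure cube} [IsProbabilityMeasure μ]
    (h : ∀ᵐ x ∂μ, x.1.2.1 ∈ adicSet M) (L : ℕ) {ε : ℝ} (hε : 0 < ε) :
    ∀ᶠ n : ℕ in atTop, entropyOf μ (wordOf 𝐓 (refinedSym M a L) n) ≤
      entropyOf μ (wordOf 𝐓 (sym M a) n) + n * ε := by
  have hM' := two_le_cast hM
  have hlog : 0 < Real.log M := Real.log_pos (by linarith)
  have hT := measurable_bakerMap hM ha hb
  have hc : Measurable fun x : cube => x.1.2.1 :=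
    (measurable_fst.comp measurable_snd).comp measurable_subtype_coe
  obtain ⟨f, hf⟩ := (countable_range fun p : ℕ × ℤ =>
    (p.2 : ℝ) / (M : ℝ) ^ p.1).exists_eq_range ⟨_, mem_range_self (0, 0)⟩
  set η : ℝ := ε / (2 * Real.log M) with hη
  have hη0 : 0 < η := by positivity
  -- the points whose central coordinate is not among the first `m` elements of `adicSet M`
  set B : ℕ → Set cube := fun m => ⋂ i, ⋂ (_ : i < m), ((fun x : cube => x.1.2.1) ⁻¹' {f i})ᶜ
    with hB
  have hBm : ∀ m, MeasurableSet (B m) := fun m =>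
    .iInter fun i => .iInter fun _ => (hc (measurableSet_singleton (f i))).compl
  have hBmem : ∀ m x, x ∈ B m ↔ ∀ i < m, x.1.2.1 ≠ f i := by simp [hB]
  obtain ⟨m, hm⟩ : ∃ m, μ.real (B m) ≤ η := by
    have h1 := tendsto_measure_iInter_atTop (μ := μ) (s := B)
      (fun m => (hBm m).nullMeasurableSet)
      (fun m n hmn x hx => (hBmem m x).2 fun i hi => (hBmem n x).1 hx i (hi.trans_le hmn))
      ⟨0, measure_ne_top _ _⟩
    have h2 : μ (⋂ m, B m) = 0 := by
      rw [measure_eq_zero_iff_ae_notMem]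
      filter_upwards [h] with x hx hx'
      rw [adicSet, hf] at hx
      obtain ⟨i, hi⟩ := hx
      exact (hBmem _ x).1 (mem_iInter.1 hx' (i + 1)) i (by omega) hi.symm
    rw [h2] at h1
    have h3 := (ENNReal.tendsto_toReal ENNReal.zero_ne_top).comp h1
    rw [ENNReal.toReal_zero] at h3
    obtain ⟨m, hm⟩ := (h3.eventually (gt_mem_nhds hη0)).exists
    exact ⟨m, hm.le⟩
  -- the identification of the central coordinate off `B m`
  set V : cube → Fin m → Bool := fun x i => decide (x.1.2.1 = f i) with hV
  have hVm : Measurable V := measurable_pi_lambda _ fun i => by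
    refine measurable_to_bool ?_
    convert hc (measurableSet_singleton (f i)) using 1
    ext x
    simp [hV]
  have htend : Tendsto (fun n : ℕ => (n : ℝ) * (ε / 2)) atTop atTop :=
    tendsto_natCast_atTop_atTop.atTop_mul_const (by positivity)
  filter_upwards [htend.eventually_ge_atTop
    (Real.log (Fintype.card (Fin m → Bool)) + ε / 2 * (L + 1))] with n hn
  have hmw := measurable_wordOf hT (measurable_sym (M := M) (a := a)) n
  set Y : cube → (Fin n → Fin (M + 1)) × (Fin m → Bool) :=
    fun x => (wordOf 𝐓 (sym M a) n x, V x) with hY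
  have hYm : Measurable Y := hmw.prodMk hVm
  -- a known initial stack leaves no freedom for the refinement of a word of symbols
  set N : (Fin n → Fin (M + 1)) × (Fin m → Bool) → ℕ :=
    fun y => if ∃ i, y.2 i = true then 1 else M ^ (n + L) + 1 with hN
  have h1 := entropyOf_le_add_integral_log (μ := μ) hYm
    (measurable_wordOf hT (measurable_refinedSym (M := M) (a := a) L) n) N (fun y => ?_)
  · have h2 : entropyOf μ Y ≤ entropyOf μ (wordOf 𝐓 (sym M a) n) + entropyOf μ V :=
      entropyOf_le_add_of_eq hmw hVm hYm Prod.mk fun x => rfl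
    have h3 : entropyOf μ V ≤ Real.log (Fintype.card (Fin m → Bool)) := entropyOf_le_log_card hVm
    have h4 : ∫ x, Real.log (N (Y x)) ∂μ ≤
        ∫ x, (B m).indicator (fun _ => ((n : ℝ) + L + 1) * Real.log M) x ∂μ := by
      refine integral_mono (integrable_comp_fintype hYm fun y => Real.log (N y))
        ((integrable_const _).indicator (hBm m)) fun x => ?_
      by_cases hx : x ∈ B m
      · have h5 : ¬ ∃ i, V x i = true := by
          rintro ⟨i, hi⟩
          exact (hBmem m x).1 hx i i.2 (of_decide_eq_true hi)
        have h6 := log_pow_add_one_le hM (n + L)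
        simp only [hN, hY, if_neg h5, indicator_of_mem hx]
        push_cast at h6 ⊢
        exact h6
      · have h5 : ∃ i, V x i = true := by
          rw [hBmem] at hx
          push Not at hx
          obtain ⟨i, hi, hxi⟩ := hx
          exact ⟨⟨i, hi⟩, decide_eq_true hxi⟩
        simp only [hN, hY, if_pos h5, indicator_of_notMem hx]
        simp
    rw [integral_indicator_const _ (hBm m), smul_eq_mul] at h4
    have h7 : μ.real (B m) * (((n : ℝ) + L + 1) * Real.log M) ≤ ε / 2 * (n + L + 1) := by
      calc _ ≤ η * (((n : ℝ) + L + 1) * Real.log M) :=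
            mul_le_mul_of_nonneg_right hm (by positivity)
        _ = _ := by rw [hη]; field_simp
    linarith
  · obtain ⟨w, v⟩ := y
    by_cases hv : ∃ i, v i = true
    · simp only [hN, if_pos hv]
      obtain ⟨i, hi⟩ := hv
      refine Finset.card_le_one.2 fun z hz z' hz' => ?_
      obtain ⟨x, hx, rfl⟩ := (Finset.mem_filter.1 hz).2
      obtain ⟨x', hx', rfl⟩ := (Finset.mem_filter.1 hz').2
      rw [hY, Prod.mk.injEq] at hx hx'
      have hw := hx.1.trans hx'.1.symm
      have e1 : x.1.2.1 = f i := of_decide_eq_true ((congrFun hx.2 i).trans hi)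
      have e2 : x'.1.2.1 = f i := of_decide_eq_true ((congrFun hx'.2 i).trans hi)
      refine wordOf_eq_iff.2 fun i hi => refinedSym_eq_iff.2 ⟨wordOf_eq_iff.1 hw i hi, ?_⟩
      exact floor_iterate_eq hM ha hb n _ L x x' hw le_rfl (by rw [e1, e2]) i hi.le
    · simp only [hN, if_neg hv]
      refine (Finset.card_le_card fun z hz => ?_).trans ((card_refined_le hM ha hb L n w).trans ?_)
      · obtain ⟨x, hx, hz⟩ := (Finset.mem_filter.1 hz).2
        exact Finset.mem_filter.2 ⟨Finset.mem_univ _, x, (Prod.mk.inj hx).1, hz⟩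
      · gcongr
        · omega
        · exact depth_le w

theorem eq_alphaMeasure_of_adicSet [NeZero M] {μ : Measure cube} [IsProbabilityMeasure μ]
    (hμ : MeasurePreserving 𝐓 μ μ)
    (hent : ENNReal.ofReal (Real.log (M + 1)) ≤ measureEntropy μ 𝐓)
    (h : ∀ᵐ x ∂μ, x.1.2.1 ∈ adicSet M) : μ = alphaMeasure M a b :=
  eq_alphaMeasure_of_entropyOf_le hM ha hb hμ hent fun L _ hε =>
    eventually_entropyOf_refined_le_of_adicSet hM ha hb h L hε

end Uniqueness

/-! ### Time reversal -/

section AbstractReversal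

variable {X Y : Type*} [MeasurableSpace X] [MeasurableSpace Y] {μ : Measure X} {T : X → X}
  {T' : Y → Y} {e : X ≃ᵐ Y}

/-- The hypothesis says that `e` conjugates `T` to the inverse of `T'`, almost everywhere. -/
theorem ae_reversal_iterate (hT : MeasurePreserving T μ μ)
    (h : ∀ᵐ x ∂μ, T' (e (T x)) = e x) :
    ∀ᵐ x ∂μ, ∀ i k : ℕ, T'^[i] (e (T^[k + i] x)) = e (T^[k] x) := by
  have h1 : ∀ᵐ x ∂μ, ∀ k : ℕ, T' (e (T (T^[k] x))) = e (T^[k] x) :=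
    ae_all_iff.2 fun k => (hT.iterate k).quasiMeasurePreserving.ae h
  filter_upwards [h1] with x hx i
  induction i with
  | zero => intro k; rfl
  | succ i ih =>
    intro k
    rw [Function.iterate_succ_apply', show k + (i + 1) = (k + 1) + i by omega, ih,
      Function.iterate_succ_apply', hx]

theorem measurePreserving_of_reversal (hT : MeasurePreserving T μ μ) (hT' : Measurable T')
    (h : ∀ᵐ x ∂μ, T' (e (T x)) = e x) : MeasurePreserving T' (μ.map e) (μ.map e) := by
  refine ⟨hT', ?_⟩
  conv_lhs => rw [← hT.map_eq]
  rw [Measure.map_map e.measurable hT.measurable,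
    Measure.map_map hT' (e.measurable.comp hT.measurable)]
  exact Measure.map_congr h

theorem ergodic_of_reversal (hT : Ergodic T μ) (hT' : Measurable T')
    (h : ∀ᵐ x ∂μ, T' (e (T x)) = e x) : Ergodic T' (μ.map e) := by
  refine ⟨measurePreserving_of_reversal hT.toMeasurePreserving hT' h, ⟨fun s hs hTs => ?_⟩⟩
  have h1 : T ⁻¹' (e ⁻¹' s) =ᵐ[μ] e ⁻¹' s := by
    filter_upwards [h] with x hx
    refine propext ?_
    change e (T x) ∈ s ↔ e x ∈ s
    rw [← hx]
    conv_lhs => rw [← hTs]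
    rfl
  rw [eventuallyConst_set']
  rcases hT.quasiErgodic.ae_empty_or_univ₀ (e.measurable hs).nullMeasurableSet h1 with h2 | h2
  · left
    rw [ae_eq_empty] at h2 ⊢
    rw [Measure.map_apply e.measurable hs, h2]
  · right
    rw [ae_eq_univ] at h2 ⊢
    rw [Measure.map_apply e.measurable hs.compl, preimage_compl, h2]

/-- Time reversal does not decrease the entropy: it reverses the words of each partition. -/
theorem measureEntropy_le_of_reversal (hT : MeasurePreserving T μ μ) (hT' : Measurable T')
    (h : ∀ᵐ x ∂μ, T' (e (T x)) = e x) : measureEntropy μ T ≤ measureEntropy (μ.map e) T' := by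
  refine iSup_le fun k => iSup_le fun ξ => iSup_le fun hξ => ?_
  refine le_iSup_of_le k (le_iSup_of_le (ξ ∘ e.symm)
    (le_iSup_of_le (hξ.comp e.symm.measurable) (le_of_eq ?_)))
  unfold partitionEntropy
  congr 1
  funext n
  congr 2
  rw [joinEntropy_eq, joinEntropy_eq, entropyOf, entropyOf]
  refine Fintype.sum_equiv (Equiv.arrowCongr Fin.revPerm (Equiv.refl (Fin k))) _ _ fun w => ?_
  congr 1
  have hm := measurable_wordOf hT.measurable hξ n
  have hm' := measurable_wordOf hT' (hξ.comp e.symm.measurable) n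
  set w' := (Equiv.arrowCongr Fin.revPerm (Equiv.refl (Fin k))) w with hw'
  rw [measureReal_def, measureReal_def, Measure.map_apply e.measurable
    (hm' (measurableSet_singleton w')),
    ← (hT.iterate n).measure_preimage
      (e.measurable (hm' (measurableSet_singleton w'))).nullMeasurableSet,
    ← hT.measure_preimage (hm (measurableSet_singleton w)).nullMeasurableSet]
  congr 1
  refine measure_congr ?_
  filter_upwards [ae_reversal_iterate hT h] with x hx
  refine propext ?_
  change wordOf T ξ n (T x) = w ↔ wordOf T' (ξ ∘ e.symm) n (e (T^[n] x)) = w'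
  have h1 : ∀ i : Fin n, wordOf T' (ξ ∘ e.symm) n (e (T^[n] x)) i =
      wordOf T ξ n (T x) (Fin.rev i) := by
    intro i
    change ξ (e.symm (T'^[i] (e (T^[n] x)))) = ξ (T^[Fin.rev i] (T x))
    have h2 := hx i (n - i)
    rw [Nat.sub_add_cancel i.2.le] at h2
    rw [h2, e.symm_apply_apply, ← Function.iterate_succ_apply, Fin.val_rev]
    congr 2
    omega
  constructor
  · intro h3
    funext i
    rw [h1, h3]
    rfl
  · intro h3
    funext i
    have h4 := h1 (Fin.rev i)
    rw [Fin.rev_rev] at h4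
    rw [← h4, h3, hw']
    change w (Fin.rev (Fin.rev i)) = w i
    rw [Fin.rev_rev]

end AbstractReversal

section Reversal

variable {M : ℕ} {a b : ℝ}

/-- The involution `(x_u, x_c, x_s) ↦ (1 - x_s, 1 - x_c, 1 - x_u)`, which conjugates the baker map
with parameters `a, b` to the inverse of the one with parameters `b, a`. -/
def flipCube : cube ≃ᵐ cube where
  toFun x := ⟨(1 - x.1.2.2, 1 - x.1.2.1, 1 - x.1.1), by
    obtain ⟨⟨h1, h2⟩, ⟨h3, h4⟩, h5, h6⟩ := x.2
    exact ⟨⟨by linarith, by linarith⟩, ⟨by linarith, by linarith⟩, by linarith, by linarith⟩⟩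
  invFun x := ⟨(1 - x.1.2.2, 1 - x.1.2.1, 1 - x.1.1), by
    obtain ⟨⟨h1, h2⟩, ⟨h3, h4⟩, h5, h6⟩ := x.2
    exact ⟨⟨by linarith, by linarith⟩, ⟨by linarith, by linarith⟩, by linarith, by linarith⟩⟩
  left_inv x := by apply Subtype.ext; simp
  right_inv x := by apply Subtype.ext; simp
  measurable_toFun := by
    refine Measurable.subtype_mk ?_
    fun_prop
  measurable_invFun := by
    refine Measurable.subtype_mk ?_
    fun_prop

theorem coe_flipCube (x : cube) :
    (flipCube x : ℝ × ℝ × ℝ) = (1 - x.1.2.2, 1 - x.1.2.1, 1 - x.1.1) := rfl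

theorem flipCube_flipCube (x : cube) : flipCube (flipCube x) = x := flipCube.left_inv x

theorem continuous_flipCube : Continuous flipCube := by
  refine Continuous.subtype_mk ?_ _
  fun_prop

theorem map_flipCube_map (μ : Measure cube) : (μ.map flipCube).map flipCube = μ := by
  rw [Measure.map_map flipCube.measurable flipCube.measurable]
  conv_rhs => rw [← Measure.map_id (μ := μ)]
  congr 1
  funext x
  exact flipCube_flipCube x

variable (hM : 2 ≤ M) (ha : a ∈ Ioo 0 (1 / (M : ℝ))) (hb : b ∈ Ioo 0 (1 / (M : ℝ)))

local notation "𝐓" => bakerMap M a b hM ha hb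
local notation "𝐓'" => bakerMap M b a hM hb ha

theorem coe_bakerMap (x : cube) : (𝐓 x : ℝ × ℝ × ℝ) = bakerFun M a b x := rfl

theorem cast_rev (k : Fin M) : ((Fin.rev k : ℕ) : ℝ) = M - 1 - k := by
  rw [Fin.val_rev, Nat.cast_sub (by omega)]
  push_cast
  ring

theorem flipCube_mem_domBeta {x : cube} {k : Fin M}
    (h : (x : ℝ × ℝ × ℝ) ∈ domAlpha M a k) (hc : 0 < x.1.2.1) :
    (flipCube (𝐓 x) : ℝ × ℝ × ℝ) ∈ domBeta M b k.rev := by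
  have hM' := cast_pos_of_two_le hM
  have hbM := mul_lt_one_of_mem hM hb
  have h3 := cast_rev k
  have hx : (𝐓 x : ℝ × ℝ × ℝ) = branchAlpha M a b k x := bakerFun_of_mem_domAlpha ha.1 h
  have hy := (flipCube (𝐓 x)).2
  obtain ⟨-, ⟨hc0, hc1⟩, hs0, hs1⟩ := x.2
  rw [coe_flipCube, hx, branchAlpha] at hy ⊢
  refine ⟨⟨?_, hy.1.2⟩, ?_, hy.2.2⟩
  · simp only
    nlinarith
  · simp only
    split_ifs with hk
    · refine ⟨?_, hy.2.1.2⟩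
      rw [h3, div_le_iff₀ hM']
      field_simp
      linarith
    · constructor
      · rw [h3, div_le_iff₀ hM']
        field_simp
        linarith
      · rw [h3, lt_div_iff₀ hM']
        field_simp
        linarith

theorem flipCube_mem_domAlpha {x : cube} {k : Fin M}
    (h : (x : ℝ × ℝ × ℝ) ∈ domBeta M a k) (hs : 0 < x.1.2.2) :
    (flipCube (𝐓 x) : ℝ × ℝ × ℝ) ∈ domAlpha M b k.rev := by
  have h3 := cast_rev k
  have hx : (𝐓 x : ℝ × ℝ × ℝ) = branchBeta M a b k x := bakerFun_of_mem_domBeta ha.1 h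
  have hy := (flipCube (𝐓 x)).2
  obtain ⟨-, -, hs0, hs1⟩ := x.2
  have hb0 := hb.1
  rw [coe_flipCube, hx, branchBeta] at hy ⊢
  refine ⟨⟨?_, ?_⟩, hy.2⟩
  · simp only
    rw [h3]
    nlinarith
  · simp only
    rw [h3]
    nlinarith

/-- The involution conjugates the baker map to the inverse of the one with swapped parameters,
outside of some faces of the cube. -/
theorem bakerMap_flipCube {x : cube} (hc : (sym M a x : ℕ) < M → 0 < x.1.2.1)
    (hs : ¬ (sym M a x : ℕ) < M → 0 < x.1.2.2) : 𝐓' (flipCube (𝐓 x)) = flipCube x := by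
  have hM' := cast_pos_of_two_le hM
  have haM := mul_lt_one_of_mem hM ha
  have hbM := mul_lt_one_of_mem hM hb
  have ha0 := ha.1
  have hb0 := hb.1
  apply Subtype.ext
  rcases exists_mem_dom hM ha.1 x.2 with ⟨k, hk⟩ | ⟨k, hk⟩
  · have hj := sym_eq_of_mem_domAlpha ha.1 hk
    have hmem := flipCube_mem_domBeta hM ha hb hk (hc (by rw [hj]; exact k.2))
    change bakerFun M b a (flipCube (𝐓 x)) = _
    rw [bakerFun_of_mem_domBeta hb.1 hmem, coe_flipCube, coe_flipCube, coe_bakerMap,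
      bakerFun_of_mem_domAlpha ha.1 hk]
    simp only [branchAlpha, branchBeta, cast_rev]
    refine Prod.ext ?_ (Prod.ext ?_ ?_)
    · simp only
      rw [div_eq_iff (by linarith)]
      ring
    · simp only
      field_simp
      ring
    · simp only
      field_simp
      ring
  · have hj := sym_eq_of_mem_domBeta ha.1 hk
    have hmem := flipCube_mem_domAlpha hM ha hb hk (hs (by rw [hj]; simp))
    change bakerFun M b a (flipCube (𝐓 x)) = _
    rw [bakerFun_of_mem_domAlpha hb.1 hmem, coe_flipCube, coe_flipCube, coe_bakerMap,
      bakerFun_of_mem_domBeta ha.1 hk]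
    simp only [branchAlpha, branchBeta, cast_rev]
    have haM' : 1 - (M : ℝ) * a ≠ 0 := by linarith
    refine Prod.ext ?_ (Prod.ext ?_ ?_)
    · simp only
      field_simp
      ring
    · simp only
      field_simp
      ring
    · simp only
      field_simp
      ring

theorem sym_flipCube_lt_iff {x : cube} (hc : (sym M a x : ℕ) < M → 0 < x.1.2.1)
    (hs : ¬ (sym M a x : ℕ) < M → 0 < x.1.2.2) :
    (sym M b (flipCube (𝐓 x)) : ℕ) < M ↔ ¬ (sym M a x : ℕ) < M := by
  rcases exists_mem_dom hM ha.1 x.2 with ⟨k, hk⟩ | ⟨k, hk⟩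
  · have hj := sym_eq_of_mem_domAlpha ha.1 hk
    have hmem := flipCube_mem_domBeta hM ha hb hk (hc (by rw [hj]; exact k.2))
    rw [hj, sym_eq_of_mem_domBeta hb.1 hmem]
    simp
  · have hj := sym_eq_of_mem_domBeta ha.1 hk
    have hmem := flipCube_mem_domAlpha hM ha hb hk (hs (by rw [hj]; simp))
    rw [hj, sym_eq_of_mem_domAlpha hb.1 hmem]
    simpa using zero_lt_two.trans_le hM

/-- The points of the face `x_s = 0` have preimages only there, and by pushing branches. -/
theorem s_eq_zero_of_bakerMap {x : cube} (h : (𝐓 x).1.2.2 = 0) :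
    x.1.2.2 = 0 ∧ (sym M a x : ℕ) < M := by
  have hbM := mul_lt_one_of_mem hM hb
  rw [bakerMap_s, sMap] at h
  split_ifs at h with hj
  · exact ⟨(mul_eq_zero.1 h).resolve_left (by linarith), hj⟩
  · have h1 := mul_nonneg hb.1.le x.2.2.2.1
    have h2 : 0 ≤ b * (cDig M x.1.2.1 : ℝ) := mul_nonneg hb.1.le (Nat.cast_nonneg _)
    linarith

theorem s_pos_ae {μ : Measure cube} [IsProbabilityMeasure μ] (hμ : MeasurePreserving 𝐓 μ μ) :
    ∀ᵐ x ∂μ, ¬ (sym M a x : ℕ) < M → 0 < x.1.2.2 := by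
  have hs : Measurable fun x : cube => x.1.2.2 :=
    (measurable_snd.comp measurable_snd).comp measurable_subtype_coe
  have hE : MeasurableSet {x : cube | x.1.2.2 = 0} := hs (measurableSet_singleton 0)
  have hF : MeasurableSet {x : cube | (sym M a x : ℕ) < M} :=
    measurable_sym (M := M) (a := a) (MeasurableSet.of_discrete
      (s := {j : Fin (M + 1) | (j : ℕ) < M}))
  have h1 : μ {x : cube | x.1.2.2 = 0} ≤ μ ({x : cube | x.1.2.2 = 0} ∩
    {x | (sym M a x : ℕ) < M}) := by
    rw [← hμ.measure_preimage hE.nullMeasurableSet]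
    exact measure_mono fun x hx => s_eq_zero_of_bakerMap hM ha hb hx
  have h2 := measure_inter_add_sdiff (μ := μ) {x : cube | x.1.2.2 = 0} hF
  have h3 : μ ({x : cube | x.1.2.2 = 0} \ {x | (sym M a x : ℕ) < M}) = 0 := by
    by_contra h
    have := ENNReal.lt_add_right (measure_ne_top μ
      ({x : cube | x.1.2.2 = 0} ∩ {x | (sym M a x : ℕ) < M})) h
    rw [h2] at this
    exact absurd h1 (not_le.2 this)
  rw [ae_iff]
  refine measure_mono_null (fun x hx => ?_) h3
  replace hx := Classical.not_imp.1 hx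
  exact ⟨le_antisymm (not_lt.1 hx.2) x.2.2.2.1, hx.1⟩

theorem bakerMap_flipCube_ae {μ : Measure cube} [IsProbabilityMeasure μ]
    (hμ : MeasurePreserving 𝐓 μ μ) (hc : ∀ᵐ x ∂μ, 0 < x.1.2.1) :
    ∀ᵐ x ∂μ, 𝐓' (flipCube (𝐓 x)) = flipCube x := by
  filter_upwards [hc, s_pos_ae hM ha hb hμ] with x h1 h2
  exact bakerMap_flipCube hM ha hb (fun _ => h1) h2

/-- Time reversal changes the sign of the mean drift. -/
theorem integral_stepHeight_flipCube {μ : Measure cube} [IsProbabilityMeasure μ]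
    (hμ : MeasurePreserving 𝐓 μ μ) (hc : ∀ᵐ x ∂μ, 0 < x.1.2.1) :
    ∫ x, (stepHeight (sym M b x) : ℝ) ∂μ.map flipCube =
      -∫ x, (stepHeight (sym M a x) : ℝ) ∂μ := by
  have hm : Measurable fun x : cube => (stepHeight (sym M b x) : ℝ) :=
    (Measurable.of_discrete (f := fun j : Fin (M + 1) => (stepHeight j : ℝ))).comp measurable_sym
  rw [integral_map flipCube.measurable.aemeasurable hm.aestronglyMeasurable]
  conv_lhs => rw [← hμ.map_eq]
  rw [integral_map (f := fun x => (stepHeight (sym M b (flipCube x)) :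
    ℝ)) hμ.measurable.aemeasurable
    (hm.comp flipCube.measurable).aestronglyMeasurable, ← integral_neg]
  refine integral_congr_ae ?_
  filter_upwards [hc, s_pos_ae hM ha hb hμ] with x h1 h2
  have h3 := sym_flipCube_lt_iff hM ha hb (fun _ => h1) h2
  simp only [stepHeight]
  split_ifs with h4 h5 h5
  · exact absurd h5 (h3.1 h4)
  · norm_num
  · norm_num
  · exact absurd (h3.2 h5) h4

end Reversal

/-! ### The two measures of maximal entropy -/

section Classification

variable {M : ℕ} {a b : ℝ} [NeZero M]

/-- The measure obtained by time reversal from the product measure for the swapped parameters. -/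
def betaMeasure (M : ℕ) (a b : ℝ) [NeZero M] : Measure cube := (alphaMeasure M b a).map flipCube

theorem isProbabilityMeasure_betaMeasure (hM : 2 ≤ M) (ha : a ∈ Ioo 0 (1 / (M : ℝ)))
    (hb : b ∈ Ioo 0 (1 / (M : ℝ))) : IsProbabilityMeasure (betaMeasure M a b) :=
  have := isProbabilityMeasure_alphaMeasure hM hb ha
  Measure.isProbabilityMeasure_map flipCube.measurable.aemeasurable

variable (hM : 2 ≤ M) (ha : a ∈ Ioo 0 (1 / (M : ℝ))) (hb : b ∈ Ioo 0 (1 / (M : ℝ)))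

local notation "𝐓" => bakerMap M a b hM ha hb
local notation "𝐓'" => bakerMap M b a hM hb ha

theorem bakerMap_flipCube_alphaMeasure :
    ∀ᵐ x ∂alphaMeasure M a b, 𝐓' (flipCube (𝐓 x)) = flipCube x :=
  have := isProbabilityMeasure_alphaMeasure hM ha hb
  bakerMap_flipCube_ae hM ha hb (measurePreserving_alphaMeasure hM ha hb)
    (alphaMeasure_c_pos hM ha hb)

theorem ergodic_betaMeasure : Ergodic 𝐓 (betaMeasure M a b) :=
  ergodic_of_reversal (ergodic_alphaMeasure hM hb ha) (measurable_bakerMap hM ha hb)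
    (bakerMap_flipCube_alphaMeasure hM hb ha)

theorem measureEntropy_betaMeasure :
    measureEntropy (betaMeasure M a b) 𝐓 = ENNReal.ofReal (Real.log (M + 1)) := by
  have := isProbabilityMeasure_betaMeasure hM ha hb
  refine le_antisymm (measureEntropy_le_log hM ha hb
    (ergodic_betaMeasure hM ha hb).toMeasurePreserving) ?_
  rw [← measureEntropy_alphaMeasure hM hb ha]
  exact measureEntropy_le_of_reversal (measurePreserving_alphaMeasure hM hb ha)
    (measurable_bakerMap hM ha hb) (bakerMap_flipCube_alphaMeasure hM hb ha)

/-- The classification of the ergodic measures of maximal entropy by the sign of the drift. -/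
theorem eq_alphaMeasure_or_eq_betaMeasure {μ : Measure cube} [IsProbabilityMeasure μ]
    (hμ : Ergodic 𝐓 μ) (hent : ENNReal.ofReal (Real.log (M + 1)) ≤ measureEntropy μ 𝐓) :
    μ = alphaMeasure M a b ∨ μ = betaMeasure M a b := by
  have hc : Measurable fun x : cube => x.1.2.1 :=
    (measurable_fst.comp measurable_snd).comp measurable_subtype_coe
  have hDm : MeasurableSet {x : cube | x.1.2.1 ∈ adicSet M} :=
    hc (countable_range _).measurableSet
  have hTD : 𝐓 ⁻¹' {x : cube | x.1.2.1 ∈ adicSet M} = {x : cube | x.1.2.1 ∈ adicSet M} :=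
    Set.ext fun x => bakerMap_mem_adicSet hM ha hb x
  rcases hμ.ae_mem_or_ae_notMem hDm hTD with hD | hD
  · exact Or.inl (eq_alphaMeasure_of_adicSet hM ha hb hμ.toMeasurePreserving hent hD)
  rcases le_total 0 (∫ x, (stepHeight (sym M a x) : ℝ) ∂μ) with hdrift | hdrift
  · exact Or.inl (eq_alphaMeasure_of_drift hM ha hb hμ hent hdrift)
  right
  have hpos : ∀ᵐ x ∂μ, 0 < x.1.2.1 := by
    filter_upwards [hD] with x hx
    refine lt_of_le_of_ne x.2.2.1.1 fun h => hx ?_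
    exact ⟨(0, 0), by simpa using h⟩
  -- the drift is negative, and the face `x_c = 0`, where time reversal fails, is null
  have hrev := bakerMap_flipCube_ae hM ha hb hμ.toMeasurePreserving hpos
  have hT' := measurable_bakerMap hM hb ha
  have : IsProbabilityMeasure (μ.map flipCube) :=
    Measure.isProbabilityMeasure_map flipCube.measurable.aemeasurable
  have h := eq_alphaMeasure_of_drift hM hb ha (ergodic_of_reversal hμ hT' hrev)
    (hent.trans (measureEntropy_le_of_reversal hμ.toMeasurePreserving hT' hrev))
    (by rw [integral_stepHeight_flipCube hM ha hb hμ.toMeasurePreserving hpos]; linarith)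
  rw [betaMeasure, ← h, map_flipCube_map]

theorem isErgodicMME_iff {μ : Measure cube} :
    IsErgodicMME 𝐓 μ ↔ μ = alphaMeasure M a b ∨ μ = betaMeasure M a b := by
  constructor
  · intro h
    have := h.isProbabilityMeasure
    refine eq_alphaMeasure_or_eq_betaMeasure hM ha hb h.ergodic ?_
    rw [← measureEntropy_alphaMeasure hM ha hb]
    exact h.entropy_le _ (isProbabilityMeasure_alphaMeasure hM ha hb)
      (measurePreserving_alphaMeasure hM ha hb)
  · rintro (rfl | rfl)
    · refine ⟨isProbabilityMeasure_alphaMeasure hM ha hb, ergodic_alphaMeasure hM ha hb, ?_,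
        fun ν hν h => ?_⟩ <;> rw [measureEntropy_alphaMeasure]
      · exact ENNReal.ofReal_ne_top
      · exact measureEntropy_le_log hM ha hb h
    · refine ⟨isProbabilityMeasure_betaMeasure hM ha hb, ergodic_betaMeasure hM ha hb, ?_,
        fun ν hν h => ?_⟩ <;> rw [measureEntropy_betaMeasure]
      · exact ENNReal.ofReal_ne_top
      · exact measureEntropy_le_log hM ha hb h

theorem alphaMeasure_sym (hM : 2 ≤ M) (ha : a ∈ Ioo 0 (1 / (M : ℝ)))
    (hb : b ∈ Ioo 0 (1 / (M : ℝ))) (j : Fin (M + 1)) :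
    alphaMeasure M a b {x | sym M a x = j} = 1 / ((M : ENNReal) + 1) := by
  have h := law_alphaMeasure hM ha hb 1 fun _ => j
  rw [pow_one] at h
  rw [one_div, ← h]
  congr 1
  ext x
  constructor
  · intro hx
    exact funext fun i => by rw [Subsingleton.elim i 0]; exact hx
  · intro hx
    exact congrFun hx 0

theorem alphaMeasure_domAlpha (hM : 2 ≤ M) (ha : a ∈ Ioo 0 (1 / (M : ℝ)))
    (hb : b ∈ Ioo 0 (1 / (M : ℝ))) (k : Fin M) :
    alphaMeasure M a b {x | (x : ℝ × ℝ × ℝ) ∈ domAlpha M a k} = 1 / ((M : ENNReal) + 1) := by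
  rw [← alphaMeasure_sym hM ha hb k.castSucc]
  congr 1
  exact Set.ext fun x => ⟨sym_eq_of_mem_domAlpha ha.1, mem_domAlpha_of_sym hM ha.1⟩

theorem betaMeasure_domBeta (hM : 2 ≤ M) (ha : a ∈ Ioo 0 (1 / (M : ℝ)))
    (hb : b ∈ Ioo 0 (1 / (M : ℝ))) (k : Fin M) :
    betaMeasure M a b {x | (x : ℝ × ℝ × ℝ) ∈ domBeta M a k} = 1 / ((M : ENNReal) + 1) := by
  have := isProbabilityMeasure_alphaMeasure hM hb ha
  have hpres := measurePreserving_alphaMeasure hM hb ha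
  have hm : MeasurableSet {x : cube | (x : ℝ × ℝ × ℝ) ∈ domBeta M a k} := by
    refine measurable_subtype_coe (measurableSet_Icc.prod (MeasurableSet.prod ?_ measurableSet_Icc))
    split_ifs
    · exact measurableSet_Icc
    · exact measurableSet_Ico
  rw [betaMeasure, Measure.map_apply flipCube.measurable hm,
    ← hpres.measure_preimage (flipCube.measurable hm).nullMeasurableSet,
    ← alphaMeasure_domAlpha hM hb ha k.rev]
  refine measure_congr ?_
  filter_upwards [alphaMeasure_c_pos hM hb ha, s_pos_ae hM hb ha hpres] with x h1 h2
  refine propext ?_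
  change (flipCube (bakerMap M b a hM hb ha x) : ℝ × ℝ × ℝ) ∈ domBeta M a k ↔
    (x : ℝ × ℝ × ℝ) ∈ domAlpha M b k.rev
  constructor
  · intro h
    rcases exists_mem_dom hM hb.1 x.2 with ⟨l, hl⟩ | ⟨l, hl⟩
    · have := domBeta_unique h (flipCube_mem_domBeta hM hb ha hl h1)
      rwa [this, Fin.rev_rev]
    · have h3 := h2 (by rw [sym_eq_of_mem_domBeta hb.1 hl]; simp)
      exact absurd h (disjoint_domAlpha_domBeta ha.1 (flipCube_mem_domAlpha hM hb ha hl h3))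
  · intro h
    have := flipCube_mem_domBeta hM hb ha h h1
    rwa [Fin.rev_rev] at this

theorem alphaMeasure_ne_betaMeasure (hM : 2 ≤ M) (ha : a ∈ Ioo 0 (1 / (M : ℝ)))
    (hb : b ∈ Ioo 0 (1 / (M : ℝ))) : alphaMeasure M a b ≠ betaMeasure M a b := by
  intro h
  have h0 := betaMeasure_domBeta hM ha hb ⟨0, by omega⟩
  have h1 := betaMeasure_domBeta hM ha hb ⟨1, by omega⟩
  rw [← h] at h0 h1
  have hm : MeasurableSet {x : cube | (x : ℝ × ℝ × ℝ) ∈ domBeta M a ⟨1, by omega⟩} := by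
    refine measurable_subtype_coe (measurableSet_Icc.prod (MeasurableSet.prod ?_ measurableSet_Icc))
    split_ifs
    · exact measurableSet_Icc
    · exact measurableSet_Ico
  have h2 := measure_union (μ := alphaMeasure M a b)
    (s₁ := {x : cube | (x : ℝ × ℝ × ℝ) ∈ domBeta M a ⟨0, by omega⟩})
    (s₂ := {x : cube | (x : ℝ × ℝ × ℝ) ∈ domBeta M a ⟨1, by omega⟩}) (disjoint_left.2
      fun x h3 h4 => absurd (congrArg Fin.val (domBeta_unique h3 h4)) (by simp)) hm
  have h3 : alphaMeasure M a b ({x : cube | (x : ℝ × ℝ × ℝ) ∈ domBeta M a ⟨0, by omega⟩} ∪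
      {x : cube | (x : ℝ × ℝ × ℝ) ∈ domBeta M a ⟨1, by omega⟩}) ≤
      alphaMeasure M a b {x | sym M a x = Fin.last M} :=
    measure_mono (union_subset (fun x => sym_eq_of_mem_domBeta ha.1)
      fun x => sym_eq_of_mem_domBeta ha.1)
  rw [h2, h0, h1, alphaMeasure_sym hM ha hb] at h3
  have h4 : (1 : ENNReal) / ((M : ENNReal) + 1) ≠ 0 := by simp
  have h5 : (1 : ENNReal) / ((M : ENNReal) + 1) ≠ ⊤ := by
    rw [one_div]
    exact ENNReal.inv_ne_top.2 (by simp)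
  exact absurd h3 (not_le.2 (ENNReal.lt_add_right h5 h4))

end Classification

/-! ### The derivative at interior orbits -/

section Derivative

/-- The diagonal linear map of `ℝ³`. -/
def diagMap (p q r : ℝ) : (ℝ × ℝ × ℝ) →L[ℝ] (ℝ × ℝ × ℝ) :=
  (p • ContinuousLinearMap.id ℝ ℝ).prodMap
    ((q • ContinuousLinearMap.id ℝ ℝ).prodMap (r • ContinuousLinearMap.id ℝ ℝ))

theorem diagMap_apply (p q r : ℝ) (v : ℝ × ℝ × ℝ) :
    diagMap p q r v = (p * v.1, q * v.2.1, r * v.2.2) := rfl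

theorem diagMap_comp (p q r p' q' r' : ℝ) :
    (diagMap p q r).comp (diagMap p' q' r') = diagMap (p * p') (q * q') (r * r') := by
  ext <;> simp [diagMap]

theorem charpoly_smul_id (p : ℝ) :
    (p • (LinearMap.id : ℝ →ₗ[ℝ] ℝ)).charpoly = Polynomial.X - Polynomial.C p := by
  have h := LinearMap.charpoly_sub_smul (1 : Module.End ℝ ℝ) (1 - p)
  rw [LinearMap.charpoly_one, Module.finrank_self, pow_one] at h
  have h2 : (1 : Module.End ℝ ℝ) - (1 - p) • 1 = p • (LinearMap.id : ℝ →ₗ[ℝ] ℝ) := by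
    ext
    simp
  rw [h2] at h
  rw [h, Polynomial.sub_comp, Polynomial.X_comp, Polynomial.one_comp, Polynomial.C_sub,
    Polynomial.C_1]
  ring

theorem derivEigenvalues_of_hasFDerivAt {G : ℝ × ℝ × ℝ → ℝ × ℝ × ℝ} {x : ℝ × ℝ × ℝ} {p q r : ℝ}
    (h : HasFDerivAt G (diagMap p q r) x) : derivEigenvalues G x = {(p : ℂ), (q : ℂ), (r : ℂ)} := by
  rw [derivEigenvalues, h.fderiv]
  have h1 : (diagMap p q r : (ℝ × ℝ × ℝ) →ₗ[ℝ] (ℝ × ℝ × ℝ)) =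
      (p • (LinearMap.id : ℝ →ₗ[ℝ] ℝ)).prodMap ((q • (LinearMap.id : ℝ →ₗ[ℝ] ℝ)).prodMap
        (r • (LinearMap.id : ℝ →ₗ[ℝ] ℝ))) := rfl
  rw [h1, LinearMap.charpoly_prodMap, LinearMap.charpoly_prodMap, charpoly_smul_id,
    charpoly_smul_id, charpoly_smul_id, Polynomial.aroots_mul (mul_ne_zero
      (Polynomial.X_sub_C_ne_zero _) (mul_ne_zero (Polynomial.X_sub_C_ne_zero _)
        (Polynomial.X_sub_C_ne_zero _))), Polynomial.aroots_mul (mul_ne_zero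
      (Polynomial.X_sub_C_ne_zero _) (Polynomial.X_sub_C_ne_zero _)),
    Polynomial.aroots_X_sub_C, Polynomial.aroots_X_sub_C, Polynomial.aroots_X_sub_C]
  rfl

variable {M : ℕ} {a b : ℝ}

theorem interior_domAlpha (k : Fin M) : interior (domAlpha M a k) =
    Ioo ((k : ℝ) * a) (((k : ℝ) + 1) * a) ×ˢ Ioo 0 1 ×ˢ Ioo 0 1 := by
  rw [domAlpha, interior_prod_eq, interior_prod_eq, interior_Ico, interior_Icc]

theorem interior_domBeta (hM : 2 ≤ M) (k : Fin M) : interior (domBeta M a k) =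
    Ioo ((M : ℝ) * a) 1 ×ˢ Ioo ((k : ℝ) / M) (((k : ℝ) + 1) / M) ×ˢ Ioo 0 1 := by
  have hM' := cast_pos_of_two_le hM
  rw [domBeta, interior_prod_eq, interior_prod_eq, interior_Icc, interior_Icc]
  split_ifs with h
  · have : ((k : ℝ) + 1) / M = 1 := by
      rw [div_eq_one_iff_eq hM'.ne']
      exact_mod_cast h
    rw [interior_Icc, this]
  · rw [interior_Ico]

variable (hM : 2 ≤ M) (ha : a ∈ Ioo 0 (1 / (M : ℝ))) (hb : b ∈ Ioo 0 (1 / (M : ℝ)))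

local notation "𝐓" => bakerMap M a b hM ha hb

theorem hasFDerivAt_branchAlpha (k : Fin M) (p : ℝ × ℝ × ℝ) :
    HasFDerivAt (branchAlpha M a b k) (diagMap a⁻¹ (M : ℝ)⁻¹ (1 - M * b)) p := by
  have h : branchAlpha M a b k = fun v => diagMap a⁻¹ (M : ℝ)⁻¹ (1 - M * b) v +
      (-(k * a / a), (k : ℝ) / M, 0) := by
    funext v
    rw [diagMap_apply, branchAlpha]
    refine Prod.ext ?_ (Prod.ext ?_ ?_)
    · simp only [Prod.mk_add_mk]; ring
    · simp only [Prod.mk_add_mk]; ring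
    · simp only [Prod.mk_add_mk]; ring
  rw [h]
  exact (ContinuousLinearMap.hasFDerivAt _).add_const _

theorem hasFDerivAt_branchBeta (k : Fin M) (p : ℝ × ℝ × ℝ) :
    HasFDerivAt (branchBeta M a b k) (diagMap (1 - M * a)⁻¹ (M : ℝ) b) p := by
  have h : branchBeta M a b k = fun v => diagMap (1 - M * a)⁻¹ (M : ℝ) b v +
      (-(M * a / (1 - M * a)), -(k : ℝ), 1 + b * ((k : ℝ) - M)) := by
    funext v
    rw [diagMap_apply, branchBeta]
    refine Prod.ext ?_ (Prod.ext ?_ ?_)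
    · simp only [Prod.mk_add_mk]; ring
    · simp only [Prod.mk_add_mk]; ring
    · simp only [Prod.mk_add_mk]; ring
  rw [h]
  exact (ContinuousLinearMap.hasFDerivAt _).add_const _

/-- The union of the interiors of the domains, as a subset of `ℝ³`. -/
def openDomainAmbient (M : ℕ) (a : ℝ) : Set (ℝ × ℝ × ℝ) :=
  (⋃ k, interior (domAlpha M a k)) ∪ ⋃ k, interior (domBeta M a k)

theorem isOpen_openDomainAmbient : IsOpen (openDomainAmbient M a) :=
  (isOpen_iUnion fun _ => isOpen_interior).union (isOpen_iUnion fun _ => isOpen_interior)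

theorem mem_openDomain_iff {x : cube} :
    x ∈ openDomain M a ↔ (x : ℝ × ℝ × ℝ) ∈ openDomainAmbient M a := by
  simp [openDomain, openDomainAmbient]

theorem hasFDerivAt_of_mem_interior_domAlpha (ha : 0 < a) {k : Fin M} {p : ℝ × ℝ × ℝ}
    (h : p ∈ interior (domAlpha M a k)) :
    HasFDerivAt (bakerFun M a b) (diagMap a⁻¹ (M : ℝ)⁻¹ (1 - M * b)) p := by
  refine (hasFDerivAt_branchAlpha k p).congr_of_eventuallyEq ?_
  filter_upwards [isOpen_interior.mem_nhds h] with y hy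
  exact bakerFun_of_mem_domAlpha ha (interior_subset hy)

theorem hasFDerivAt_of_mem_interior_domBeta (ha : 0 < a) {k : Fin M} {p : ℝ × ℝ × ℝ}
    (h : p ∈ interior (domBeta M a k)) :
    HasFDerivAt (bakerFun M a b) (diagMap (1 - M * a)⁻¹ (M : ℝ) b) p := by
  refine (hasFDerivAt_branchBeta k p).congr_of_eventuallyEq ?_
  filter_upwards [isOpen_interior.mem_nhds h] with y hy
  exact bakerFun_of_mem_domBeta ha (interior_subset hy)

theorem differentiableAt_bakerFun (ha : 0 < a) {p : ℝ × ℝ × ℝ} (h : p ∈ openDomainAmbient M a) :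
    DifferentiableAt ℝ (bakerFun M a b) p := by
  rcases h with h | h
  · obtain ⟨k, hk⟩ := mem_iUnion.1 h
    exact (hasFDerivAt_of_mem_interior_domAlpha ha hk).differentiableAt
  · obtain ⟨k, hk⟩ := mem_iUnion.1 h
    exact (hasFDerivAt_of_mem_interior_domBeta ha hk).differentiableAt

theorem differentiableAt_iterate (ha : 0 < a) {p : ℝ × ℝ × ℝ} {n : ℕ}
    (h : ∀ i < n, (bakerFun M a b)^[i] p ∈ openDomainAmbient M a) :
    DifferentiableAt ℝ (bakerFun M a b)^[n] p := by
  induction n with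
  | zero => exact differentiableAt_id
  | succ n ih =>
    rw [Function.iterate_succ']
    exact (differentiableAt_bakerFun ha (h n (by omega))).comp p (ih fun i hi => h i (by omega))

theorem eventually_differentiableAt_iterate (ha : 0 < a) {p : ℝ × ℝ × ℝ} {n : ℕ}
    (h : ∀ i < n, (bakerFun M a b)^[i] p ∈ openDomainAmbient M a) :
    ∀ᶠ y in 𝓝 p, DifferentiableAt ℝ (bakerFun M a b)^[n] y := by
  have h1 : ∀ᶠ y in 𝓝 p, ∀ i ∈ Finset.range n,
      (bakerFun M a b)^[i] y ∈ openDomainAmbient M a := by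
    rw [Finset.eventually_all]
    intro i hi
    have hi' := Finset.mem_range.1 hi
    exact (differentiableAt_iterate ha fun j hj => h j (hj.trans hi')).continuousAt.eventually
      (isOpen_openDomainAmbient.mem_nhds (h i hi'))
  filter_upwards [h1] with y hy
  exact differentiableAt_iterate ha fun i hi => hy i (Finset.mem_range.2 hi)

theorem coe_iterate (n : ℕ) (x : cube) :
    (𝐓^[n] x : ℝ × ℝ × ℝ) = (bakerFun M a b)^[n] (x : ℝ × ℝ × ℝ) := by
  induction n with
  | zero => rfl
  | succ n ih =>
    rw [Function.iterate_succ_apply', Function.iterate_succ_apply', ← ih]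
    rfl

theorem hasFDerivAt_bakerFun (ha : 0 < a) {x : cube} (h : x ∈ openDomain M a) :
    HasFDerivAt (bakerFun M a b) (diagMap (uRate M a (sym M a x))⁻¹
      ((M : ℝ) ^ (-stepHeight (sym M a x))) (sRate M b (sym M a x))) (x : ℝ × ℝ × ℝ) := by
  rcases h with ⟨k, hk⟩ | ⟨k, hk⟩
  · rw [sym_eq_of_mem_domAlpha ha (interior_subset hk)]
    simpa [uRate, stepHeight, sRate] using hasFDerivAt_of_mem_interior_domAlpha (b := b) ha hk
  · rw [sym_eq_of_mem_domBeta ha (interior_subset hk)]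
    simpa [uRate, stepHeight, sRate] using hasFDerivAt_of_mem_interior_domBeta (b := b) ha hk

theorem hasFDerivAt_iterate (n : ℕ) (x : cube) (h : ∀ i < n, 𝐓^[i] x ∈ openDomain M a) :
    HasFDerivAt (bakerFun M a b)^[n] (diagMap (∏ i, uRate M a (wordOf 𝐓 (sym M a) n x i))⁻¹
      ((M : ℝ) ^ (-height 𝐓 M a n x)) (∏ i, sRate M b (wordOf 𝐓 (sym M a) n x i)))
      (x : ℝ × ℝ × ℝ) := by
  have hM' := cast_pos_of_two_le hM
  induction n generalizing x with
  | zero =>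
    have : diagMap 1 1 1 = ContinuousLinearMap.id ℝ (ℝ × ℝ × ℝ) := by
      ext <;> simp [diagMap]
    simpa [height, this] using hasFDerivAt_id (𝕜 := ℝ) (x : ℝ × ℝ × ℝ)
  | succ n ih =>
    have h1 := ih (𝐓 x) fun i hi => h (i + 1) (by omega)
    have h2 := hasFDerivAt_bakerFun (x := x) (b := b) ha.1 (h 0 (by omega))
    rw [Function.iterate_succ, wordOf_succ, height_succ, Fin.prod_univ_succ, Fin.prod_univ_succ]
    simp only [Fin.cons_zero, Fin.cons_succ]
    have h3 := HasFDerivAt.comp (x : ℝ × ℝ × ℝ) h1 h2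
    rw [diagMap_comp] at h3
    refine h3.congr_fderiv ?_
    congr 1
    · rw [mul_inv, mul_comm]
    · rw [← zpow_add₀ hM'.ne', neg_add, add_comm]
    · rw [mul_comm]

theorem mem_maximalInvariantSet_of_periodic {X : Type*} {f : X → X} {U : Set X} {x : X} {n : ℕ}
    (hn : 1 ≤ n) (hx : f^[n] x = x) :
    x ∈ maximalInvariantSet f U ↔ ∀ i, f^[i] x ∈ U := by
  constructor
  · intro h i
    exact mem_iInter.1 h.1 i
  · intro h
    refine ⟨mem_iInter.2 h, mem_iInter.2 fun k => ?_⟩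
    refine ⟨f^[k * n - k] x, h _, ?_⟩
    rw [← Function.iterate_add_apply, Nat.add_sub_cancel' (Nat.le_mul_of_pos_right k hn)]
    have h1 : Function.IsPeriodicPt f n x := hx
    exact h1.const_mul k

/-- The periodic points of period `n` along orbits in the interiors of the domains. -/
def interiorPer (n : ℕ) : Set cube :=
  {x | 𝐓^[n] x = x ∧ ∀ i, 𝐓^[i] x ∈ openDomain M a}

theorem derivEigenvalues_of_mem {n : ℕ} {x : cube}
    (hx : x ∈ interiorPer hM ha hb n) :
    derivEigenvalues (bakerFun M a b)^[n] (x : ℝ × ℝ × ℝ) =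
      {(((∏ i, uRate M a (wordOf 𝐓 (sym M a) n x i))⁻¹ : ℝ) : ℂ),
        (((M : ℝ) ^ (-height 𝐓 M a n x) : ℝ) : ℂ),
        ((∏ i, sRate M b (wordOf 𝐓 (sym M a) n x i) : ℝ) : ℂ)} :=
  derivEigenvalues_of_hasFDerivAt (hasFDerivAt_iterate hM ha hb n x fun i _ => hx.2 i)

/-- The unstable dimension of a periodic point is determined by the sign of its height. -/
theorem mem_unstablePer_iff {d n : ℕ} (hn : 1 ≤ n) {x : cube} :
    x ∈ unstablePer M a b hM ha hb d n ↔ x ∈ interiorPer hM ha hb n ∧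
      height 𝐓 M a n x ≠ 0 ∧ d = if 0 < height 𝐓 M a n x then 1 else 2 := by
  have hM' := two_le_cast hM
  have key : ∀ x ∈ interiorPer hM ha hb n,
      (IsHyperbolicAt (bakerFun M a b)^[n] (x : ℝ × ℝ × ℝ) ↔ height 𝐓 M a n x ≠ 0) ∧
      unstableDim (bakerFun M a b)^[n] (x : ℝ × ℝ × ℝ) =
        if height 𝐓 M a n x < 0 then 2 else 1 := by
    intro x hx
    have hE := derivEigenvalues_of_mem hM ha hb hx
    set p := (∏ i, uRate M a (wordOf 𝐓 (sym M a) n x i))⁻¹ with hp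
    set r := ∏ i, sRate M b (wordOf 𝐓 (sym M a) n x i) with hr
    set h := height 𝐓 M a n x with hh
    have hu0 : 0 < ∏ i, uRate M a (wordOf 𝐓 (sym M a) n x i) :=
      Finset.prod_pos fun i _ => uRate_pos hM ha _
    have hp1 : 1 < ‖(p : ℂ)‖ := by
      have h1 : ∏ i, uRate M a (wordOf 𝐓 (sym M a) n x i) < 1 := by
        have : Nonempty (Fin n) := ⟨⟨0, hn⟩⟩
        calc _ < ∏ _ : Fin n, (1 : ℝ) := Finset.prod_lt_prod_of_nonempty
              (fun i _ => uRate_pos hM ha _) (fun i _ => uRate_lt_one hM ha _)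
              Finset.univ_nonempty
          _ = 1 := by simp
      rw [Complex.norm_real, Real.norm_of_nonneg (inv_pos.2 hu0).le]
      exact (one_lt_inv₀ hu0).2 h1
    have hr1 : ‖(r : ℂ)‖ < 1 := by
      rw [Complex.norm_real, Real.norm_of_nonneg (prod_sRate_nonneg hM hb _)]
      exact (prod_sRate_le hM hb _).trans_lt (pow_lt_one₀
        (le_max_of_le_right hb.1.le) (max_sRate_lt_one hM hb) (by omega))
    have hq : ‖(((M : ℝ) ^ (-h) : ℝ) : ℂ)‖ = (M : ℝ) ^ (-h) := by
      rw [Complex.norm_real, Real.norm_of_nonneg (by positivity)]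
    constructor
    · rw [IsHyperbolicAt, hE]
      constructor
      · rintro ⟨-, h1⟩ h0
        refine h1 _ (by simp : (((M : ℝ) ^ (-h) : ℝ) : ℂ) ∈ _) ?_
        rw [hq, h0]
        simp
      · intro h0
        refine ⟨eventually_differentiableAt_iterate ha.1 fun i _ => ?_, ?_⟩
        · rw [← coe_iterate hM ha hb, ← mem_openDomain_iff]
          exact hx.2 i
        · intro z hz
          simp only [Multiset.insert_eq_cons, Multiset.mem_cons, Multiset.mem_singleton] at hz
          rcases hz with rfl | rfl | rfl
          · exact hp1.ne'
          · rw [hq]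
            intro h1
            exact h0 (neg_eq_zero.1 ((zpow_eq_one_iff_right₀ (by linarith) (by linarith)).1 h1))
          · exact hr1.ne
    · rw [unstableDim, hE]
      simp only [Multiset.insert_eq_cons]
      rw [← Multiset.cons_zero, Multiset.countP_cons, Multiset.countP_cons, Multiset.countP_cons,
        Multiset.countP_zero, if_pos hp1, if_neg (not_lt.2 hr1.le), hq]
      have hiff : 1 < (M : ℝ) ^ (-h) ↔ h < 0 := by
        constructor
        · intro h1
          by_contra h0
          exact absurd h1 (not_lt.2 (zpow_le_one_of_nonpos₀ (by linarith) (by omega)))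
        · intro h0
          exact one_lt_zpow₀ (by linarith) (by omega)
      simp only [hiff]
      split_ifs <;> rfl
  constructor
  · rintro ⟨h1, h2, h3, h4⟩
    have hx : x ∈ interiorPer hM ha hb n :=
      ⟨h2, (mem_maximalInvariantSet_of_periodic hn h2).1 h1⟩
    obtain ⟨k1, k2⟩ := key x hx
    refine ⟨hx, k1.1 h3, ?_⟩
    have := k1.1 h3
    rw [← h4, k2]
    split_ifs <;> omega
  · rintro ⟨hx, h0, hd⟩
    obtain ⟨k1, k2⟩ := key x hx
    refine ⟨(mem_maximalInvariantSet_of_periodic hn hx.1).2 hx.2, hx.1, k1.2 h0, ?_⟩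
    rw [hd, k2]
    split_ifs <;> omega

end Derivative

/-! ### Periodic points: injectivity of the coding and time reversal -/

section Periodic

variable {M : ℕ} {a b : ℝ}

variable (hM : 2 ≤ M) (ha : a ∈ Ioo 0 (1 / (M : ℝ))) (hb : b ∈ Ioo 0 (1 / (M : ℝ)))

local notation "𝐓" => bakerMap M a b hM ha hb
local notation "𝐓'" => bakerMap M b a hM hb ha

/-- The open cube `(0,1)³`. -/
def openCube : Set cube := {x | x.1 ∈ Ioo (0 : ℝ) 1 ×ˢ Ioo (0 : ℝ) 1 ×ˢ Ioo (0 : ℝ) 1}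

theorem mem_openCube_of_openDomain (hM : 2 ≤ M) (ha : a ∈ Ioo 0 (1 / (M : ℝ))) {x : cube}
    (h : x ∈ openDomain M a) : x ∈ openCube := by
  have hM' := cast_pos_of_two_le hM
  have haM := mul_lt_one_of_mem hM ha
  have ha0 := ha.1
  rcases h with ⟨k, hk⟩ | ⟨k, hk⟩
  · rw [interior_domAlpha] at hk
    obtain ⟨⟨h1, h2⟩, h3⟩ := hk
    have hk0 : (0 : ℝ) ≤ k := Nat.cast_nonneg _
    have hkM : (k : ℝ) + 1 ≤ M := cast_add_one_le k
    exact ⟨⟨by nlinarith, by nlinarith⟩, h3⟩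
  · rw [interior_domBeta hM] at hk
    obtain ⟨⟨h1, h2⟩, ⟨h3, h4⟩, h5⟩ := hk
    have hk0 : (0 : ℝ) ≤ k := Nat.cast_nonneg _
    have hkM : (k : ℝ) + 1 ≤ M := cast_add_one_le k
    refine ⟨⟨by nlinarith, h2⟩, ⟨?_, ?_⟩, h5⟩
    · exact lt_of_le_of_lt (by positivity) h3
    · exact h4.trans_le ((div_le_one hM').2 hkM)

/-- A point of the open cube with image in the open cube lies in the interior of a domain. -/
theorem mem_openDomain_of_openCube {x : cube} (h : x ∈ openCube) (hT : 𝐓 x ∈ openCube) :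
    x ∈ openDomain M a := by
  have hM' := cast_pos_of_two_le hM
  have haM := mul_lt_one_of_mem hM ha
  have ha0 := ha.1
  obtain ⟨hu, hc, hs⟩ := h
  obtain ⟨hu', hc', -⟩ := hT
  rcases exists_mem_dom hM ha.1 x.2 with ⟨k, hk⟩ | ⟨k, hk⟩
  · left
    refine ⟨k, ?_⟩
    rw [interior_domAlpha]
    have h1 : (𝐓 x).1.1 = (x.1.1 - k * a) / a := by
      rw [coe_bakerMap, bakerFun_of_mem_domAlpha ha.1 hk, branchAlpha]
    rw [h1] at hu'
    have h2 := hu'.1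
    rw [lt_div_iff₀ ha0] at h2
    exact ⟨⟨by linarith, hk.1.2⟩, hc, hs⟩
  · right
    refine ⟨k, ?_⟩
    rw [interior_domBeta hM]
    have h1 : (𝐓 x).1.1 = (x.1.1 - M * a) / (1 - M * a) := by
      rw [coe_bakerMap, bakerFun_of_mem_domBeta ha.1 hk, branchBeta]
    have h2 : (𝐓 x).1.2.1 = M * x.1.2.1 - k := by
      rw [coe_bakerMap, bakerFun_of_mem_domBeta ha.1 hk, branchBeta]
    rw [h1] at hu'
    rw [h2] at hc'
    have h3 := hu'.1
    rw [lt_div_iff₀ (by linarith)] at h3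
    refine ⟨⟨by linarith, hu.2⟩, ⟨?_, ?_⟩, hs⟩
    · rw [div_lt_iff₀ hM']
      linarith [hc'.1]
    · rw [lt_div_iff₀ hM']
      linarith [hc'.2]

theorem mem_interiorPer_iff {n : ℕ} {x : cube} :
    x ∈ interiorPer hM ha hb n ↔ 𝐓^[n] x = x ∧ ∀ i, 𝐓^[i] x ∈ openCube := by
  refine and_congr_right fun _ => ⟨fun h i => mem_openCube_of_openDomain hM ha (h i),
    fun h i => mem_openDomain_of_openCube hM ha hb (h i) ?_⟩
  rw [← Function.iterate_succ_apply' 𝐓]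
  exact h (i + 1)

theorem iterate_mem_interiorPer {n : ℕ} {x : cube} (h : x ∈ interiorPer hM ha hb n) (k : ℕ) :
    𝐓^[k] x ∈ interiorPer hM ha hb n := by
  refine ⟨?_, fun i => ?_⟩
  · rw [← Function.iterate_add_apply, add_comm, Function.iterate_add_apply, h.1]
  · rw [← Function.iterate_add_apply]
    exact h.2 _

theorem height_iterate {n : ℕ} {x : cube} (h : 𝐓^[n] x = x) (k : ℕ) :
    height 𝐓 M a n (𝐓^[k] x) = height 𝐓 M a n x := by
  have h1 := height_add (M := M) (a := a) 𝐓 k n x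
  have h2 := height_add (M := M) (a := a) 𝐓 n k x
  rw [h] at h2
  rw [add_comm k n, h2] at h1
  linarith

/-- Along a periodic orbit that pushes more than it pops, one can start at a time of minimal height:
from then on the initial stack is never touched. -/
theorem exists_depth_eq_zero {n : ℕ} (hn : 1 ≤ n) {x : cube}
    (h : ∀ i, sym M a (𝐓^[i] (𝐓^[n] x)) = sym M a (𝐓^[i] x)) (hpos : 0 < height 𝐓 M a n x) :
    ∃ τ < n, depth (wordOf 𝐓 (sym M a) n (𝐓^[τ] x)) = 0 := by
  obtain ⟨τ, hτ, hmin⟩ := Finset.exists_min_image (Finset.range n)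
    (fun i => height 𝐓 M a i x) ⟨0, Finset.mem_range.2 hn⟩
  refine ⟨τ, Finset.mem_range.1 hτ, Nat.le_zero.1 ((depth_le_iff 𝐓 n 0 _).2 fun i hi => ?_)⟩
  have h1 := height_add (M := M) (a := a) 𝐓 τ i x
  have hτ' := Finset.mem_range.1 hτ
  rw [Nat.cast_zero, zero_add]
  rcases lt_or_ge (τ + i) n with hlt | hge
  · have := hmin (τ + i) (Finset.mem_range.2 hlt)
    linarith
  · obtain ⟨l, hl⟩ := Nat.exists_eq_add_of_le hge
    have h2 := height_add (M := M) (a := a) 𝐓 n l x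
    have h3 : height 𝐓 M a l (𝐓^[n] x) = height 𝐓 M a l x := by
      simp only [height, birkhoffSum, h]
    rw [h3, ← hl] at h2
    have := hmin l (Finset.mem_range.2 (by omega))
    linarith

/-- Points with the same itinerary have the same expanding coordinate. -/
theorem u_eq_of_sym_eq {x y : cube} (h : ∀ i, sym M a (𝐓^[i] x) = sym M a (𝐓^[i] y)) :
    x.1.1 = y.1.1 := by
  have h1 : ∀ R : ℕ, |x.1.1 - y.1.1| ≤ max a (1 - M * a) ^ R := by
    intro R
    have hw : wordOf 𝐓 (sym M a) R x = wordOf 𝐓 (sym M a) R y := wordOf_eq_iff.2 fun i _ => h i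
    rw [wordOf_sym_eq, wordOf_sym_eq] at hw
    exact abs_sub_le_of_wordOf_eq hM ha R _ _ (fun i _ => u_iterate_mem hM ha hb i _)
      (fun i _ => u_iterate_mem hM ha hb i _) hw
  have h2 := ge_of_tendsto' (tendsto_pow_atTop_nhds_zero_of_lt_one (max_uRate_pos ha).le
    (max_uRate_lt_one hM ha)) h1
  exact sub_eq_zero.1 (abs_nonpos_iff.1 h2)

/-- A `1`-unstable periodic point is determined by its word. -/
theorem eq_of_wordOf_eq {n : ℕ} (hn : 1 ≤ n) {x y : cube} (hx : x ∈ interiorPer hM ha hb n)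
    (hy : y ∈ interiorPer hM ha hb n) (hpos : 0 < height 𝐓 M a n x)
    (hw : wordOf 𝐓 (sym M a) n x = wordOf 𝐓 (sym M a) n y) : x = y := by
  have hM' := two_le_cast hM
  have hsym : ∀ i, sym M a (𝐓^[i] x) = sym M a (𝐓^[i] y) := by
    intro i
    have hxp : Function.IsPeriodicPt 𝐓 n x := hx.1
    have hyp : Function.IsPeriodicPt 𝐓 n y := hy.1
    rw [← hxp.iterate_mod_apply i, ← hyp.iterate_mod_apply i]
    exact wordOf_eq_iff.1 hw _ (Nat.mod_lt _ hn)
  obtain ⟨τ, hτ, hdepth⟩ := exists_depth_eq_zero hM ha hb hn (by rw [hx.1]; simp) hpos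
  have hxτ := iterate_mem_interiorPer hM ha hb hx τ
  have hyτ := iterate_mem_interiorPer hM ha hb hy τ
  have hsymτ : ∀ i, sym M a (𝐓^[i] (𝐓^[τ] x)) = sym M a (𝐓^[i] (𝐓^[τ] y)) := by
    intro i
    rw [← Function.iterate_add_apply, ← Function.iterate_add_apply]
    exact hsym _
  have hcx := (mem_openCube_of_openDomain hM ha (hxτ.2 0)).2.1.2
  have hcy := (mem_openCube_of_openDomain hM ha (hyτ.2 0)).2.1.2
  have hu := u_eq_of_sym_eq hM ha hb hsymτ
  obtain ⟨h1, h2⟩ := sub_iterate_eq hM ha hb n 0 (𝐓^[τ] x) (𝐓^[τ] y)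
    (wordOf_eq_iff.2 fun i _ => hsymτ i) hdepth.le (floor_eq_of_lt_one hcx hcy)
  rw [hxτ.1, hyτ.1] at h1 h2
  have hc : (𝐓^[τ] x).1.2.1 = (𝐓^[τ] y).1.2.1 := by
    have h3 : 1 < (M : ℝ) ^ height 𝐓 M a n (𝐓^[τ] x) := by
      rw [height_iterate hM ha hb hx.1]
      exact one_lt_zpow₀ (by linarith) hpos
    have h4 : ((𝐓^[τ] x).1.2.1 - (𝐓^[τ] y).1.2.1) *
        ((M : ℝ) ^ height 𝐓 M a n (𝐓^[τ] x) - 1) = 0 := by linarith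
    rcases mul_eq_zero.1 h4 with h5 | h5 <;> linarith
  have hs : (𝐓^[τ] x).1.2.2 = (𝐓^[τ] y).1.2.2 := by
    have h3 : ∏ i, sRate M b (wordOf 𝐓 (sym M a) n (𝐓^[τ] x) i) < 1 :=
      (prod_sRate_le hM hb _).trans_lt (pow_lt_one₀
        (le_max_of_le_right hb.1.le) (max_sRate_lt_one hM hb) (by omega))
    have h4 : ((𝐓^[τ] x).1.2.2 - (𝐓^[τ] y).1.2.2) *
        (1 - ∏ i, sRate M b (wordOf 𝐓 (sym M a) n (𝐓^[τ] x) i)) = 0 := by linarith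
    rcases mul_eq_zero.1 h4 with h5 | h5 <;> linarith
  have heq : 𝐓^[τ] x = 𝐓^[τ] y := Subtype.ext (Prod.ext hu (Prod.ext hc hs))
  have h5 := congrArg 𝐓^[n - τ] heq
  rwa [← Function.iterate_add_apply, ← Function.iterate_add_apply, Nat.sub_add_cancel hτ.le,
    hx.1, hy.1] at h5

theorem flipCube_mem_openCube {x : cube} (h : x ∈ openCube) : flipCube x ∈ openCube := by
  obtain ⟨⟨h1, h2⟩, ⟨h3, h4⟩, h5, h6⟩ := h
  refine ⟨⟨?_, ?_⟩, ⟨?_, ?_⟩, ?_, ?_⟩ <;> simp only [coe_flipCube] <;> linarith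

theorem bakerMap_flipCube_of_openCube {x : cube} (h : x ∈ openCube) :
    𝐓' (flipCube (𝐓 x)) = flipCube x :=
  bakerMap_flipCube hM ha hb (fun _ => h.2.1.1) fun _ => h.2.2.1

/-- Time reversal maps periodic points to periodic points of the map with swapped parameters, and
changes the sign of the height. -/
theorem flipCube_mem_interiorPer {n : ℕ} (hn : 1 ≤ n) {x : cube} (h : x ∈ interiorPer hM ha hb n) :
    flipCube x ∈ interiorPer hM hb ha n ∧
      height 𝐓' M b n (flipCube x) = -height 𝐓 M a n x := by
  rw [mem_interiorPer_iff] at h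
  obtain ⟨hper, hcube⟩ := h
  have hback : ∀ i k, 𝐓'^[i] (flipCube (𝐓^[k + i] x)) = flipCube (𝐓^[k] x) := by
    intro i
    induction i with
    | zero => intro k; rfl
    | succ i ih =>
      intro k
      rw [Function.iterate_succ_apply', show k + (i + 1) = (k + 1) + i by omega, ih,
        Function.iterate_succ_apply']
      exact bakerMap_flipCube_of_openCube hM ha hb (hcube k)
  have hper' : Function.IsPeriodicPt 𝐓 n x := hper
  have hloc : ∀ i ≤ n, 𝐓'^[i] (flipCube x) = flipCube (𝐓^[n - i] x) := by
    intro i hi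
    have h1 := hback i (n - i)
    rwa [Nat.sub_add_cancel hi, hper] at h1
  refine ⟨(mem_interiorPer_iff hM hb ha).2 ⟨?_, fun i => ?_⟩, ?_⟩
  · rw [hloc n le_rfl, Nat.sub_self]
    rfl
  · have h1 := hback i (i * n - i)
    rw [Nat.sub_add_cancel (Nat.le_mul_of_pos_right i hn)] at h1
    have h2 : 𝐓^[i * n] x = x := hper'.const_mul i
    rw [h2] at h1
    rw [h1]
    exact flipCube_mem_openCube (hcube _)
  · rw [height, height, birkhoffSum, birkhoffSum, ← Finset.sum_neg_distrib,
      ← Finset.sum_range_reflect]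
    refine Finset.sum_congr rfl fun i hi => ?_
    have hi' := Finset.mem_range.1 hi
    rw [hloc _ (by omega), show n - (n - 1 - i) = i + 1 by omega, Function.iterate_succ_apply']
    have h3 := sym_flipCube_lt_iff hM ha hb (x := 𝐓^[i] x) (fun _ => (hcube i).2.1.1)
      fun _ => (hcube i).2.2.1
    simp only [stepHeight]
    split_ifs with h4 h5 h5
    · exact absurd h5 (h3.1 h4)
    · norm_num
    · norm_num
    · exact absurd (h3.2 h5) h4

end Periodic

/-! ### Periodic points: existence -/

section Existence

variable {M : ℕ} {a b : ℝ}

variable (hM : 2 ≤ M) (ha : a ∈ Ioo 0 (1 / (M : ℝ))) (hb : b ∈ Ioo 0 (1 / (M : ℝ)))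

local notation "𝐓" => bakerMap M a b hM ha hb

theorem seqCode_u_mem (hM : 2 ≤ M) (ha : a ∈ Ioo 0 (1 / (M : ℝ))) (ω : ℕ → Fin (M + 1)) :
    seqCode (uRate M a) (uShift M a) ω ∈ Icc (0 : ℝ) 1 :=
  seqCode_mem (uRate_nonneg hM ha) (uShift_nonneg ha) (uRate_add_le hM ha) ω

theorem seqCode_u_eq (hM : 2 ≤ M) (ha : a ∈ Ioo 0 (1 / (M : ℝ))) (ω : ℕ → Fin (M + 1)) :
    seqCode (uRate M a) (uShift M a) ω =
      uRate M a (ω 0) * seqCode (uRate M a) (uShift M a) (shiftSeq ω) + uShift M a (ω 0) :=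
  seqCode_eq (uRate_nonneg hM ha) (uShift_nonneg ha) (uRate_add_le hM ha) ω

theorem eq_last_of_seqCode_eq_one (hM : 2 ≤ M) (ha : a ∈ Ioo 0 (1 / (M : ℝ))) (i : ℕ) :
    ∀ ω : ℕ → Fin (M + 1), seqCode (uRate M a) (uShift M a) ω = 1 → ω i = Fin.last M := by
  have key : ∀ ω : ℕ → Fin (M + 1), seqCode (uRate M a) (uShift M a) ω = 1 →
      ω 0 = Fin.last M ∧ seqCode (uRate M a) (uShift M a) (shiftSeq ω) = 1 := by
    intro ω h
    have h1 := seqCode_u_eq hM ha ω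
    have h2 := seqCode_u_mem hM ha (shiftSeq ω)
    have haM := mul_lt_one_of_mem hM ha
    have ha0 := ha.1
    rw [h, uRate, uShift] at h1
    split_ifs at h1 with hj
    · have : ((ω 0 : ℕ) : ℝ) + 1 ≤ M := by exact_mod_cast hj
      nlinarith [h2.2]
    · have h3 : (ω 0 : ℕ) = M := not_lt_eq hj
      refine ⟨Fin.ext h3, ?_⟩
      rw [h3] at h1
      have h4 : (1 - (M : ℝ) * a) * (seqCode (uRate M a) (uShift M a) (shiftSeq ω) - 1) = 0 := by
        linarith
      rcases mul_eq_zero.1 h4 with h5 | h5 <;> linarith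
  induction i with
  | zero => exact fun ω h => (key ω h).1
  | succ i ih => exact fun ω h => ih (shiftSeq ω) (key ω h).2

theorem eq_zero_of_seqCode_eq_zero (hM : 2 ≤ M) (ha : a ∈ Ioo 0 (1 / (M : ℝ))) (i : ℕ) :
    ∀ ω : ℕ → Fin (M + 1), seqCode (uRate M a) (uShift M a) ω = 0 → ω i = 0 := by
  have key : ∀ ω : ℕ → Fin (M + 1), seqCode (uRate M a) (uShift M a) ω = 0 →
      ω 0 = 0 ∧ seqCode (uRate M a) (uShift M a) (shiftSeq ω) = 0 := by
    intro ω h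
    have h1 := seqCode_u_eq hM ha ω
    have h2 := mul_nonneg (uRate_nonneg hM ha (ω 0)) (seqCode_u_mem hM ha (shiftSeq ω)).1
    have h3 := uShift_nonneg ha (ω 0)
    rw [h] at h1
    have h4 : uShift M a (ω 0) = 0 := by linarith
    have h5 : uRate M a (ω 0) * seqCode (uRate M a) (uShift M a) (shiftSeq ω) = 0 := by linarith
    refine ⟨?_, (mul_eq_zero.1 h5).resolve_left (uRate_pos hM ha _).ne'⟩
    have h6 := (mul_eq_zero.1 h4).resolve_right ha.1.ne'
    exact Fin.ext (by simpa using h6)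
  induction i with
  | zero => exact fun ω h => (key ω h).1
  | succ i ih => exact fun ω h => ih (shiftSeq ω) (key ω h).2

/-- The points with a given coded expanding coordinate have the given itinerary. -/
theorem itinerary_of_seqCode {ω : ℕ → Fin (M + 1)}
    (h : ∀ i, seqCode (uRate M a) (uShift M a) (shiftSeq^[i] ω) < 1) {x : cube}
    (hx : x.1.1 = seqCode (uRate M a) (uShift M a) ω) (i : ℕ) :
    (𝐓^[i] x).1.1 = seqCode (uRate M a) (uShift M a) (shiftSeq^[i] ω) ∧
      sym M a (𝐓^[i] x) = ω i := by
  have hsym : ∀ i, (𝐓^[i] x).1.1 = seqCode (uRate M a) (uShift M a) (shiftSeq^[i] ω) →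
      sym M a (𝐓^[i] x) = ω i := by
    intro i hi
    have h1 := uSym_affine hM ha (shiftSeq^[i] ω 0)
      (u := seqCode (uRate M a) (uShift M a) (shiftSeq (shiftSeq^[i] ω)))
      ⟨(seqCode_u_mem hM ha _).1, by
        have h2 := h (i + 1)
        rwa [Function.iterate_succ_apply'] at h2⟩
    rw [← seqCode_u_eq hM ha, ← hi, shiftSeq_iterate, zero_add] at h1
    exact h1
  have hu : ∀ i, (𝐓^[i] x).1.1 = seqCode (uRate M a) (uShift M a) (shiftSeq^[i] ω) := by
    intro i
    induction i with
    | zero => exact hx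
    | succ i ih =>
      have h2 : ω i = shiftSeq^[i] ω 0 := by rw [shiftSeq_iterate, zero_add]
      rw [Function.iterate_succ_apply', Function.iterate_succ_apply', bakerMap_u, hsym i ih, ih,
        seqCode_u_eq hM ha, h2, uMap_affine hM ha]
  exact ⟨hu i, hsym i (hu i)⟩

/-- The face `x_s = 0` is reached from itself only, and without popping. -/
theorem sym_lt_of_s_eq_zero (n : ℕ) : ∀ x : cube, (𝐓^[n] x).1.2.2 = 0 →
    x.1.2.2 = 0 ∧ ∀ i < n, (sym M a (𝐓^[i] x) : ℕ) < M := by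
  induction n with
  | zero => exact fun x h => ⟨h, by simp⟩
  | succ n ih =>
    intro x h
    obtain ⟨h1, h2⟩ := ih (𝐓 x) h
    obtain ⟨h3, h4⟩ := s_eq_zero_of_bakerMap hM ha hb h1
    refine ⟨h3, fun i hi => ?_⟩
    rcases i with _ | i
    · exact h4
    · exact h2 i (by omega)

theorem s_eq_one_of_bakerMap {x : cube} (h : (𝐓 x).1.2.2 = 1) :
    x.1.2.2 = 1 ∧ ¬ (sym M a x : ℕ) < M := by
  have hM' := cast_pos_of_two_le hM
  have hb0 := hb.1
  have hs := x.2.2.2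
  rw [bakerMap_s, sMap] at h
  split_ifs at h with hj
  · have h1 := mul_pos hM' hb0
    have h2 := mul_nonneg h1.le hs.1
    nlinarith [hs.1, hs.2, mul_lt_one_of_mem hM hb]
  · have h1 : (cDig M x.1.2.1 : ℝ) + 1 ≤ M := by exact_mod_cast cDig_lt hM _
    have h2 : b * (x.1.2.2 - (M - cDig M x.1.2.1)) = 0 := by linarith
    have h3 := (mul_eq_zero.1 h2).resolve_left hb0.ne'
    exact ⟨by linarith [hs.2], hj⟩

/-- The face `x_s = 1` is reached from itself only, and without pushing. -/
theorem not_sym_lt_of_s_eq_one (n : ℕ) : ∀ x : cube, (𝐓^[n] x).1.2.2 = 1 →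
    x.1.2.2 = 1 ∧ ∀ i < n, ¬ (sym M a (𝐓^[i] x) : ℕ) < M := by
  induction n with
  | zero => exact fun x h => ⟨h, by simp⟩
  | succ n ih =>
    intro x h
    obtain ⟨h1, h2⟩ := ih (𝐓 x) h
    obtain ⟨h3, h4⟩ := s_eq_one_of_bakerMap hM ha hb h1
    refine ⟨h3, fun i hi => ?_⟩
    rcases i with _ | i
    · exact h4
    · exact h2 i (by omega)

/-- A periodic sequence of symbols is realized by an interior periodic point, provided that it never
reads the initial stack, and that the stack which it writes is neither
empty nor full. The central and the contracting coordinate are fixed points of affine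
contractions. -/
theorem exists_mem_interiorPer {n : ℕ} (hn : 1 ≤ n) {ω : ℕ → Fin (M + 1)}
    (hper : ∀ i, ω (i + n) = ω i) (hα : ∃ i, ω i ≠ Fin.last M) (hβ : ∃ i, ω i = Fin.last M)
    {x₀ : cube} (hx₀ : (x₀ : ℝ × ℝ × ℝ) = (seqCode (uRate M a) (uShift M a) ω, 0, 0))
    (hdepth : depth (wordOf 𝐓 (sym M a) n x₀) = 0) (h0 : 0 < (𝐓^[n] x₀).1.2.1)
    (h1 : (𝐓^[n] x₀).1.2.1 + (M : ℝ) ^ (-height 𝐓 M a n x₀) < 1) :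
    ∃ x ∈ interiorPer hM ha hb n, ∀ i, sym M a (𝐓^[i] x) = ω i := by
  have hM' := two_le_cast hM
  have hM0 := cast_pos_of_two_le hM
  have hperk : ∀ k i, ω (i + k * n) = ω i := by
    intro k
    induction k with
    | zero => simp
    | succ k ih => intro i; rw [Nat.succ_mul, ← add_assoc, hper, ih]
  have hshift : shiftSeq^[n] ω = ω := by
    funext i
    rw [shiftSeq_iterate, hper]
  -- both kinds of letters recur
  have hα' : ∀ i, ∃ j, i ≤ j ∧ ω j ≠ Fin.last M := by
    intro i
    obtain ⟨j, hj⟩ := hα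
    exact ⟨j + i * n, le_add_left (Nat.le_mul_of_pos_right i hn), by rwa [hperk]⟩
  have hβ' : ∀ i, ∃ j, i ≤ j ∧ ω j = Fin.last M := by
    intro i
    obtain ⟨j, hj⟩ := hβ
    exact ⟨j + i * n, le_add_left (Nat.le_mul_of_pos_right i hn), by rwa [hperk]⟩
  have hu1 : ∀ i, seqCode (uRate M a) (uShift M a) (shiftSeq^[i] ω) < 1 := by
    intro i
    refine lt_of_le_of_ne (seqCode_u_mem hM ha _).2 fun h => ?_
    obtain ⟨j, hij, hj⟩ := hα' i
    have h2 := eq_last_of_seqCode_eq_one hM ha (j - i) _ h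
    rw [shiftSeq_iterate, Nat.sub_add_cancel hij] at h2
    exact hj h2
  have hu0 : ∀ i, 0 < seqCode (uRate M a) (uShift M a) (shiftSeq^[i] ω) := by
    intro i
    refine lt_of_le_of_ne (seqCode_u_mem hM ha _).1 fun h => ?_
    obtain ⟨j, hij, hj⟩ := hβ' i
    have h2 := eq_zero_of_seqCode_eq_zero hM ha (j - i) _ h.symm
    rw [shiftSeq_iterate, Nat.sub_add_cancel hij, hj] at h2
    have h3 := congrArg Fin.val h2
    simp at h3
    omega
  have hit : ∀ {x : cube}, x.1.1 = seqCode (uRate M a) (uShift M a) ω → ∀ i,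
      (𝐓^[i] x).1.1 = seqCode (uRate M a) (uShift M a) (shiftSeq^[i] ω) ∧
        sym M a (𝐓^[i] x) = ω i := fun hx i => itinerary_of_seqCode hM ha hb hu1 hx i
  have hx₀u : x₀.1.1 = seqCode (uRate M a) (uShift M a) ω := by rw [hx₀]
  have hx₀c : x₀.1.2.1 = 0 := by rw [hx₀]
  have hx₀s : x₀.1.2.2 = 0 := by rw [hx₀]
  -- points with the same itinerary
  have hrel : ∀ y : cube, y.1.1 = seqCode (uRate M a) (uShift M a) ω → y.1.2.1 < 1 → ∀ i ≤ n,
      ((𝐓^[i] y).1.2.1 - (𝐓^[i] x₀).1.2.1) * (M : ℝ) ^ height 𝐓 M a i x₀ = y.1.2.1 ∧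
      (𝐓^[i] y).1.2.2 - (𝐓^[i] x₀).1.2.2 =
        (∏ l, sRate M b (wordOf 𝐓 (sym M a) i x₀ l)) * y.1.2.2 := by
    intro y hy hyc i hi
    have hw : wordOf 𝐓 (sym M a) i y = wordOf 𝐓 (sym M a) i x₀ :=
      wordOf_eq_iff.2 fun l _ => (hit hy l).2.trans (hit hx₀u l).2.symm
    have hd : depth (wordOf 𝐓 (sym M a) i y) ≤ 0 := by
      rw [hw, ← hdepth]
      exact depth_wordOf_mono 𝐓 x₀ hi
    have h2 := sub_iterate_eq hM ha hb i 0 y x₀ hw hd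
      (floor_eq_of_lt_one hyc (by rw [hx₀c]; exact one_pos))
    rw [hx₀c, hx₀s, sub_zero, sub_zero, height_eq_sum, hw, ← height_eq_sum] at h2
    exact h2
  -- On the points with this itinerary, `f^n` acts as `c ↦ q * c + e` and `s ↦ r * s + σ`.
  set h := height 𝐓 M a n x₀ with hh
  set q : ℝ := (M : ℝ) ^ (-h) with hq
  set e := (𝐓^[n] x₀).1.2.1 with he
  set σ := (𝐓^[n] x₀).1.2.2 with hσ
  set r := ∏ l, sRate M b (wordOf 𝐓 (sym M a) n x₀ l) with hr
  have hq0 : 0 < q := zpow_pos hM0 _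
  have hqh : (M : ℝ) ^ h * q = 1 := by rw [hq, ← zpow_add₀ hM0.ne', add_neg_cancel, zpow_zero]
  have hr0 : 0 ≤ r := prod_sRate_nonneg hM hb _
  have hr1 : r < 1 := (prod_sRate_le hM hb _).trans_lt (pow_lt_one₀
    (le_max_of_le_right hb.1.le) (max_sRate_lt_one hM hb) (by omega))
  have hσ0 : 0 ≤ σ := (𝐓^[n] x₀).2.2.2.1
  have hσr : σ ≤ 1 - r := by
    -- the image of `s = 1` is at most `1`
    have hy := (hrel (mkCube (⟨_, seqCode_u_mem hM ha ω⟩, 0, 1)) rfl (by simp [mkCube]) n le_rfl).2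
    have hy1 := (𝐓^[n] (mkCube (⟨_, seqCode_u_mem hM ha ω⟩, 0, 1))).2.2.2.2
    have hy2 : (mkCube (⟨_, seqCode_u_mem hM ha ω⟩, 0, 1)).1.2.2 = 1 := rfl
    rw [hy2, mul_one] at hy
    linarith
  set c : ℝ := e / (1 - q) with hc
  set s : ℝ := σ / (1 - r) with hs
  have hq1 : 0 < 1 - q := by linarith
  have hr1' : 0 < 1 - r := by linarith
  have hc0 : 0 < c := div_pos h0 hq1
  have hc1 : c < 1 := (div_lt_one hq1).2 (by linarith)
  have hs0 : 0 ≤ s := div_nonneg hσ0 hr1'.le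
  have hs1 : s ≤ 1 := (div_le_one hr1').2 hσr
  set x : cube := mkCube (⟨_, seqCode_u_mem hM ha ω⟩, ⟨c, hc0.le, hc1.le⟩, ⟨s, hs0, hs1⟩) with hx
  have hxu : x.1.1 = seqCode (uRate M a) (uShift M a) ω := rfl
  have hxc : x.1.2.1 = c := rfl
  have hxs : x.1.2.2 = s := rfl
  have hfix : 𝐓^[n] x = x := by
    obtain ⟨h2, h3⟩ := hrel x hxu (by rw [hxc]; exact hc1) n le_rfl
    refine Subtype.ext (Prod.ext ?_ (Prod.ext ?_ ?_))
    · rw [(hit hxu n).1, hshift]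
      exact hxu.symm
    · rw [hxc] at h2 ⊢
      have h4 : (𝐓^[n] x).1.2.1 - e = c * q := by
        rw [← h2, mul_assoc, hqh, mul_one]
      have h5 : c * (1 - q) = e := div_mul_cancel₀ _ hq1.ne'
      linarith
    · rw [hxs] at h3 ⊢
      have h5 : s * (1 - r) = σ := div_mul_cancel₀ _ hr1'.ne'
      linarith
  have hperx : Function.IsPeriodicPt 𝐓 n x := hfix
  refine ⟨x, (mem_interiorPer_iff hM ha hb).2 ⟨hfix, fun i => ?_⟩, fun i => (hit hxu i).2⟩
  have hci : 0 < (𝐓^[i] x).1.2.1 := by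
    rw [← hperx.iterate_mod_apply i]
    have h2 := (hrel x hxu (by rw [hxc]; exact hc1) (i % n) (Nat.mod_lt _ hn).le).1
    have h3 := (𝐓^[i % n] x₀).2.2.1.1
    rw [hxc] at h2
    have h4 : 0 < ((𝐓^[i % n] x).1.2.1 - (𝐓^[i % n] x₀).1.2.1) := by
      refine pos_of_mul_pos_left ?_ (zpow_pos hM0 (height 𝐓 M a (i % n) x₀)).le
      rw [h2]
      exact hc0
    linarith
  -- A point with `x_s = 0` has only pushed and one with `x_s = 1` has only popped, which periodicity
  -- excludes since both kinds of letters occur.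
  refine ⟨⟨?_, ?_⟩, ⟨hci, c_lt_one_iterate hM ha hb (by rw [hxc]; exact hc1) i⟩, ?_, ?_⟩
  · rw [(hit hxu i).1]
    exact hu0 i
  · rw [(hit hxu i).1]
    exact hu1 i
  · refine lt_of_le_of_ne (𝐓^[i] x).2.2.2.1 fun hz => ?_
    obtain ⟨j, hj⟩ := hβ
    have h2 : 𝐓^[i + (j + 1) * n] x = 𝐓^[i] x := by
      rw [Function.iterate_add_apply, (hperx.const_mul (j + 1)).eq]
    have h3 := (sym_lt_of_s_eq_zero hM ha hb (i + (j + 1) * n) x (by rw [h2]; exact hz.symm)).2 j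
      (by nlinarith)
    rw [(hit hxu j).2, hj] at h3
    simp at h3
  · refine lt_of_le_of_ne (𝐓^[i] x).2.2.2.2 fun hz => ?_
    obtain ⟨j, hj⟩ := hα
    have h2 : 𝐓^[i + (j + 1) * n] x = 𝐓^[i] x := by
      rw [Function.iterate_add_apply, (hperx.const_mul (j + 1)).eq]
    have h3 := (not_sym_lt_of_s_eq_one hM ha hb (i + (j + 1) * n) x (by rw [h2]; exact hz)).2 j
      (by nlinarith)
    rw [(hit hxu j).2] at h3
    exact hj (Fin.ext (not_lt_eq h3))

end Existence

/-! ### Counting periodic points -/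

/-- The cyclic rotation of a word by `τ` letters. -/
def rotateWord {ι : Type*} {n : ℕ} (τ : ℕ) (w : Fin n → ι) : Fin n → ι :=
  fun i => w ⟨(i + τ) % n, Nat.mod_lt _ i.pos⟩

theorem rotateWord_injective {ι : Type*} {n τ : ℕ} (hτ : τ < n) :
    Function.Injective (rotateWord τ : (Fin n → ι) → Fin n → ι) := by
  intro w w' h
  funext j
  have h1 := congrFun h ⟨(j + (n - τ)) % n, Nat.mod_lt _ j.pos⟩
  have h2 : ((j + (n - τ)) % n + τ) % n = j := by
    rw [Nat.mod_add_mod, add_assoc, Nat.sub_add_cancel hτ.le, Nat.add_mod_right,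
      Nat.mod_eq_of_lt j.isLt]
  simpa only [rotateWord, h2, Fin.eta] using h1

section Counting

variable {M : ℕ} {a b : ℝ}

variable (hM : 2 ≤ M) (ha : a ∈ Ioo 0 (1 / (M : ℝ))) (hb : b ∈ Ioo 0 (1 / (M : ℝ)))

local notation "𝐓" => bakerMap M a b hM ha hb

open Classical in
/-- The words of length `n` that send every point with a central coordinate in `(0, 1)` to a point
whose central coordinate is at a distance less than `M ^ (-L)` of `0` or `1`. -/
def edgeWords (n L : ℕ) : Finset (Fin n → Fin (M + 1)) :=
  Finset.univ.filter fun w => ∀ y : cube, wordOf 𝐓 (sym M a) n y = w → 0 < y.1.2.1 →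
    y.1.2.1 < 1 → (𝐓^[n] y).1.2.1 < ((M : ℝ) ^ L)⁻¹ ∨ 1 - ((M : ℝ) ^ L)⁻¹ < (𝐓^[n] y).1.2.1

theorem mem_edgeWords {n L : ℕ} {w : Fin n → Fin (M + 1)} :
    w ∈ edgeWords hM ha hb n L ↔ ∀ y : cube, wordOf 𝐓 (sym M a) n y = w → 0 < y.1.2.1 →
      y.1.2.1 < 1 → (𝐓^[n] y).1.2.1 < ((M : ℝ) ^ L)⁻¹ ∨
        1 - ((M : ℝ) ^ L)⁻¹ < (𝐓^[n] y).1.2.1 := by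
  simp only [edgeWords, Finset.mem_filter, Finset.mem_univ, true_and]

/-- By invariance, the edge words are read with probability at most `2 * M ^ (-L)`. -/
theorem card_edgeWords_le (n L : ℕ) :
    ((edgeWords hM ha hb n L).card : ℝ) * ((M : ℝ) + 1)⁻¹ ^ n ≤ 2 * ((M : ℝ) ^ L)⁻¹ := by
  have : NeZero M := ⟨by omega⟩
  have := isProbabilityMeasure_alphaMeasure hM ha hb
  have hT := measurePreserving_alphaMeasure hM ha hb
  have hw := measurable_wordOf hT.measurable (measurable_sym (M := M) (a := a)) n
  set μ := alphaMeasure M a b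
  set A : Set cube := {x | x.1.2.1 < ((M : ℝ) ^ L)⁻¹} with hA
  set B : Set cube := {x | 1 - ((M : ℝ) ^ L)⁻¹ < x.1.2.1} with hB
  have hc : Measurable fun x : cube => x.1.2.1 := by fun_prop
  have hAm : MeasurableSet A := measurableSet_lt hc measurable_const
  have hBm : MeasurableSet B := measurableSet_lt measurable_const hc
  have h1 : μ.real (wordOf 𝐓 (sym M a) n ⁻¹' (edgeWords hM ha hb n L)) =
      (edgeWords hM ha hb n L).card * ((M : ℝ) + 1)⁻¹ ^ n := by
    rw [← sum_measureReal_preimage_singleton _ fun w _ => hw (measurableSet_singleton w)]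
    simp only [μ, real_law_alphaMeasure hM ha hb, Finset.sum_const, nsmul_eq_mul]
  have h2 : μ (wordOf 𝐓 (sym M a) n ⁻¹' (edgeWords hM ha hb n L)) ≤
      (M : ENNReal)⁻¹ ^ L + (M : ENNReal)⁻¹ ^ L := by
    calc _ ≤ μ (𝐓^[n] ⁻¹' A ∪ 𝐓^[n] ⁻¹' B) := by
          refine measure_mono_ae ?_
          filter_upwards [alphaMeasure_c_pos hM ha hb, alphaMeasure_c_lt_one hM ha hb] with x h3 h4
          intro hx
          exact (mem_edgeWords hM ha hb).1 hx x rfl h3 h4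
      _ ≤ μ (𝐓^[n] ⁻¹' A) + μ (𝐓^[n] ⁻¹' B) := measure_union_le _ _
      _ = μ A + μ B := by
          rw [(hT.iterate n).measure_preimage hAm.nullMeasurableSet,
            (hT.iterate n).measure_preimage hBm.nullMeasurableSet]
      _ ≤ _ := add_le_add (alphaMeasure_c_lt_le hM ha hb L) (alphaMeasure_lt_c_le hM ha hb L)
  rw [← h1, measureReal_def]
  have hM0 : (M : ENNReal) ≠ 0 := by exact_mod_cast NeZero.ne M
  refine (ENNReal.toReal_mono (by finiteness) h2).trans_eq ?_
  rw [← two_mul, ENNReal.toReal_mul, ENNReal.toReal_pow, ENNReal.toReal_inv]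
  simp

/-- A word is realized by a `1`-unstable periodic point if it raises the height by at least `L` and
if none of its rotations is an edge word. -/
theorem exists_wordOf_eq {n L : ℕ} (hL : 1 ≤ L) {w : Fin n → Fin (M + 1)}
    (hα : ∃ i, w i ≠ Fin.last M) (hβ : ∃ i, w i = Fin.last M)
    (hh : (L : ℤ) ≤ ∑ i, stepHeight (w i))
    (hS : ∀ τ < n, rotateWord τ w ∉ edgeWords hM ha hb n L) :
    ∃ x ∈ interiorPer hM ha hb n, wordOf 𝐓 (sym M a) n x = w := by
  obtain ⟨iα, hα⟩ := hα
  obtain ⟨iβ, hβ⟩ := hβ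
  have hn : 1 ≤ n := iα.pos
  have hM' := two_le_cast hM
  have hM0 := cast_pos_of_two_le hM
  set ω : ℕ → Fin (M + 1) := fun i => w ⟨i % n, Nat.mod_lt _ hn⟩ with hω
  have hωw : ∀ i : Fin n, ω i = w i := fun i => by
    simp only [hω, Nat.mod_eq_of_lt i.isLt, Fin.eta]
  have hper : ∀ i, ω (i + n) = ω i := fun i => by simp only [hω, Nat.add_mod_right]
  have hωα : ∀ τ, τ ≤ n → ∃ i, ω (i + τ) ≠ Fin.last M := fun τ hτ =>
    ⟨iα + (n - τ), by rw [add_assoc, Nat.sub_add_cancel hτ, hper, hωw]; exact hα⟩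
  have hωβ : ∀ τ, τ ≤ n → ∃ i, ω (i + τ) = Fin.last M := fun τ hτ =>
    ⟨iβ + (n - τ), by rw [add_assoc, Nat.sub_add_cancel hτ, hper, hωw]; exact hβ⟩
  have hperk : ∀ k i, ω (i + k * n) = ω i := by
    intro k
    induction k with
    | zero => simp
    | succ k ih => intro i; rw [Nat.succ_mul, ← add_assoc, hper, ih]
  have hu1 : ∀ i, seqCode (uRate M a) (uShift M a) (shiftSeq^[i] ω) < 1 := by
    intro i
    refine lt_of_le_of_ne (seqCode_u_mem hM ha _).2 fun h => ?_
    have h2 := eq_last_of_seqCode_eq_one hM ha (iα + i * n - i) _ h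
    rw [shiftSeq_iterate, Nat.sub_add_cancel (le_add_left (Nat.le_mul_of_pos_right i hn)), hperk,
      hωw] at h2
    exact hα h2
  -- points with vanishing central and contracting coordinates and the itineraries `ω ∘ (· + τ)`
  set p : ℕ → cube := fun τ => mkCube (⟨_, seqCode_u_mem hM ha (shiftSeq^[τ] ω)⟩, 0, 0) with hp
  have hit : ∀ τ i, sym M a (𝐓^[i] (p τ)) = ω (i + τ) := fun τ i => by
    rw [(itinerary_of_seqCode hM ha hb (ω := shiftSeq^[τ] ω) (x := p τ) (fun j => by
      rw [← Function.iterate_add_apply]; exact hu1 _) rfl i).2, shiftSeq_iterate]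
  have hword : ∀ τ, wordOf 𝐓 (sym M a) n (p τ) = rotateWord τ w := fun τ => by
    funext i
    exact hit τ i
  have hrot0 : rotateWord 0 w = w := by
    funext i
    exact hωw i
  have hheight0 : (L : ℤ) ≤ height 𝐓 M a n (p 0) := by
    rw [height_eq_sum, hword 0, hrot0]
    exact hh
  obtain ⟨τ, hτ, hdepth⟩ := exists_depth_eq_zero hM ha hb hn (x := p 0) (fun i => by
    rw [← Function.iterate_add_apply, hit, hit, add_zero, add_zero, hper]) (by omega)
  have hwτ : wordOf 𝐓 (sym M a) n (𝐓^[τ] (p 0)) = wordOf 𝐓 (sym M a) n (p τ) :=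
    wordOf_eq_iff.2 fun i _ => by
      rw [← Function.iterate_add_apply, hit, hit, add_zero]
  rw [hwτ] at hdepth
  have hheight : (L : ℤ) ≤ height 𝐓 M a n (p τ) := by
    have h1 := height_add (M := M) (a := a) 𝐓 τ n (p 0)
    have h2 := height_add (M := M) (a := a) 𝐓 n τ (p 0)
    have h3 : height 𝐓 M a τ (𝐓^[n] (p 0)) = height 𝐓 M a τ (p 0) := by
      simp only [height, birkhoffSum]
      refine Finset.sum_congr rfl fun i _ => ?_
      rw [← Function.iterate_add_apply, hit, hit, add_zero, add_zero, hper]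
    rw [add_comm n τ, h1, h3] at h2
    rw [height_eq_sum, ← hwτ, ← height_eq_sum]
    linarith
  -- A point `y` that ends at distance at least `M ^ (-L)` from the edges shows that the stack written
  -- by the word is neither empty nor full.
  have hnot := hS τ hτ
  rw [mem_edgeWords] at hnot
  push Not at hnot
  obtain ⟨y, hyw, hy0, hy1, hyL, hyR⟩ := hnot
  rw [← hword τ] at hyw
  have hrel := (sub_iterate_eq hM ha hb n 0 y (p τ) hyw (by rw [hyw]; exact hdepth.le)
    (floor_eq_of_lt_one hy1 one_pos)).1
  rw [height_eq_sum, hyw, ← height_eq_sum] at hrel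
  have hpc : (p τ).1.2.1 = 0 := rfl
  rw [hpc, sub_zero] at hrel
  set h := height 𝐓 M a n (p τ) with hhdef
  have hq : (M : ℝ) ^ (-h) ≤ ((M : ℝ) ^ L)⁻¹ := by
    rw [← zpow_natCast, ← zpow_neg]
    exact zpow_le_zpow_right₀ (by linarith) (by omega)
  have hq0 : 0 < (M : ℝ) ^ (-h) := zpow_pos hM0 _
  have hqh : (M : ℝ) ^ h * (M : ℝ) ^ (-h) = 1 := by
    rw [← zpow_add₀ hM0.ne', add_neg_cancel, zpow_zero]
  have hrel' : (𝐓^[n] y).1.2.1 - (𝐓^[n] (p τ)).1.2.1 = y.1.2.1 * (M : ℝ) ^ (-h) := by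
    rw [← hrel, mul_assoc, hqh, mul_one]
  obtain ⟨x, hx, hxs⟩ := exists_mem_interiorPer hM ha hb hn (ω := shiftSeq^[τ] ω) (x₀ := p τ)
    (fun i => by rw [shiftSeq_iterate, shiftSeq_iterate, add_right_comm, hper])
    (by simpa only [shiftSeq_iterate] using hωα τ hτ.le)
    (by simpa only [shiftSeq_iterate] using hωβ τ hτ.le) rfl hdepth
    (by nlinarith) (by nlinarith)
  refine ⟨𝐓^[n - τ] x, iterate_mem_interiorPer hM ha hb hx _, ?_⟩
  funext i
  rw [wordOf, ← Function.iterate_add_apply, hxs, shiftSeq_iterate, add_assoc,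
    Nat.sub_add_cancel hτ.le, hper, hωw]

/-- The `1`-unstable periodic points of period `n`. -/
def posPer (n : ℕ) : Set cube := {x | x ∈ interiorPer hM ha hb n ∧ 0 < height 𝐓 M a n x}

theorem injOn_wordOf {n : ℕ} (hn : 1 ≤ n) :
    InjOn (wordOf 𝐓 (sym M a) n) (posPer hM ha hb n) :=
  fun _ hx _ hy h => eq_of_wordOf_eq hM ha hb hn hx.1 hy.1 hx.2 h

theorem finite_posPer {n : ℕ} (hn : 1 ≤ n) : (posPer hM ha hb n).Finite :=
  Finite.of_injOn (mapsTo_univ _ _) (injOn_wordOf hM ha hb hn) finite_univ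

theorem ncard_posPer_le {n : ℕ} (hn : 1 ≤ n) : (posPer hM ha hb n).ncard ≤ (M + 1) ^ n := by
  have h := ncard_le_ncard_of_injOn (wordOf 𝐓 (sym M a) n) (fun x _ => mem_univ _)
    (injOn_wordOf hM ha hb hn) finite_univ
  rw [ncard_univ, Nat.card_eq_fintype_card] at h
  simpa using h

/-- The words that are not realized have a small height, or never pop, or have a rotation that is an
edge word. -/
theorem le_ncard_posPer {n L : ℕ} (hn : 1 ≤ n) (hL : 1 ≤ L) :
    (M + 1) ^ n ≤ (posPer hM ha hb n).ncard +
      (Finset.univ.filter fun w : Fin n → Fin (M + 1) => ∑ i, stepHeight (w i) < (L : ℤ)).card +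
      M ^ n + n * (edgeWords hM ha hb n L).card := by
  classical
  set F := (finite_posPer hM ha hb hn).toFinset with hF
  have hFc : F.card = (posPer hM ha hb n).ncard := (ncard_eq_toFinset_card _ _).symm
  set A := F.image (wordOf 𝐓 (sym M a) n)
  set B := Finset.univ.filter fun w : Fin n → Fin (M + 1) => ∑ i, stepHeight (w i) < (L : ℤ)
  set C : Finset (Fin n → Fin (M + 1)) :=
    Fintype.piFinset fun _ => Finset.univ.erase (Fin.last M) with hC
  set D : Finset (Fin n → Fin (M + 1)) := (Finset.range n).biUnion fun τ =>
    Finset.univ.filter fun w => rotateWord τ w ∈ edgeWords hM ha hb n L with hD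
  have hcover : (Finset.univ : Finset (Fin n → Fin (M + 1))) ⊆ A ∪ B ∪ C ∪ D := by
    intro w _
    by_contra hw
    simp only [Finset.mem_union, not_or] at hw
    obtain ⟨⟨⟨hA, hB⟩, hC'⟩, hD'⟩ := hw
    have hB' : (L : ℤ) ≤ ∑ i, stepHeight (w i) := by
      by_contra hlt
      exact hB (Finset.mem_filter.2 ⟨Finset.mem_univ _, not_le.1 hlt⟩)
    have hβ : ∃ i, w i = Fin.last M := by
      by_contra hne
      push Not at hne
      exact hC' (Fintype.mem_piFinset.2 fun i => Finset.mem_erase.2 ⟨hne i, Finset.mem_univ _⟩)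
    have hα : ∃ i, w i ≠ Fin.last M := by
      by_contra hne
      push Not at hne
      have : ∑ i, stepHeight (w i) ≤ 0 := Finset.sum_nonpos fun i _ => by
        rw [hne i, stepHeight]
        simp
      omega
    obtain ⟨x, hx, hxw⟩ := exists_wordOf_eq hM ha hb hL hα hβ hB' fun τ hτ hS => hD' <|
      Finset.mem_biUnion.2 ⟨τ, Finset.mem_range.2 hτ,
        Finset.mem_filter.2 ⟨Finset.mem_univ _, hS⟩⟩
    refine hA (Finset.mem_image.2 ⟨x, ?_, hxw⟩)
    rw [hF, Finite.mem_toFinset]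
    refine ⟨hx, ?_⟩
    rw [height_eq_sum, hxw]
    omega
  have hCc : C.card = M ^ n := by
    rw [hC, Fintype.card_piFinset_const, Finset.card_erase_of_mem (Finset.mem_univ _)]
    simp
  have hDc : D.card ≤ n * (edgeWords hM ha hb n L).card := by
    refine (Finset.card_biUnion_le_card_mul _ _ (edgeWords hM ha hb n L).card fun τ hτ => ?_).trans
      (by rw [Finset.card_range])
    refine Finset.card_le_card_of_injOn (rotateWord τ) (fun w hw => (Finset.mem_filter.1 hw).2)
      (rotateWord_injective (Finset.mem_range.1 hτ)).injOn
  have hAc : A.card ≤ (posPer hM ha hb n).ncard := hFc ▸ Finset.card_image_le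
  have h1 := Finset.card_le_card hcover
  have h2 := Finset.card_union_le (A ∪ B ∪ C) D
  have h3 := Finset.card_union_le (A ∪ B) C
  have h4 := Finset.card_union_le A B
  have h5 : (Finset.univ : Finset (Fin n → Fin (M + 1))).card = (M + 1) ^ n := by simp
  omega

theorem tendsto_natSqrt_atTop : Tendsto Nat.sqrt atTop atTop :=
  tendsto_atTop_atTop.2 fun k => ⟨k * k, fun _ hn => Nat.le_sqrt.2 hn⟩

/-- Almost all words are realized by `1`-unstable periodic points. -/
theorem tendsto_ncard_posPer :
    Tendsto (fun n => ((posPer hM ha hb n).ncard : ℝ) * ((M : ℝ) + 1)⁻¹ ^ n) atTop (𝓝 1) := by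
  have hM' := two_le_cast hM
  have hM0 := cast_pos_of_two_le hM
  have hM1 : (0 : ℝ) < (M : ℝ) + 1 := by linarith
  set d := driftRate M with hd
  have hd0 : 0 ≤ d := driftRate_nonneg
  have hd1 : d < 1 := driftRate_lt_one hM
  have hcancel : ∀ n : ℕ, ((M : ℝ) + 1) ^ n * ((M : ℝ) + 1)⁻¹ ^ n = 1 := fun n => by
    rw [← mul_pow, mul_inv_cancel₀ hM1.ne', one_pow]
  -- the words that raise the height by less than `√n`
  have hB : Tendsto (fun n : ℕ => (3 / 2 : ℝ) ^ n.sqrt * d ^ n) atTop (𝓝 0) := by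
    have h1 : Tendsto (fun s : ℕ => (3 / 2 : ℝ) * d ^ s) atTop (𝓝 0) := by
      simpa using (tendsto_pow_atTop_nhds_zero_of_lt_one hd0 hd1).const_mul (3 / 2 : ℝ)
    have h2 : Tendsto (fun s : ℕ => (1 / 2 : ℝ) ^ s) atTop (𝓝 0) :=
      tendsto_pow_atTop_nhds_zero_of_lt_one (by norm_num) (by norm_num)
    have h3 := h2.comp tendsto_natSqrt_atTop
    have h4 := tendsto_natSqrt_atTop.eventually (h1.eventually
      (Iic_mem_nhds (show (0 : ℝ) < 1 / 2 by norm_num)))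
    refine squeeze_zero' (Eventually.of_forall fun n => by positivity) ?_ h3
    filter_upwards [h4] with n hn
    calc (3 / 2 : ℝ) ^ n.sqrt * d ^ n ≤ (3 / 2 : ℝ) ^ n.sqrt * d ^ (n.sqrt * n.sqrt) := by
          refine mul_le_mul_of_nonneg_left ?_ (by positivity)
          exact pow_le_pow_of_le_one hd0 hd1.le (Nat.sqrt_le n)
      _ = ((3 / 2 : ℝ) * d ^ n.sqrt) ^ n.sqrt := by rw [pow_mul, mul_pow]
      _ ≤ (1 / 2 : ℝ) ^ n.sqrt := pow_le_pow_left₀ (by positivity) hn _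
  -- the words without popping
  have hC : Tendsto (fun n : ℕ => (M : ℝ) ^ n * ((M : ℝ) + 1)⁻¹ ^ n) atTop (𝓝 0) := by
    simp only [← mul_pow]
    refine tendsto_pow_atTop_nhds_zero_of_lt_one (by positivity) ?_
    rw [← div_eq_mul_inv, div_lt_one hM1]
    linarith
  -- the words with a rotation that is an edge word for `L = √n`
  have hD : Tendsto (fun n : ℕ => (n : ℝ) * (2 * ((M : ℝ) ^ n.sqrt)⁻¹)) atTop (𝓝 0) := by
    have h1 : Tendsto (fun s : ℕ => 8 * ((s : ℝ) ^ 2 * (1 / 2 : ℝ) ^ s)) atTop (𝓝 0) := by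
      simpa using (tendsto_pow_const_mul_const_pow_of_abs_lt_one 2
        (r := (1 / 2 : ℝ)) (by rw [abs_of_pos] <;> norm_num)).const_mul (8 : ℝ)
    have h2 := h1.comp tendsto_natSqrt_atTop
    refine squeeze_zero' (Eventually.of_forall fun n => by positivity) ?_ h2
    filter_upwards [eventually_ge_atTop 1] with n hn
    have hs : 1 ≤ n.sqrt := Nat.le_sqrt.2 (by omega)
    have h3 : n ≤ 4 * n.sqrt ^ 2 := by nlinarith [Nat.sqrt_le_add n]
    have h4 : (n : ℝ) ≤ 4 * (n.sqrt : ℝ) ^ 2 := by exact_mod_cast h3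
    have h5 : ((M : ℝ) ^ n.sqrt)⁻¹ ≤ (1 / 2 : ℝ) ^ n.sqrt := by
      rw [one_div, inv_pow]
      exact inv_anti₀ (by positivity) (pow_le_pow_left₀ (by norm_num) hM' _)
    calc (n : ℝ) * (2 * ((M : ℝ) ^ n.sqrt)⁻¹)
        ≤ (4 * (n.sqrt : ℝ) ^ 2) * (2 * (1 / 2 : ℝ) ^ n.sqrt) := by gcongr
      _ = 8 * ((n.sqrt : ℝ) ^ 2 * (1 / 2 : ℝ) ^ n.sqrt) := by ring
  have hlow := ((tendsto_const_nhds (x := (1 : ℝ))).sub hB).sub hC |>.sub hD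
  simp only [sub_zero] at hlow
  refine tendsto_of_tendsto_of_tendsto_of_le_of_le' hlow tendsto_const_nhds ?_ ?_
  · filter_upwards [eventually_ge_atTop 1] with n hn
    have hs : 1 ≤ n.sqrt := Nat.le_sqrt.2 (by omega)
    have h1 := (Nat.cast_le (α := ℝ)).2 (le_ncard_posPer hM ha hb hn hs)
    push_cast at h1
    have h2 := mul_le_mul_of_nonneg_right h1 (pow_nonneg (inv_nonneg.2 hM1.le) n)
    rw [hcancel, add_mul, add_mul, add_mul, mul_assoc] at h2
    have h3 := card_height_lt_le (M := M) n n.sqrt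
    have h4 := mul_le_mul_of_nonneg_left (card_edgeWords_le hM ha hb n n.sqrt)
      (Nat.cast_nonneg (α := ℝ) n)
    linarith
  · filter_upwards [eventually_ge_atTop 1] with n hn
    refine (mul_le_mul_of_nonneg_right ?_ (by positivity)).trans_eq (hcancel n)
    exact_mod_cast ncard_posPer_le hM ha hb hn

end Counting

/-! ### Equidistribution of periodic points -/

section Uniform

variable {X : Type*} [MeasurableSpace X] [MeasurableSingletonClass X] {S : Set X}

theorem uniformOn_real_apply (hS : S.Finite) (A : Set X) :
    (ProbabilityTheory.uniformOn S).real A = ((S ∩ A).ncard : ℝ) / S.ncard := by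
  rw [measureReal_def, ProbabilityTheory.uniformOn, ProbabilityTheory.cond_apply hS.measurableSet,
    Measure.count_apply_finite _ hS, Measure.count_apply_finite _ (hS.inter_of_left A),
    ← ncard_eq_toFinset_card _ hS,
    ← ncard_eq_toFinset_card _ (hS.inter_of_left A), ENNReal.toReal_mul, ENNReal.toReal_inv,
    ENNReal.toReal_natCast, ENNReal.toReal_natCast, div_eq_inv_mul]

theorem integral_uniformOn (hS : S.Finite) (φ : X → ℝ) :
    ∫ x, φ x ∂ProbabilityTheory.uniformOn S = uniformAverage S φ := by
  rw [ProbabilityTheory.uniformOn, ProbabilityTheory.cond, integral_smul_measure,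
    Measure.count_apply_finite _ hS, ← ncard_eq_toFinset_card _ hS, uniformAverage, div_eq_inv_mul,
    ENNReal.toReal_inv, ENNReal.toReal_natCast, smul_eq_mul, finsum_mem_eq_finite_toFinset_sum _ hS]
  congr 1
  have hi : IntegrableOn φ (hS.toFinset : Set X) Measure.count := by
    rw [hS.coe_toFinset, ← biUnion_of_singleton S, integrableOn_finite_biUnion hS]
    simp
  have h := setIntegral_finset hS.toFinset hi
  rw [hS.coe_toFinset] at h
  rw [h]
  refine Finset.sum_congr rfl fun x _ => ?_
  rw [measureReal_def, Measure.count_singleton, ENNReal.toReal_one, one_smul]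

theorem measurePreserving_uniformOn (hS : S.Finite) (hS' : S.Nonempty) {T : X → X}
    (hT : Measurable T) (h : BijOn T S S) :
    MeasurePreserving T (ProbabilityTheory.uniformOn S) (ProbabilityTheory.uniformOn S) := by
  have := ProbabilityTheory.isProbabilityMeasure_uniformOn hS hS'
  have := Measure.isProbabilityMeasure_map (μ := ProbabilityTheory.uniformOn S) hT.aemeasurable
  refine ⟨hT, Measure.ext fun A hA => ?_⟩
  rw [← measureReal_eq_measureReal_iff, map_measureReal_apply hT hA,
    uniformOn_real_apply hS, uniformOn_real_apply hS]
  congr 2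
  rw [← (h.injOn.mono inter_subset_left).ncard_image, image_inter_preimage, h.image_eq]

end Uniform

theorem uniformAverage_image {X Y : Type*} {f : X → Y} (hf : Function.Injective f) (S : Set X)
    (φ : Y → ℝ) : uniformAverage (f '' S) φ = uniformAverage S fun x => φ (f x) := by
  rw [uniformAverage, uniformAverage, finsum_mem_image hf.injOn, ncard_image_of_injective _ hf]

theorem uniformAverage_union {X : Type*} {S S' : Set X} (hS : S.Finite) (hS' : S'.Finite)
    (h : Disjoint S S') (φ : X → ℝ) :
    uniformAverage (S ∪ S') φ = (S.ncard * uniformAverage S φ + S'.ncard * uniformAverage S' φ) /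
      ((S.ncard : ℝ) + S'.ncard) := by
  have key : ∀ U : Set X, U.Finite → (U.ncard : ℝ) * uniformAverage U φ = ∑ᶠ x ∈ U, φ x := by
    intro U hU
    rcases U.eq_empty_or_nonempty with rfl | hne
    · simp
    · have : (U.ncard : ℝ) ≠ 0 := by exact_mod_cast (ncard_pos hU).2 hne |>.ne'
      rw [uniformAverage, mul_div_cancel₀ _ this]
  rw [key S hS, key S' hS', uniformAverage, finsum_mem_union h hS hS', ncard_union_eq h hS hS']
  push_cast
  rfl

/-- Pointwise upper bounds with asymptotically the same total are limits. -/
theorem tendsto_of_le_of_tendsto_sum {ι κ : Type*} [Fintype ι] {l : Filter κ} {f : κ → ι → ℝ}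
    {g : ι → ℝ} (hfg : ∀ᶠ n in l, ∀ i, f n i ≤ g i)
    (hsum : Tendsto (fun n => ∑ i, f n i) l (𝓝 (∑ i, g i))) (i : ι) :
    Tendsto (fun n => f n i) l (𝓝 (g i)) := by
  have h1 : Tendsto (fun n => g i - (∑ j, g j - ∑ j, f n j)) l (𝓝 (g i)) := by
    have := (tendsto_const_nhds (x := g i)).sub ((tendsto_const_nhds (x := ∑ j, g j)).sub hsum)
    simpa using this
  refine tendsto_of_tendsto_of_tendsto_of_le_of_le' h1 tendsto_const_nhds ?_
    (hfg.mono fun n h => h i)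
  filter_upwards [hfg] with n h
  have h2 := Finset.single_le_sum (f := fun j => g j - f n j) (fun j _ => sub_nonneg.2 (h j))
    (Finset.mem_univ i)
  rw [Finset.sum_sub_distrib] at h2
  linarith

section Equidistribution

variable {M : ℕ} {a b : ℝ}

variable (hM : 2 ≤ M) (ha : a ∈ Ioo 0 (1 / (M : ℝ))) (hb : b ∈ Ioo 0 (1 / (M : ℝ)))

local notation "𝐓" => bakerMap M a b hM ha hb

theorem bijOn_posPer {n : ℕ} (hn : 1 ≤ n) : BijOn 𝐓 (posPer hM ha hb n) (posPer hM ha hb n) := by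
  obtain ⟨k, rfl⟩ := Nat.exists_eq_add_of_le' hn
  have hmem : ∀ x ∈ posPer hM ha hb (k + 1), ∀ i, 𝐓^[i] x ∈ posPer hM ha hb (k + 1) :=
    fun x hx i => ⟨iterate_mem_interiorPer hM ha hb hx.1 i, by
      rw [height_iterate hM ha hb hx.1.1]
      exact hx.2⟩
  refine ⟨fun x hx => hmem x hx 1, fun x hx y hy h => ?_, fun y hy => ⟨𝐓^[k] y, hmem y hy k, ?_⟩⟩
  · rw [← hx.1.1, ← hy.1.1, Function.iterate_succ_apply, Function.iterate_succ_apply, h]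
  · rw [← Function.iterate_succ_apply' 𝐓]
    exact hy.1.1

theorem eventually_ncard_posPer_ne_zero : ∀ᶠ n in atTop, (posPer hM ha hb n).ncard ≠ 0 := by
  filter_upwards [(tendsto_ncard_posPer hM ha hb).eventually
    (Ioi_mem_nhds (show (0 : ℝ) < 1 by norm_num))] with n hn h0
  rw [h0, Nat.cast_zero, zero_mul] at hn
  exact lt_irrefl _ hn

/-- Periodic points with the same first `m` letters are distinguished by the remaining ones. -/
theorem ncard_posPer_inter_le (m k : ℕ) (hn : 1 ≤ m + k) (w : Fin m → Fin (M + 1)) :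
    (posPer hM ha hb (m + k) ∩ wordOf 𝐓 (sym M a) m ⁻¹' {w}).ncard ≤ (M + 1) ^ k := by
  have h := ncard_le_ncard_of_injOn (s := posPer hM ha hb (m + k) ∩ wordOf 𝐓 (sym M a) m ⁻¹' {w})
    (t := univ) (fun x => wordOf 𝐓 (sym M a) k (𝐓^[m] x)) (fun x _ => mem_univ _) (by
      intro x hx y hy h
      have hx2 : wordOf 𝐓 (sym M a) m x = w := hx.2
      have hy2 : wordOf 𝐓 (sym M a) m y = w := hy.2
      refine injOn_wordOf hM ha hb hn hx.1 hy.1 ?_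
      simp only at h
      rw [wordOf_append, wordOf_append, h, hx2, hy2]) finite_univ
  rw [ncard_univ, Nat.card_eq_fintype_card] at h
  simpa using h

/-- The words read at the `1`-unstable periodic points become uniformly distributed. -/
theorem tendsto_law_posPer (m : ℕ) (w : Fin m → Fin (M + 1)) :
    Tendsto (fun n => (ProbabilityTheory.uniformOn (posPer hM ha hb n)).real
      (wordOf 𝐓 (sym M a) m ⁻¹' {w})) atTop (𝓝 (((M : ℝ) + 1)⁻¹ ^ m)) := by
  have hM1 : (0 : ℝ) < (M : ℝ) + 1 := by positivity
  have hw := measurable_wordOf (measurable_bakerMap hM ha hb)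
    (measurable_sym (M := M) (a := a)) m
  have hp := tendsto_ncard_posPer hM ha hb
  have hlaw : ∀ n, 1 ≤ n → ∀ v, (ProbabilityTheory.uniformOn (posPer hM ha hb n)).real
      (wordOf 𝐓 (sym M a) m ⁻¹' {v}) =
      ((posPer hM ha hb n ∩ wordOf 𝐓 (sym M a) m ⁻¹' {v}).ncard : ℝ) /
        (posPer hM ha hb n).ncard := fun n hn v =>
    uniformOn_real_apply (finite_posPer hM ha hb hn) _
  -- Normalized by `(M + 1) ^ n` in place of the number of periodic points, the frequencies of the
  -- words of length `m` are bounded by `(M + 1) ^ (-m)`, and their sum tends to `1`.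
  have key : Tendsto (fun n => (ProbabilityTheory.uniformOn (posPer hM ha hb n)).real
      (wordOf 𝐓 (sym M a) m ⁻¹' {w}) * ((posPer hM ha hb n).ncard * ((M : ℝ) + 1)⁻¹ ^ n)) atTop
      (𝓝 (((M : ℝ) + 1)⁻¹ ^ m)) := by
    refine tendsto_of_le_of_tendsto_sum (f := fun n v =>
      (ProbabilityTheory.uniformOn (posPer hM ha hb n)).real (wordOf 𝐓 (sym M a) m ⁻¹' {v}) *
        ((posPer hM ha hb n).ncard * ((M : ℝ) + 1)⁻¹ ^ n))
      (g := fun _ => ((M : ℝ) + 1)⁻¹ ^ m) ?_ ?_ w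
    · filter_upwards [eventually_ge_atTop 1, eventually_ge_atTop m,
        eventually_ncard_posPer_ne_zero hM ha hb] with n hn hm hne v
      obtain ⟨k, rfl⟩ := Nat.exists_eq_add_of_le hm
      have hne' : ((posPer hM ha hb (m + k)).ncard : ℝ) ≠ 0 := by exact_mod_cast hne
      rw [hlaw _ hn, ← mul_assoc, div_mul_cancel₀ _ hne']
      have h1 : ((posPer hM ha hb (m + k) ∩ wordOf 𝐓 (sym M a) m ⁻¹' {v}).ncard : ℝ) ≤
          ((M : ℝ) + 1) ^ k := by exact_mod_cast ncard_posPer_inter_le hM ha hb m k hn v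
      calc _ ≤ ((M : ℝ) + 1) ^ k * ((M : ℝ) + 1)⁻¹ ^ (m + k) :=
            mul_le_mul_of_nonneg_right h1 (by positivity)
        _ = ((M : ℝ) + 1)⁻¹ ^ m := by
            rw [pow_add, mul_left_comm, ← mul_pow, mul_inv_cancel₀ hM1.ne', one_pow, mul_one]
    · have h1 : ∑ _v : Fin m → Fin (M + 1), ((M : ℝ) + 1)⁻¹ ^ m = 1 := by
        rw [Finset.sum_const, Finset.card_univ, Fintype.card_fun, Fintype.card_fin,
          Fintype.card_fin, nsmul_eq_mul]
        push_cast
        rw [← mul_pow, mul_inv_cancel₀ hM1.ne', one_pow]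
      rw [h1]
      refine hp.congr' ?_
      filter_upwards [eventually_ge_atTop 1, eventually_ncard_posPer_ne_zero hM ha hb] with n hn hne
      have := ProbabilityTheory.isProbabilityMeasure_uniformOn (finite_posPer hM ha hb hn)
        (nonempty_of_ncard_ne_zero hne)
      rw [← Finset.sum_mul, sum_law hw, one_mul]
  have h2 := key.div hp one_ne_zero
  rw [div_one] at h2
  refine h2.congr' ?_
  filter_upwards [eventually_ncard_posPer_ne_zero hM ha hb] with n hne
  have hne' : ((posPer hM ha hb n).ncard : ℝ) ≠ 0 := by exact_mod_cast hne
  exact mul_div_cancel_right₀ _ (mul_ne_zero hne' (by positivity))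

theorem tendsto_uniformAverage_posPer [NeZero M] {φ : cube → ℝ} (hφ : Continuous φ) :
    Tendsto (fun n => uniformAverage (posPer hM ha hb n) φ) atTop
      (𝓝 (∫ x, φ x ∂alphaMeasure M a b)) := by
  refine (tendsto_integral_alphaMeasure hM ha hb
    (μ := fun n => ProbabilityTheory.uniformOn (posPer hM ha hb n)) ?_
    (tendsto_law_posPer hM ha hb) hφ).congr' ?_
  · filter_upwards [eventually_ge_atTop 1, eventually_ncard_posPer_ne_zero hM ha hb] with n hn hne
    have hfin := finite_posPer hM ha hb hn
    have hnonempty := nonempty_of_ncard_ne_zero hne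
    refine ⟨ProbabilityTheory.isProbabilityMeasure_uniformOn hfin hnonempty,
      measurePreserving_uniformOn hfin hnonempty (measurable_bakerMap hM ha hb)
        (bijOn_posPer hM ha hb hn), ?_⟩
    have h1 : ∀ᵐ x ∂ProbabilityTheory.uniformOn (posPer hM ha hb n), x ∈ posPer hM ha hb n :=
      ProbabilityTheory.ae_cond_mem hfin.measurableSet
    filter_upwards [h1] with x hx
    exact (mem_openCube_of_openDomain hM ha (hx.1.2 0)).2.1.2
  · filter_upwards [eventually_ge_atTop 1] with n hn
    exact integral_uniformOn (finite_posPer hM ha hb hn) φ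

theorem unstablePer_one_eq {n : ℕ} (hn : 1 ≤ n) :
    unstablePer M a b hM ha hb 1 n = posPer hM ha hb n := by
  ext x
  rw [mem_unstablePer_iff hM ha hb hn]
  refine ⟨fun ⟨h1, _, h3⟩ => ⟨h1, ?_⟩, fun h => ⟨h.1, h.2.ne', (if_pos h.2).symm⟩⟩
  by_contra h
  rw [if_neg h] at h3
  exact absurd h3 (by norm_num)

/-- The `2`-unstable periodic points are the time reversals of the `1`-unstable ones of the map with
swapped parameters. -/
theorem unstablePer_two_eq {n : ℕ} (hn : 1 ≤ n) :
    unstablePer M a b hM ha hb 2 n = flipCube '' posPer hM hb ha n := by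
  ext x
  rw [mem_unstablePer_iff hM ha hb hn]
  constructor
  · rintro ⟨h1, h2, h3⟩
    obtain ⟨h4, h5⟩ := flipCube_mem_interiorPer hM ha hb hn h1
    refine ⟨flipCube x, ⟨h4, ?_⟩, flipCube_flipCube x⟩
    have h6 : ¬ 0 < height 𝐓 M a n x := fun h => by
      rw [if_pos h] at h3
      exact absurd h3 (by norm_num)
    omega
  · rintro ⟨y, hy, rfl⟩
    obtain ⟨h4, h5⟩ := flipCube_mem_interiorPer hM hb ha hn hy.1
    have h6 := hy.2
    exact ⟨h4, by omega, (if_neg (by omega)).symm⟩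

theorem disjoint_unstablePer {n : ℕ} (hn : 1 ≤ n) :
    Disjoint (unstablePer M a b hM ha hb 1 n) (unstablePer M a b hM ha hb 2 n) := by
  refine Set.disjoint_left.2 fun x h1 h2 => ?_
  have h3 := ((mem_unstablePer_iff hM ha hb hn).1 h1).2.2
  have h4 := ((mem_unstablePer_iff hM ha hb hn).1 h2).2.2
  omega

theorem finite_unstablePer_one {n : ℕ} (hn : 1 ≤ n) :
    (unstablePer M a b hM ha hb 1 n).Finite := by
  rw [unstablePer_one_eq hM ha hb hn]
  exact finite_posPer hM ha hb hn

theorem finite_unstablePer_two {n : ℕ} (hn : 1 ≤ n) :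
    (unstablePer M a b hM ha hb 2 n).Finite := by
  rw [unstablePer_two_eq hM ha hb hn]
  exact (finite_posPer hM hb ha hn).image _

theorem tendsto_uniformAverage_one [NeZero M] {φ : cube → ℝ} (hφ : Continuous φ) :
    Tendsto (fun n => uniformAverage (unstablePer M a b hM ha hb 1 n) φ) atTop
      (𝓝 (∫ x, φ x ∂alphaMeasure M a b)) := by
  refine (tendsto_uniformAverage_posPer hM ha hb hφ).congr' ?_
  filter_upwards [eventually_ge_atTop 1] with n hn
  rw [unstablePer_one_eq hM ha hb hn]

theorem tendsto_uniformAverage_two [NeZero M] {φ : cube → ℝ} (hφ : Continuous φ) :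
    Tendsto (fun n => uniformAverage (unstablePer M a b hM ha hb 2 n) φ) atTop
      (𝓝 (∫ x, φ x ∂betaMeasure M a b)) := by
  rw [betaMeasure, integral_map flipCube.measurable.aemeasurable
    hφ.measurable.aestronglyMeasurable]
  refine (tendsto_uniformAverage_posPer hM hb ha (hφ.comp continuous_flipCube)).congr' ?_
  filter_upwards [eventually_ge_atTop 1] with n hn
  rw [unstablePer_two_eq hM ha hb hn, uniformAverage_image flipCube.injective]
  rfl

theorem tendsto_uniformAverage_union [NeZero M] {φ : cube → ℝ} (hφ : Continuous φ) :
    Tendsto (fun n => uniformAverage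
        (unstablePer M a b hM ha hb 1 n ∪ unstablePer M a b hM ha hb 2 n) φ) atTop
      (𝓝 ((1 / 2) * ∫ x, φ x ∂alphaMeasure M a b + (1 / 2) * ∫ x, φ x ∂betaMeasure M a b)) := by
  have hp := tendsto_ncard_posPer hM ha hb
  have hp' := tendsto_ncard_posPer hM hb ha
  have h1 := tendsto_uniformAverage_one hM ha hb hφ
  have h2 := tendsto_uniformAverage_two hM ha hb hφ
  have h3 := ((hp.mul h1).add (hp'.mul h2)).div (hp.add hp') (by norm_num)
  have h4 : (1 * ∫ x, φ x ∂alphaMeasure M a b + 1 * ∫ x, φ x ∂betaMeasure M a b) / (1 + 1) =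
      (1 / 2) * ∫ x, φ x ∂alphaMeasure M a b + (1 / 2) * ∫ x, φ x ∂betaMeasure M a b := by ring
  rw [← h4]
  refine h3.congr' ?_
  filter_upwards [eventually_ge_atTop 1] with n hn
  have hr : ((M : ℝ) + 1)⁻¹ ^ n ≠ 0 := by positivity
  simp only [Pi.div_apply]
  rw [uniformAverage_union (finite_unstablePer_one hM ha hb hn)
    (finite_unstablePer_two hM ha hb hn) (disjoint_unstablePer hM ha hb hn),
    ← unstablePer_one_eq hM ha hb hn, ← ncard_image_of_injective (posPer hM hb ha n)
    flipCube.injective, ← unstablePer_two_eq hM ha hb hn]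
  rw [mul_right_comm, mul_right_comm _ (((M : ℝ) + 1)⁻¹ ^ n), ← add_mul, ← add_mul,
    mul_div_mul_right _ _ hr]

end Equidistribution

end Heterochaos

end

open Heterochaos in
theorem theorem1p1 (M : ℕ) (a b : ℝ) (hM : 2 ≤ M) (ha : a ∈ Set.Ioo 0 (1 / (M : ℝ)))
    (hb : b ∈ Set.Ioo 0 (1 / (M : ℝ))) :
    ∃ μα μβ : MeasureTheory.Measure cube,
      -- `μα` and `μβ` are the two ergodic measures of maximal entropy, suitably labelled
      μα ≠ μβ ∧
      (∀ μ : MeasureTheory.Measure cube,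
        IsErgodicMME (bakerMap M a b hM ha hb) μ ↔ μ = μα ∨ μ = μβ) ∧
      measureEntropy μα (bakerMap M a b hM ha hb) = ENNReal.ofReal (Real.log (M + 1)) ∧
      measureEntropy μβ (bakerMap M a b hM ha hb) = ENNReal.ofReal (Real.log (M + 1)) ∧
      (∀ k : Fin M, μα {x | (x : ℝ × ℝ × ℝ) ∈ domAlpha M a k} = 1 / ((M : ENNReal) + 1)) ∧
      (∀ k : Fin M, μβ {x | (x : ℝ × ℝ × ℝ) ∈ domBeta M a k} = 1 / ((M : ENNReal) + 1)) ∧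
      -- the sets of periodic points are finite
      (∀ n : ℕ, 1 ≤ n → (unstablePer M a b hM ha hb 1 n).Finite ∧
        (unstablePer M a b hM ha hb 2 n).Finite) ∧
      -- convergence of the averages
      ∀ φ : cube → ℝ, Continuous φ →
        Filter.Tendsto (fun n : ℕ => uniformAverage (unstablePer M a b hM ha hb 1 n) φ)
          Filter.atTop (nhds (∫ x, φ x ∂μα)) ∧
        Filter.Tendsto (fun n : ℕ => uniformAverage (unstablePer M a b hM ha hb 2 n) φ)
          Filter.atTop (nhds (∫ x, φ x ∂μβ)) ∧
        Filter.Tendsto (fun n : ℕ => uniformAverage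
            (unstablePer M a b hM ha hb 1 n ∪ unstablePer M a b hM ha hb 2 n) φ)
          Filter.atTop (nhds ((1 / 2) * ∫ x, φ x ∂μα + (1 / 2) * ∫ x, φ x ∂μβ)) := by
  have : NeZero M := ⟨by omega⟩
  exact ⟨alphaMeasure M a b, betaMeasure M a b, alphaMeasure_ne_betaMeasure hM ha hb,
    fun μ => isErgodicMME_iff hM ha hb, measureEntropy_alphaMeasure hM ha hb,
    measureEntropy_betaMeasure hM ha hb, alphaMeasure_domAlpha hM ha hb,
    betaMeasure_domBeta hM ha hb,
    fun n hn => ⟨finite_unstablePer_one hM ha hb hn, finite_unstablePer_two hM ha hb hn⟩,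
    fun φ hφ => ⟨tendsto_uniformAverage_one hM ha hb hφ, tendsto_uniformAverage_two hM ha hb hφ,
      tendsto_uniformAverage_union hM ha hb hφ⟩⟩
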